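/- Let $\Phi_0$ be a strictly plurisubharmonic (real) quadratic form on $\mathbb C^n$ and let $\Lambda_{\Phi_0}=\{(x,\tfrac{2}{i}\tfrac{\partial\Phi_0}{\partial x}(x)) : x\in\mathbb C^n\}\subset\mathbb C^{2n}$, identified with $\mathbb C^n\cong\mathbb R^{2n}$ through $(x,\xi)\mapsto x$. For $s>1$, $\mathcal G^s_b(\mathbb R^d)$ is the set of $u\in C^\infty(\mathbb R^d;\mathbb C)$ with $|\partial^\alpha u|\le M^{1+|\alpha|}\alpha!^s$ on $\mathbb R^d$ for all $\alpha$ and some $M>0$. For a real weight $\Phi$ and $h>0$ put $H_\Phi=\mathrm{Hol}(\mathbb C^n)\cap L^2(\mathbb C^n,e^{-2\Phi/h}L(dx))$, with the $L^2$ norm, $L(dx)$ being Lebesgue measure. Let $a\in\mathcal G^s_b(\Lambda_{\Phi_0})$, $s>1$, and let $\widetilde a\in\mathcal G^s_b(\mathbb C^{2n})$ be an almost holomorphic extension of $a$ (that is, $\widetilde a|_{\Lambda_{\Phi_0}}=a$ and $\overline\partial\widetilde a$ vanishes to infinite order along $\Lambda_{\Phi_0}$) with $\operatorname{supp}\widetilde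 a\subset\Lambda_{\Phi_0}+B_{\mathbb C^{2n}}(0,C_0)$ for some $C_0>0$. For holomorphic $u$ with $u(x)=O_{h,N}(1)\langle x\rangle^{-N}e^{\Phi_0(x)/h}$ for all $N$, let $$a^w(x,hD_x)u(x)=\frac1{(2\pi h)^n}\iint_{\Gamma(x)}e^{\frac ih(x-y)\cdot\theta}\,a\Big(\frac{x+y}2,\theta\Big)u(y)\,dy\wedge d\theta,\qquad \Gamma(x):\ \theta=\frac2i\frac{\partial\Phi_0}{\partial x}\Big(\frac{x+y}2\Big),\ y\in\mathbb C^n,$$ with $\Gamma(x)$ oriented so that the symbol $1$ gives the identity, and extend $a^w(x,hD_x)$ by continuity to $H_{\Phi_0}$. Then there is a constant $C_1>0$ (depending only on $n,\Phi_0,s,a,\widetilde a$) such that for every $C>0$ there are $h_0>0$ and $K>0$ (depending only on these data and $C$) with the following property. Let $0<h<h_0$; let $U\subset\mathbb C^n$ be a bounded open set such that $$|a(x,\xi)|\ge 2/C\quad\text{for all }(x,\xi)\in\Lambda_{\Phi_0}\text{ with }x\in\mathbb C^n\setminus U;$$ and let $\Phi_1\in C^{1,1}(\mathbb C^n;\mathbb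 R)$ satisfy $$\|\nabla^k(\Phi_1-\Phi_0)\|_{L^\infty(\mathbb C^n)}\le C_1^{-1}h^{1-\frac1s},\qquad k=0,1,2.$$ Then for every $u\in H_{\Phi_1}$ the function $a^w(x,hD_x)u$ is well defined, belongs to $H_{\Phi_1}$, and $$\int_{\mathbb C^n\setminus U}|u(x)|^2e^{-2\Phi_1(x)/h}\,L(dx)\le K\,\|a^w(x,hD_x)u\|^2_{H_{\Phi_1}}+K\,h\,\|u\|^2_{H_{\Phi_1}}.$$ -/

import Mathlib

open MeasureTheory Filter Topology
open scoped ContDiff Pointwise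

noncomputable section

namespace BargmannWeyl

/-- The space `ℂⁿ` with its Euclidean norm; its `volume` is Lebesgue measure on `ℂⁿ ≅ ℝ²ⁿ`. -/
abbrev Cn (n : ℕ) : Type := EuclideanSpace ℂ (Fin n)

/-- The standard complex basis vector `e_j` of `ℂⁿ`. -/
def e {n : ℕ} (j : Fin n) : Cn n := EuclideanSpace.single j (1 : ℂ)

/-! ### Quadratic weights and the associated Lagrangian plane -/

/-- A real quadratic form on `ℂⁿ` is strictly plurisubharmonic when its Levi form is positive
definite. For a quadratic form `Φ` the Levi form
`∑ ∂²Φ/∂x_j∂x̄_k w_j w̄_k` (an average of `Φ` over rotations of `w`) equals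
`(Φ(w) + Φ(i w)) / 2`. -/
def StrictlyPSH {n : ℕ} (Φ : QuadraticForm ℝ (Cn n)) : Prop :=
  ∀ w : Cn n, w ≠ 0 → 0 < (Φ w + Φ (Complex.I • w)) / 2

/-- The holomorphic gradient `∂f/∂x`, with components
`∂f/∂x_j = (∂f/∂(Re x_j) - i ∂f/∂(Im x_j)) / 2`. -/
def holGrad {n : ℕ} (f : Cn n → ℝ) (x : Cn n) : Cn n :=
  WithLp.toLp 2 fun j =>
    (1 / 2 : ℂ) * ((fderiv ℝ f x (e j) : ℂ) - Complex.I * (fderiv ℝ f x (Complex.I • e j) : ℂ))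

/-- `ξ_Φ(x) = (2/i) ∂Φ/∂x (x)`. -/
def xi {n : ℕ} (f : Cn n → ℝ) (x : Cn n) : Cn n := (2 / Complex.I) • holGrad f x

/-- `Λ_Φ = {(x, (2/i) ∂Φ/∂x(x)) : x ∈ ℂⁿ} ⊆ ℂ²ⁿ`. -/
def Lambda {n : ℕ} (f : Cn n → ℝ) : Set (Cn n × Cn n) := Set.range fun x => (x, xi f x)

/-- The inverse of the projection `π_x : Λ_Φ → ℂⁿ`. -/
def lift {n : ℕ} (f : Cn n → ℝ) (x : Cn n) : Lambda f := ⟨(x, xi f x), x, rfl⟩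

/-! ### Bounded Gevrey classes -/

/-- The bounded Gevrey class of order `s`, in the coordinates given by the family of real basis
directions `b`: `|∂^α u(x)| ≤ C^{1+|α|} (α!)^s`. A multi-index `α` with `|α| = k` is
given by a list `c` of `k` coordinates, and then `α_i = #{l : c l = i}`. -/
def GevreyBdd {V ι : Type*} [NormedAddCommGroup V] [NormedSpace ℝ V] [Fintype ι] [DecidableEq ι]
    (b : ι → V) (s : ℝ) (u : V → ℂ) : Prop :=
  ContDiff ℝ ∞ u ∧ ∃ C : ℝ, 0 < C ∧ ∀ (k : ℕ) (c : Fin k → ι) (x : V),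
    ‖iteratedFDeriv ℝ k u x (fun l => b (c l))‖ ≤
      C ^ (1 + k) * ((∏ i, (Finset.univ.filter fun l => c l = i).card.factorial : ℕ) : ℝ) ^ s

/-- The directions of the real coordinates `Re x_j`, `Im x_j` of `ℂⁿ`. -/
def realDirs {n : ℕ} : Fin n ⊕ Fin n → Cn n :=
  Sum.elim (fun j => e j) (fun j => Complex.I • e j)

/-- The directions of the real coordinates of `ℂ²ⁿ = ℂⁿ × ℂⁿ`. -/
def realDirs₂ {n : ℕ} : (Fin n ⊕ Fin n) ⊕ (Fin n ⊕ Fin n) → Cn n × Cn n :=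
  Sum.elim (fun i => (realDirs i, 0)) (fun i => (0, realDirs i))

/-- `𝒢ˢ_b(Λ_Φ)`, where `Λ_Φ` is identified with `ℂⁿ ≅ ℝ²ⁿ` through `π_x`. -/
def GevreyLambda {n : ℕ} (Φ : Cn n → ℝ) (s : ℝ) (a : Lambda Φ → ℂ) : Prop :=
  GevreyBdd realDirs s fun x => a (lift Φ x)

/-- `∂̄ã` at `ρ` applied to `w`. -/
def dbar {n : ℕ} (A : Cn n × Cn n → ℂ) (w ρ : Cn n × Cn n) : ℂ :=
  (1 / 2 : ℂ) * (fderiv ℝ A ρ w + Complex.I * fderiv ℝ A ρ (Complex.I • w))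

/-- `A ∈ 𝒢ˢ_b(ℂ²ⁿ)` is an almost holomorphic extension of `a`, supported in
`Λ_Φ + B(0, C₀)` for some `C₀ > 0`: `A = a` on `Λ_Φ` and `∂̄A` vanishes to infinite order
along `Λ_Φ`. -/
structure IsAlmostHolomorphicExtension {n : ℕ} (Φ : Cn n → ℝ) (s : ℝ) (a : Lambda Φ → ℂ)
    (A : Cn n × Cn n → ℂ) : Prop where
  gevrey : GevreyBdd realDirs₂ s A
  extends_symbol : ∀ ρ : Lambda Φ, A ρ = a ρ
  flat : ∀ ρ ∈ Lambda Φ, ∀ (w : Cn n × Cn n) (k : ℕ), iteratedFDeriv ℝ k (dbar A w) ρ = 0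
  support : ∃ C₀ : ℝ, 0 < C₀ ∧ tsupport A ⊆ Lambda Φ + Metric.ball 0 C₀

/-! ### Weighted spaces of holomorphic functions -/

/-- The function `u e^{-Φ/h}`. -/
def weighted {n : ℕ} (Φ : Cn n → ℝ) (h : ℝ) (u : Cn n → ℂ) (x : Cn n) : ℂ :=
  u x * (Real.exp (-Φ x / h) : ℂ)

/-- `u ∈ H_Φ(ℂⁿ) = Hol(ℂⁿ) ∩ L²(ℂⁿ, e^{-2Φ/h} L(dx))`. -/
def MemH {n : ℕ} (Φ : Cn n → ℝ) (h : ℝ) (u : Cn n → ℂ) : Prop :=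
  Differentiable ℂ u ∧ MemLp (weighted Φ h u) 2 volume

/-- `∫_S |u|² e^{-2Φ/h} L(dx)`. -/
def massOn {n : ℕ} (Φ : Cn n → ℝ) (h : ℝ) (S : Set (Cn n)) (u : Cn n → ℂ) : ℝ :=
  ∫ x in S, ‖u x‖ ^ 2 * Real.exp (-2 * Φ x / h)

/-- `‖u‖²_{H_Φ} = ∫_{ℂⁿ} |u|² e^{-2Φ/h} L(dx)`. -/
def normSqH {n : ℕ} (Φ : Cn n → ℝ) (h : ℝ) (u : Cn n → ℂ) : ℝ := massOn Φ h Set.univ u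

/-- Holomorphic `u` with `u(x) = O_N(1) ⟨x⟩^{-N} e^{Φ(x)/h}` for all `N`, where
`⟨x⟩ = (1 + |x|²)^{1/2}`. -/
def RapidDecay {n : ℕ} (Φ : Cn n → ℝ) (h : ℝ) (u : Cn n → ℂ) : Prop :=
  Differentiable ℂ u ∧ ∀ N : ℕ, ∃ C : ℝ, ∀ x : Cn n,
    ‖u x‖ ≤ C * (Real.sqrt (1 + ‖x‖ ^ 2) ^ N)⁻¹ * Real.exp (Φ x / h)

/-! ### Weyl quantization -/

/-- The density of `dy₁ ∧ ⋯ ∧ dyₙ ∧ dθ₁ ∧ ⋯ ∧ dθₙ` with respect to Lebesgue measure `L(dy)` on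
the contour `θ = θ(y)`, which is `det (2i ∂θ_j/∂ȳ_k)` with
`2 ∂/∂ȳ_k = ∂/∂(Re y_k) + i ∂/∂(Im y_k)`. The orientation of the contour is the one
for which this density is positive when `θ(y) = (2/i) ∂Φ/∂x((x+y)/2)` and `Φ` is strictly
plurisubharmonic (it then equals `2ⁿ det (∂²Φ/∂x_j∂x̄_k)`), so that the symbol `1` is
quantized to the identity. -/
def contourDensity {n : ℕ} (θ : Cn n → Cn n) (y : Cn n) : ℂ :=
  Matrix.det (Matrix.of fun j k : Fin n =>
    Complex.I * ((fderiv ℝ θ y (e k)) j + Complex.I * (fderiv ℝ θ y (Complex.I • e k)) j))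

/-- The midpoint `(x+y)/2`. -/
def mid {n : ℕ} (x y : Cn n) : Cn n := (1 / 2 : ℝ) • (x + y)

/-- The Weyl quantization along the contour `Γ(x) : θ = (2/i) ∂Φ/∂x((x+y)/2)`,
`(2πh)^{-n} ∫∫_{Γ(x)} e^{(i/h)(x-y)·θ} a((x+y)/2, θ) u(y) dy ∧ dθ`.
The integral converges absolutely for `u` of rapid decay. -/
def weylGamma {n : ℕ} (Φ : Cn n → ℝ) (a : Lambda Φ → ℂ) (h : ℝ) (u : Cn n → ℂ) (x : Cn n) : ℂ :=
  (1 / (2 * Real.pi * h) ^ n : ℝ) *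
    ∫ y : Cn n,
      Complex.exp (Complex.I / h * ∑ j, (x j - y j) * xi Φ (mid x y) j) *
        a (lift Φ (mid x y)) * u y * contourDensity (fun y' => xi Φ (mid x y')) y

/-- `v = a^w(x, hD_x) u`, where `a^w(x, hD_x)` is the extension by continuity to `H_Φ(ℂⁿ)`
of the operator `weylGamma`, given on the dense subspace of functions of rapid decay: `v ∈ H_Φ`,
and there are `u_k` of rapid decay with `u_k → u` and `a^w u_k → v` in
`L²(ℂⁿ, e^{-2Φ/h} L(dx))`. -/
def IsWeylImage {n : ℕ} (Φ : Cn n → ℝ) (a : Lambda Φ → ℂ) (h : ℝ) (u v : Cn n → ℂ) : Prop :=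
  MemH Φ h v ∧ ∃ U : ℕ → Cn n → ℂ, (∀ k, RapidDecay Φ h (U k)) ∧
    Tendsto (fun k => eLpNorm (weighted Φ h (U k - u)) 2 volume) atTop (𝓝 0) ∧
    Tendsto (fun k => eLpNorm (weighted Φ h (weylGamma Φ a h (U k) - v)) 2 volume) atTop (𝓝 0)

/-! ### Perturbed weights -/

/-- `f ∈ C^{1,1}(ℂⁿ; ℝ)`. -/
def IsC11 {n : ℕ} (f : Cn n → ℝ) : Prop :=
  ContDiff ℝ 1 f ∧ ∃ K, LipschitzWith K (fderiv ℝ f)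

/-- `‖∇ᵏ f‖_{L^∞} ≤ ε` for `k = 0, 1, 2`, for `f` of class `C^{1,1}`; the `L^∞` norm of the
(almost everywhere defined) Hessian is the Lipschitz constant of the gradient. -/
def C11Small {n : ℕ} (f : Cn n → ℝ) (ε : ℝ) : Prop :=
  (∀ x, |f x| ≤ ε) ∧ (∀ x, ‖fderiv ℝ f x‖ ≤ ε) ∧
    ∀ x y, ‖fderiv ℝ f x - fderiv ℝ f y‖ ≤ ε * ‖x - y‖

end BargmannWeyl

end

/-! Write `f = Φ₁ - Φ₀`, `t = √h`, `ε = C₁⁻¹ h^(1-1/s)`, let `R` be the real part of the Levi form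
of `Φ₀`, and let `β(x)` be the vector with `2 R(v, β) = df(x) v`. Measured with the weight `Φ₁`, the
Weyl operator should act near `x` as multiplication by the symbol at a complex point at distance
`O(|β|) = O(ε)` from `Λ`. The claim is that it equals multiplication by such a number `b(x)`, times
the constant by which the symbol `1` acts, up to an operator of norm `O(√h)` on `L²(e^{-2Φ₁/h})`
(`exists_operator_bound`). Since `b - a = O(h^(1-1/s))`, `b` is bounded below off `U` for small `h`,
and dividing by it gives the estimate; the square of `√h` is the factor `h` in the error.

On `Γ(x)` the kernel has modulus `e^{(Φ₀(x)-Φ₀(y))/h}`, without decay in `x - y`. The decay is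
recovered by writing `u` inside the integral through a reproducing formula with a Gaussian kernel
tilted by `β`, and exchanging the integrals. The symbol then enters only through an oscillatory
Gaussian integral at frequency `i(x-y-β)/t` (`weyl_integral_eq`), which decays by integration by
parts. The weights contribute the growing factor `exp((f(y)-f(x)+R(β,β))/h)`.

This growth is removed by translating the Gaussian in an imaginary direction. For an analytic symbol
this would be a contour shift; here a Taylor polynomial of order `m` replaces the continuation
(`norm_integral_sub_shift_le`). At distance `ε` the `k`-th Taylor term is at most of order `(const ·
ε m^(s-1))^k` for `k ≤ m`, which is geometric when `m ≈ 2 h^(-1/s)`, and the remainder is of size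
`e^{-m}`. Since `3ε/h ≤ h^(-1/s)`, this remainder beats the growth of the weight by more than any
power of `h` (`exists_order`). This balance is what fixes the exponent `1 - 1/s`.

In the shifted main term the linear part of `f` is cancelled by `β`, and the `C^{1,1}` remainder of
`f` by an additional small shift along `x - y` (`shift_exponent_le`). What is left is `σ - b` on the
scale `t`, whence one factor `t` and a kernel concentrated on `|x - y| ≲ t`
(`exists_weighted_kernel_bound`); Young's inequality concludes.

All this is done for functions of rapid decay. An explicit Bergman projection gives their density in
`H_{Φ₀}` and the completeness of that space, hence the extension of the operator by continuity
(`existsUnique_isWeylImage`). For fixed `h` the weights `Φ₀` and `Φ₁` define equivalent norms, so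
the estimate passes to the limit (`elliptic_estimate_of_isWeylImage`). -/

open scoped ENNReal

noncomputable section

namespace BargmannWeyl

/-! ### Oscillatory Gaussian integrals and their decay in the frequency. -/

section RealAnalysis

variable {E : Type*} [NormedAddCommGroup E] [NormedSpace ℝ E]

/-- Smooth functions whose derivatives of order at most `J` are bounded by `A (1 + |v|)^k`. -/
def SymbBdd (J k : ℕ) (A : ℝ) (q : E → ℂ) : Prop :=
  ContDiff ℝ ∞ q ∧ ∀ j ≤ J, ∀ v, ‖iteratedFDeriv ℝ j q v‖ ≤ A * (1 + ‖v‖) ^ k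

/-- The directional derivative. -/
def dird (η : E) (q : E → ℂ) (v : E) : ℂ := fderiv ℝ q v η

lemma contDiff_dird {q : E → ℂ} (hq : ContDiff ℝ ∞ q) (η : E) : ContDiff ℝ ∞ (dird η q) :=
  (hq.fderiv_right (m := ∞) (by simp)).clm_apply contDiff_const

lemma norm_iteratedFDeriv_dird_le {q : E → ℂ} (hq : ContDiff ℝ ∞ q) (η : E) (j : ℕ) (v : E) :
    ‖iteratedFDeriv ℝ j (dird η q) v‖ ≤ ‖η‖ * ‖iteratedFDeriv ℝ (j + 1) q v‖ := by
  have := norm_iteratedFDeriv_clm_apply_const (𝕜 := ℝ) (f := fderiv ℝ q) (c := η) (x := v) (n := j)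
    (N := ∞) ((hq.fderiv_right (m := ∞) (by simp)).contDiffAt) (by exact_mod_cast le_top)
  rwa [norm_iteratedFDeriv_fderiv] at this

lemma contDiff_iterate_dird {q : E → ℂ} (hq : ContDiff ℝ ∞ q) (η : E) (k : ℕ) :
    ContDiff ℝ ∞ ((dird η)^[k] q) := by
  induction k with
  | zero => simpa
  | succ k ih => rw [Function.iterate_succ_apply']; exact contDiff_dird ih η

lemma norm_iteratedFDeriv_iterate_dird_le {q : E → ℂ} (hq : ContDiff ℝ ∞ q) (η : E) (k j : ℕ)
    (v : E) :
    ‖iteratedFDeriv ℝ j ((dird η)^[k] q) v‖ ≤ ‖η‖ ^ k * ‖iteratedFDeriv ℝ (j + k) q v‖ := by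
  induction k generalizing j with
  | zero => simp
  | succ k ih =>
    rw [Function.iterate_succ_apply']
    refine (norm_iteratedFDeriv_dird_le (contDiff_iterate_dird hq η k) η j v).trans ?_
    calc _ ≤ ‖η‖ * (‖η‖ ^ k * ‖iteratedFDeriv ℝ (j + 1 + k) q v‖) := by gcongr; exact ih (j + 1)
      _ = _ := by rw [show j + (k + 1) = j + 1 + k by ring]; ring

lemma iterate_dird_eq {q : E → ℂ} (hq : ContDiff ℝ ∞ q) (η : E) (k : ℕ) (v : E) :
    (dird η)^[k] q v = iteratedFDeriv ℝ k q v (fun _ => η) := by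
  induction k generalizing v with
  | zero => simp
  | succ k ih =>
    rw [Function.iterate_succ_apply', iteratedFDeriv_succ_apply_left]
    have h1 : (dird η)^[k] q = fun v => iteratedFDeriv ℝ k q v (fun _ => η) := funext ih
    have h2 : DifferentiableAt ℝ (iteratedFDeriv ℝ k q) v :=
      (hq.differentiable_iteratedFDeriv (m := k) (by exact_mod_cast WithTop.coe_lt_top _)) v
    change fderiv ℝ ((dird η)^[k] q) v η = _
    rw [h1, fderiv_continuousMultilinear_apply_const_apply h2]
    rfl

lemma SymbBdd.mono {J k J' : ℕ} {A : ℝ} {q : E → ℂ} (h : SymbBdd J k A q) (hJ : J' ≤ J) :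
    SymbBdd J' k A q := ⟨h.1, fun j hj v => h.2 j (hj.trans hJ) v⟩

lemma SymbBdd.dird {J k : ℕ} {A : ℝ} {q : E → ℂ} (h : SymbBdd (J + 1) k A q) (η : E) :
    SymbBdd J k (‖η‖ * A) (dird η q) :=
  ⟨contDiff_dird h.1 η, fun j hj v => (norm_iteratedFDeriv_dird_le h.1 η j v).trans (by
    rw [mul_assoc]; gcongr; exact h.2 _ (by omega) v)⟩

lemma SymbBdd.norm_le {J k : ℕ} {A : ℝ} {q : E → ℂ} (h : SymbBdd J k A q) (v : E) :
    ‖q v‖ ≤ A * (1 + ‖v‖) ^ k := by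
  simpa using h.2 0 (Nat.zero_le _) v

lemma SymbBdd.nonneg {J k : ℕ} {A : ℝ} {q : E → ℂ} (h : SymbBdd J k A q) : 0 ≤ A := by
  simpa using (norm_nonneg _).trans (h.2 0 (Nat.zero_le _) 0)

lemma norm_iteratedFDeriv_clm_le (l : E →L[ℝ] ℝ) (i : ℕ) (v : E) :
    ‖iteratedFDeriv ℝ i l v‖ ≤ ‖l‖ * (1 + ‖v‖) := by
  match i with
  | 0 =>
    simp only [norm_iteratedFDeriv_zero]
    calc ‖l v‖ ≤ ‖l‖ * ‖v‖ := l.le_opNorm v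
      _ ≤ _ := by gcongr; linarith
  | 1 =>
    rw [norm_iteratedFDeriv_one, ContinuousLinearMap.fderiv]
    nlinarith [norm_nonneg l, norm_nonneg v]
  | (i + 2) =>
    rw [← norm_iteratedFDeriv_fderiv]
    have : fderiv ℝ (l : E → ℝ) = fun _ => l := by ext1 x; exact l.fderiv
    rw [this, iteratedFDeriv_succ_const]
    simp; positivity

lemma SymbBdd.clm_mul {J k : ℕ} {A : ℝ} {q : E → ℂ} (h : SymbBdd J k A q) (l : E →L[ℝ] ℝ) :
    SymbBdd J (k + 1) (2 ^ J * ‖l‖ * A) (fun v => (l v : ℂ) * q v) := by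
  have e : (fun v => (l v : ℂ) * q v) = fun v => l v • q v := by ext v; simp
  rw [e]
  refine ⟨l.contDiff.smul h.1, fun j hj v => ?_⟩
  have hA := h.nonneg
  refine (norm_iteratedFDeriv_smul_le (𝕜 := ℝ) (N := ∞) l.contDiff h.1 v
    (n := j) (by exact_mod_cast le_top)).trans ?_
  calc _ ≤ ∑ i ∈ Finset.range (j + 1), (j.choose i : ℝ) *
        ((‖l‖ * (1 + ‖v‖)) * (A * (1 + ‖v‖) ^ k)) := by
        refine Finset.sum_le_sum fun i hi => ?_
        rw [mul_assoc]
        gcongr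
        · exact norm_iteratedFDeriv_clm_le l i v
        · exact h.2 _ (by omega) v
    _ = 2 ^ j * (‖l‖ * A * (1 + ‖v‖) ^ (k + 1)) := by
        rw [← Finset.sum_mul]
        have : (∑ i ∈ Finset.range (j + 1), (j.choose i : ℝ)) = 2 ^ j := by
          exact_mod_cast Nat.sum_range_choose j
        rw [this]; ring
    _ ≤ 2 ^ J * (‖l‖ * A * (1 + ‖v‖) ^ (k + 1)) := by
        gcongr; norm_num
    _ = _ := by ring

/-- The oscillating Gaussian `exp (-4 (R(v,v) + i R(ζ,v)))`. -/
def oscGauss (R : E →L[ℝ] E →L[ℝ] ℝ) (ζ v : E) : ℂ :=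
  Complex.exp (-4 * (R v v + Complex.I * R ζ v))

lemma norm_oscGauss (R : E →L[ℝ] E →L[ℝ] ℝ) (ζ v : E) :
    ‖oscGauss R ζ v‖ = Real.exp (-4 * R v v) := by
  rw [oscGauss, Complex.norm_exp]; congr 1; simp

lemma contDiff_oscGauss (R : E →L[ℝ] E →L[ℝ] ℝ) (ζ : E) : ContDiff ℝ ∞ (oscGauss R ζ) := by
  unfold oscGauss
  have h1 : ContDiff ℝ ∞ fun v => R v v := R.contDiff.clm_apply contDiff_id
  have h2 : ContDiff ℝ ∞ fun v => R ζ v := (R ζ).contDiff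
  have h1' := Complex.ofRealCLM.contDiff.comp h1
  have h2' := Complex.ofRealCLM.contDiff.comp h2
  exact (contDiff_const.mul (h1'.add (contDiff_const.mul h2'))).cexp

lemma hasLineDerivAt_oscGauss {R : E →L[ℝ] E →L[ℝ] ℝ} (hR : ∀ v w, R v w = R w v) (ζ v η : E) :
    HasLineDerivAt ℝ (oscGauss R ζ)
      (-4 * (2 * R η v + Complex.I * R ζ η) * oscGauss R ζ v) v η := by
  unfold HasLineDerivAt oscGauss
  have h0 : ∀ t : ℝ, (-4 * ((R (v + t • η) (v + t • η) : ℝ) + Complex.I * (R ζ (v + t • η) : ℝ)) : ℂ)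
      = -4 * ((R v v + Complex.I * R ζ v) + (2 * R η v + Complex.I * R ζ η) * t
        + R η η * (t : ℂ) ^ 2) := by
    intro t
    simp only [map_add, map_smul, add_apply, smul_apply,
      smul_eq_mul, hR v η]
    push_cast; ring
  simp_rw [h0]
  have ht : HasDerivAt (fun t : ℝ => (t : ℂ)) 1 0 := Complex.ofRealCLM.hasDerivAt
  have := (((ht.const_mul ((2 * R η v + Complex.I * R ζ η) : ℂ)).const_add
    ((R v v + Complex.I * R ζ v) : ℂ)).add ((ht.pow 2).const_mul ((R η η : ℝ) : ℂ))).const_mul (-4 : ℂ)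
  refine this.cexp.congr_deriv ?_
  simp
  ring

variable [FiniteDimensional ℝ E] [MeasurableSpace E] [BorelSpace E] {μ : Measure E}
  [μ.IsAddHaarMeasure]

lemma integrable_poly_mul_gauss (μ : Measure E) [μ.IsAddHaarMeasure] (k : ℕ) {c : ℝ} (hc : 0 < c) :
    Integrable (fun v : E => (1 + ‖v‖) ^ k * Real.exp (-c * ‖v‖ ^ 2)) μ := by
  set d : ℕ := Module.finrank ℝ E + 1
  have hd : ((Module.finrank ℝ E : ℕ) : ℝ) < (d : ℝ) := by simp [d]
  have hI := integrable_one_add_norm (E := E) (μ := μ) hd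
  obtain ⟨M, hM⟩ : ∃ M : ℝ, ∀ r : ℝ, 0 ≤ r → (1 + r) ^ (k + d) * Real.exp (-c * r ^ 2) ≤ M := by
    have hlim : Tendsto (fun r : ℝ => (1 + r) ^ (k + d) * Real.exp (-(1 + r))) atTop (𝓝 0) :=
      (Real.tendsto_pow_mul_exp_neg_atTop_nhds_zero (k + d)).comp
        (tendsto_atTop_add_const_left _ 1 tendsto_id)
    have h1 : ∀ᶠ r : ℝ in atTop, (1 + r) ^ (k + d) * Real.exp (-c * r ^ 2) ≤ 1 := by
      filter_upwards [hlim.eventually (ge_mem_nhds (zero_lt_one (α := ℝ))), eventually_ge_atTop 1,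
        eventually_ge_atTop (2 / c)] with r hr h1 h2
      refine le_trans ?_ hr
      have : 2 ≤ c * r := by rwa [div_le_iff₀' hc] at h2
      gcongr
      nlinarith
    obtain ⟨r₀, hr₀⟩ := eventually_atTop.1 h1
    have hcont : Continuous fun r : ℝ => (1 + r) ^ (k + d) * Real.exp (-c * r ^ 2) := by fun_prop
    obtain ⟨M, hM⟩ := (isCompact_Icc (a := (0 : ℝ)) (b := r₀)).exists_bound_of_continuousOn
      hcont.continuousOn
    refine ⟨max M 1, fun r hr => ?_⟩
    rcases le_total r r₀ with h | h
    · exact (le_abs_self _).trans ((hM r ⟨hr, h⟩).trans (le_max_left _ _))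
    · exact (hr₀ r h).trans (le_max_right _ _)
  refine (hI.const_mul M).mono' (by fun_prop) (ae_of_all _ fun v => ?_)
  rw [Real.norm_of_nonneg (by positivity)]
  rw [Real.rpow_neg (by positivity), Real.rpow_natCast, ← div_eq_mul_inv,
    le_div_iff₀ (by positivity)]
  calc _ = (1 + ‖v‖) ^ (k + d) * Real.exp (-c * ‖v‖ ^ 2) := by rw [pow_add]; ring
    _ ≤ M := hM _ (norm_nonneg v)

lemma integrable_symb_mul_oscGauss {R : E →L[ℝ] E →L[ℝ] ℝ} {ρ : ℝ} (hρ : 0 < ρ)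
    (hR' : ∀ v, ρ * ‖v‖ ^ 2 ≤ R v v) (ζ : E) {q : E → ℂ} (hq : Continuous q) {A : ℝ} {k : ℕ}
    (hA : ∀ v, ‖q v‖ ≤ A * (1 + ‖v‖) ^ k) :
    Integrable (fun v => q v * oscGauss R ζ v) μ := by
  have hI := integrable_poly_mul_gauss μ k (c := 4 * ρ) (by positivity)
  refine (hI.const_mul A).mono'
    (hq.mul (contDiff_oscGauss R ζ).continuous).aestronglyMeasurable (ae_of_all _ fun v => ?_)
  rw [norm_mul, norm_oscGauss, ← mul_assoc]
  have h0 : 0 ≤ A * (1 + ‖v‖) ^ k := (norm_nonneg _).trans (hA v)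
  have h1 : Real.exp (-4 * R v v) ≤ Real.exp (-(4 * ρ) * ‖v‖ ^ 2) :=
    Real.exp_le_exp.2 (by nlinarith [hR' v])
  gcongr
  exact hA v

lemma norm_integral_symb_le {R : E →L[ℝ] E →L[ℝ] ℝ} {ρ : ℝ} (hρ : 0 < ρ)
    (hR' : ∀ v, ρ * ‖v‖ ^ 2 ≤ R v v) (ζ : E) {q : E → ℂ} {A : ℝ} {k : ℕ}
    (hA : ∀ v, ‖q v‖ ≤ A * (1 + ‖v‖) ^ k) :
    ‖∫ v, q v * oscGauss R ζ v ∂μ‖ ≤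
      (∫ v : E, (1 + ‖v‖) ^ k * Real.exp (-(4 * ρ) * ‖v‖ ^ 2) ∂μ) * A := by
  have hI := integrable_poly_mul_gauss μ k (c := 4 * ρ) (by positivity)
  rw [mul_comm, ← integral_const_mul]
  refine norm_integral_le_of_norm_le (hI.const_mul A) (ae_of_all _ fun v => ?_)
  rw [norm_mul, norm_oscGauss, ← mul_assoc]
  have h0 : 0 ≤ A * (1 + ‖v‖) ^ k := (norm_nonneg _).trans (hA v)
  have h1 : Real.exp (-4 * R v v) ≤ Real.exp (-(4 * ρ) * ‖v‖ ^ 2) :=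
    Real.exp_le_exp.2 (by nlinarith [hR' v])
  gcongr
  exact hA v

/-- Integration by parts against the oscillating Gaussian. -/
lemma integral_dird_mul_oscGauss {R : E →L[ℝ] E →L[ℝ] ℝ} (hR : ∀ v w, R v w = R w v) {ρ : ℝ}
    (hρ : 0 < ρ) (hR' : ∀ v, ρ * ‖v‖ ^ 2 ≤ R v v) (ζ η : E) {q : E → ℂ} {A : ℝ} {k : ℕ}
    (hq : SymbBdd 1 k A q) :
    ∫ v, dird η q v * oscGauss R ζ v ∂μ =
      4 * Complex.I * R ζ η * ∫ v, q v * oscGauss R ζ v ∂μ +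
        8 * ∫ v, (R η v * q v) * oscGauss R ζ v ∂μ := by
  have i1 : Integrable (fun v => q v * oscGauss R ζ v) μ :=
    integrable_symb_mul_oscGauss hρ hR' ζ hq.1.continuous hq.norm_le
  have i2 : Integrable (fun v => (R η v * q v) * oscGauss R ζ v) μ :=
    integrable_symb_mul_oscGauss hρ hR' ζ (hq.clm_mul (R η)).1.continuous (hq.clm_mul (R η)).norm_le
  have i3 : Integrable (fun v => dird η q v * oscGauss R ζ v) μ :=
    integrable_symb_mul_oscGauss hρ hR' ζ (hq.dird (J := 0) η).1.continuous
      (hq.dird (J := 0) η).norm_le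
  have e : (fun v => q v * (-4 * (2 * R η v + Complex.I * R ζ η) * oscGauss R ζ v)) =
      fun v => (-4 * Complex.I * R ζ η) * (q v * oscGauss R ζ v) +
        (-8) * ((R η v * q v) * oscGauss R ζ v) := by
    ext v; ring
  have key := integral_bilinear_hasLineDerivAt_right_eq_neg_left_of_integrable (μ := μ)
    (B := ContinuousLinearMap.mul ℝ ℂ) (f := q) (f' := dird η q) (g := oscGauss R ζ)
    (g' := fun v => -4 * (2 * R η v + Complex.I * R ζ η) * oscGauss R ζ v) (v := η)
    (by simpa using i3) (by
      simp only [ContinuousLinearMap.mul_apply']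
      rw [e]; exact (i1.const_mul _).add (i2.const_mul _)) (by simpa using i1)
    (fun x _ => ((hq.1.differentiable (by simp)) x).hasFDerivAt.hasLineDerivAt η)
    (fun x _ => hasLineDerivAt_oscGauss hR ζ x η)
  simp only [ContinuousLinearMap.mul_apply'] at key
  rw [e, integral_add (i1.const_mul _) (i2.const_mul _), integral_const_mul,
    integral_const_mul] at key
  linear_combination key

/-- Integration by parts is done along `ζ` itself: this produces `R(ζ,ζ) ≥ ρ|ζ|²` in front of the
integral, while the other two terms cost only one factor `|ζ|`, so each step gains `|ζ|⁻¹`. One of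
those terms has the symbol `R(ζ,v) q(v)`, whose growth exponent is `k + 1`; hence the induction over
all `k`. The constant is uniform in `q` and `ζ`. -/
lemma exists_osc_bound_pow (μ : Measure E) [μ.IsAddHaarMeasure]
    {R : E →L[ℝ] E →L[ℝ] ℝ} (hR : ∀ v w, R v w = R w v) {ρ : ℝ}
    (hρ : 0 < ρ) (hR' : ∀ v, ρ * ‖v‖ ^ 2 ≤ R v v) (N k : ℕ) :
    ∃ C : ℝ, 0 ≤ C ∧ ∀ (q : E → ℂ) (A : ℝ) (ζ : E), SymbBdd N k A q →
      ‖ζ‖ ^ N * ‖∫ v, q v * oscGauss R ζ v ∂μ‖ ≤ C * A := by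
  induction N generalizing k with
  | zero =>
    refine ⟨∫ v : E, (1 + ‖v‖) ^ k * Real.exp (-(4 * ρ) * ‖v‖ ^ 2) ∂μ, by positivity,
      fun q A ζ hq => ?_⟩
    simpa using norm_integral_symb_le (μ := μ) hρ hR' ζ hq.norm_le
  | succ N ih =>
    obtain ⟨C₁, hC₁, h₁⟩ := ih k
    obtain ⟨C₂, hC₂, h₂⟩ := ih (k + 1)
    refine ⟨(C₁ + 8 * (C₂ * (2 ^ N * ‖R‖))) / (4 * ρ), by positivity, fun q A ζ hq => ?_⟩
    rcases eq_or_ne ζ 0 with rfl | hζ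
    · simp only [norm_zero, ne_eq, Nat.add_eq_zero_iff, one_ne_zero, and_false, not_false_eq_true,
        zero_pow, zero_mul]
      have := hq.nonneg
      positivity
    have hζ' : 0 < ‖ζ‖ := norm_pos_iff.2 hζ
    have hA := hq.nonneg
    have e := integral_dird_mul_oscGauss (μ := μ) hR hρ hR' ζ ζ (hq.mono (by omega : 1 ≤ N + 1))
    have b₁ := h₁ _ _ ζ (hq.dird ζ)
    have b₂ := h₂ _ _ ζ ((hq.mono (Nat.le_succ N)).clm_mul (R ζ))
    set I₀ := ∫ v, q v * oscGauss R ζ v ∂μ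
    set I₁ := ∫ v, dird ζ q v * oscGauss R ζ v ∂μ
    set I₂ := ∫ v, (R ζ v * q v) * oscGauss R ζ v ∂μ
    have hn : 4 * R ζ ζ * ‖I₀‖ ≤ ‖I₁‖ + 8 * ‖I₂‖ := by
      have : 4 * Complex.I * R ζ ζ * I₀ = I₁ - 8 * I₂ := by linear_combination -e
      have h3 := norm_sub_le I₁ (8 * I₂)
      rw [← this] at h3
      have hp : 0 ≤ R ζ ζ := le_trans (by positivity) (hR' ζ)
      simpa [abs_of_nonneg hp] using h3
    have hRz : ‖R ζ‖ ≤ ‖R‖ * ‖ζ‖ := R.le_opNorm ζ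
    have b₂' : ‖ζ‖ ^ N * ‖I₂‖ ≤ C₂ * (2 ^ N * (‖R‖ * ‖ζ‖) * A) := b₂.trans (by gcongr)
    rw [div_mul_eq_mul_div, le_div_iff₀ (by positivity)]
    have h5 : 4 * (ρ * ‖ζ‖ ^ 2) * ‖I₀‖ ≤ ‖I₁‖ + 8 * ‖I₂‖ :=
      le_trans (by gcongr; exact hR' ζ) hn
    have h6 : ‖ζ‖ ^ N * (4 * (ρ * ‖ζ‖ ^ 2) * ‖I₀‖) ≤ ‖ζ‖ * ((C₁ + 8 * (C₂ * (2 ^ N * ‖R‖))) * A) := by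
      calc _ ≤ ‖ζ‖ ^ N * (‖I₁‖ + 8 * ‖I₂‖) := by gcongr
        _ = ‖ζ‖ ^ N * ‖I₁‖ + 8 * (‖ζ‖ ^ N * ‖I₂‖) := by ring
        _ ≤ C₁ * (‖ζ‖ * A) + 8 * (C₂ * (2 ^ N * (‖R‖ * ‖ζ‖) * A)) := by gcongr
        _ = _ := by ring
    refine le_of_mul_le_mul_left ?_ hζ'
    calc _ = ‖ζ‖ ^ N * (4 * (ρ * ‖ζ‖ ^ 2) * ‖I₀‖) := by rw [pow_succ]; ring
      _ ≤ _ := h6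

lemma exists_osc_bound (μ : Measure E) [μ.IsAddHaarMeasure]
    {R : E →L[ℝ] E →L[ℝ] ℝ} (hR : ∀ v w, R v w = R w v) {ρ : ℝ}
    (hρ : 0 < ρ) (hR' : ∀ v, ρ * ‖v‖ ^ 2 ≤ R v v) (N k : ℕ) :
    ∃ C : ℝ, 0 ≤ C ∧ ∀ (q : E → ℂ) (A : ℝ) (ζ : E), SymbBdd N k A q →
      (1 + ‖ζ‖) ^ N * ‖∫ v, q v * oscGauss R ζ v ∂μ‖ ≤ C * A := by
  obtain ⟨C₀, h0, h₀⟩ := exists_osc_bound_pow μ hR hρ hR' 0 k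
  obtain ⟨C₁, h1, h₁⟩ := exists_osc_bound_pow μ hR hρ hR' N k
  refine ⟨2 ^ N * (C₀ + C₁), by positivity, fun q A ζ hq => ?_⟩
  have b₀ := h₀ q A ζ (hq.mono (Nat.zero_le _))
  have b₁ := h₁ q A ζ hq
  have : (1 + ‖ζ‖) ^ N ≤ 2 ^ N * (‖ζ‖ ^ 0 + ‖ζ‖ ^ N) := by
    rcases le_total ‖ζ‖ 1 with h | h
    · calc (1 + ‖ζ‖) ^ N ≤ 2 ^ N := by gcongr; linarith
        _ ≤ _ := by rw [pow_zero]; nlinarith [pow_nonneg (norm_nonneg ζ) N, pow_pos (two_pos (α := ℝ)) N]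
    · calc (1 + ‖ζ‖) ^ N ≤ (2 * ‖ζ‖) ^ N := by gcongr; linarith
        _ = 2 ^ N * ‖ζ‖ ^ N := mul_pow _ _ _
        _ ≤ _ := by gcongr; simp
  calc _ ≤ 2 ^ N * (‖ζ‖ ^ 0 + ‖ζ‖ ^ N) * ‖∫ v, q v * oscGauss R ζ v ∂μ‖ := by gcongr
    _ = 2 ^ N * (‖ζ‖ ^ 0 * ‖∫ v, q v * oscGauss R ζ v ∂μ‖ +
        ‖ζ‖ ^ N * ‖∫ v, q v * oscGauss R ζ v ∂μ‖) := by ring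
    _ ≤ 2 ^ N * (C₀ * A + C₁ * A) := by gcongr
    _ = _ := by ring

end RealAnalysis

/-! ### Translating the Gaussian by an imaginary vector. -/

section Shift

variable {E : Type*} [NormedAddCommGroup E] [NormedSpace ℝ E]
lemma hasDerivAt_oscGauss_freq (R : E →L[ℝ] E →L[ℝ] ℝ) (ζ η v : E) (t : ℝ) :
    HasDerivAt (fun t : ℝ => oscGauss R (ζ + (2 * t) • η) v)
      (-8 * Complex.I * R η v * oscGauss R (ζ + (2 * t) • η) v) t := by
  unfold oscGauss
  have h0 : ∀ t : ℝ, (-4 * (R v v + Complex.I * (R (ζ + (2 * t) • η) v : ℝ)) : ℂ)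
      = -4 * (R v v + Complex.I * R ζ v) + (-8 * Complex.I * R η v) * t := by
    intro t
    simp only [map_add, map_smul, add_apply, smul_apply, smul_eq_mul]
    push_cast; ring
  simp_rw [h0]
  have ht : HasDerivAt (fun t : ℝ => (t : ℂ)) 1 t := Complex.ofRealCLM.hasDerivAt
  refine ((ht.const_mul _).const_add _).cexp.congr_deriv ?_
  ring

variable [FiniteDimensional ℝ E] [MeasurableSpace E] [BorelSpace E] {μ : Measure E}
  [μ.IsAddHaarMeasure]

lemma hasDerivAt_integral_oscGauss {R : E →L[ℝ] E →L[ℝ] ℝ} {ρ : ℝ} (hρ : 0 < ρ)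
    (hR' : ∀ v, ρ * ‖v‖ ^ 2 ≤ R v v) (ζ η : E) {q : E → ℂ} {A : ℝ} {k : ℕ}
    (hq : SymbBdd 0 k A q) (t : ℝ) :
    HasDerivAt (fun t : ℝ => ∫ v, q v * oscGauss R (ζ + (2 * t) • η) v ∂μ)
      (-8 * Complex.I * ∫ v, (R η v * q v) * oscGauss R (ζ + (2 * t) • η) v ∂μ) t := by
  have hq2 := hq.clm_mul (R η)
  have hI := integrable_poly_mul_gauss μ (k + 1) (c := 4 * ρ) (by positivity)
  have key := (hasDerivAt_integral_of_dominated_loc_of_deriv_le (μ := μ) (𝕜 := ℝ)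
    (F := fun t v => q v * oscGauss R (ζ + (2 * t) • η) v)
    (F' := fun t v => q v * (-8 * Complex.I * R η v * oscGauss R (ζ + (2 * t) • η) v))
    (x₀ := t) (s := Set.univ)
    (bound := fun v => (8 * (2 ^ 0 * ‖R η‖ * A)) * ((1 + ‖v‖) ^ (k + 1) *
      Real.exp (-(4 * ρ) * ‖v‖ ^ 2))) univ_mem
    (Eventually.of_forall fun t => (integrable_symb_mul_oscGauss hρ hR' _ hq.1.continuous
      hq.norm_le).aestronglyMeasurable)
    (integrable_symb_mul_oscGauss hρ hR' _ hq.1.continuous hq.norm_le)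
    (by
      refine Continuous.aestronglyMeasurable ?_
      have := (contDiff_oscGauss R (ζ + (2 * t) • η)).continuous
      have := hq.1.continuous
      fun_prop)
    (ae_of_all _ fun v t _ => ?_) (hI.const_mul _)
    (ae_of_all _ fun v t _ => (hasDerivAt_oscGauss_freq R ζ η v t).const_mul (q v))).2
  · refine key.congr_deriv ?_
    rw [← integral_const_mul]
    congr 1; ext v; ring
  · have h1 : ‖(R η v * q v : ℂ)‖ ≤ 2 ^ 0 * ‖R η‖ * A * (1 + ‖v‖) ^ (k + 1) := hq2.norm_le v
    have h2 : Real.exp (-4 * R v v) ≤ Real.exp (-(4 * ρ) * ‖v‖ ^ 2) :=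
      Real.exp_le_exp.2 (by nlinarith [hR' v])
    have h3 : ‖q v * (-8 * Complex.I * R η v * oscGauss R (ζ + (2 * t) • η) v)‖ =
        8 * ‖(R η v * q v : ℂ)‖ * Real.exp (-4 * R v v) := by
      rw [norm_mul, norm_mul, norm_oscGauss]; simp; ring
    rw [h3]
    calc _ ≤ 8 * (2 ^ 0 * ‖R η‖ * A * (1 + ‖v‖) ^ (k + 1)) *
          Real.exp (-(4 * ρ) * ‖v‖ ^ 2) := by
          have := (norm_nonneg _).trans h1
          gcongr
      _ = _ := by ring

/-- The integral of `q` against the Gaussian translated by the imaginary vector `i t η`. -/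
def shiftInt (μ : Measure E) (R : E →L[ℝ] E →L[ℝ] ℝ) (ζ η : E) (q : E → ℂ) (t : ℝ) : ℂ :=
  Complex.exp ((4 * (t ^ 2 * R η η + t * R ζ η) : ℝ)) *
    ∫ v, q v * oscGauss R (ζ + (2 * t) • η) v ∂μ

/-- With `G` the oscillating Gaussian continued to complex arguments, `shiftInt` is the integral of
`q(v) G(v + itη)`. The `t`-derivative of `G(v + itη)` is `i` times its derivative along `η`, and
integration by parts moves that derivative onto `q` with the opposite sign. -/
lemma hasDerivAt_shiftInt {R : E →L[ℝ] E →L[ℝ] ℝ} (hR : ∀ v w, R v w = R w v) {ρ : ℝ}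
    (hρ : 0 < ρ) (hR' : ∀ v, ρ * ‖v‖ ^ 2 ≤ R v v) (ζ η : E) {q : E → ℂ} {A : ℝ} {k : ℕ}
    (hq : SymbBdd 1 k A q) (t : ℝ) :
    HasDerivAt (shiftInt μ R ζ η q) (-Complex.I * shiftInt μ R ζ η (dird η q) t) t := by
  have h1 := hasDerivAt_integral_oscGauss (μ := μ) hρ hR' ζ η (hq.mono (Nat.zero_le 1)) t
  have ht : HasDerivAt (fun t : ℝ => (t : ℂ)) 1 t := Complex.ofRealCLM.hasDerivAt
  have h2 := ((((ht.pow 2).mul_const ((R η η : ℝ) : ℂ)).add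
    (ht.mul_const ((R ζ η : ℝ) : ℂ))).const_mul (4 : ℂ)).cexp
  have h3 := integral_dird_mul_oscGauss (μ := μ) hR hρ hR' (ζ + (2 * t) • η) η hq
  have e : shiftInt μ R ζ η q = fun t : ℝ => Complex.exp (4 * ((t : ℂ) ^ 2 * (R η η : ℝ) +
      t * (R ζ η : ℝ))) * ∫ v, q v * oscGauss R (ζ + (2 * t) • η) v ∂μ := by
    ext t; simp [shiftInt]
  rw [e]
  refine (h2.mul h1).congr_deriv ?_
  unfold shiftInt
  rw [h3]
  simp only [map_add, map_smul, add_apply, smul_apply, smul_eq_mul, Pi.add_apply, Pi.pow_apply]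
  push_cast
  linear_combination (4 * (Complex.exp (4 * ((t : ℂ) ^ 2 * (R η η : ℝ) + t * (R ζ η : ℝ)))) *
    (R ζ η + 2 * t * R η η) * ∫ v, q v * oscGauss R (ζ + (2 * t) • η) v ∂μ) * Complex.I_sq

/-- In a tower `G k' = G (k+1)` the derivative of `∑ (-t)^k/k! · G k t` telescopes to its last term.
The sum is `G 0 0` at `t = 0` and the Taylor expansion based at `1` when `t = 1`; the mean value
inequality compares the two. -/
lemma norm_taylor_sub_le {G : ℕ → ℝ → ℂ} (hG : ∀ k t, HasDerivAt (G k) (G (k + 1) t) t) (n : ℕ)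
    {B : ℝ} (hB : ∀ t ∈ Set.Icc (0 : ℝ) 1, ‖G (n + 1) t‖ ≤ B) :
    ‖G 0 0 - ∑ k ∈ Finset.range (n + 1), (-1 : ℂ) ^ k / k.factorial * G k 1‖ ≤ B / n.factorial := by
  have hd : ∀ (n : ℕ) (t : ℝ), HasDerivAt (fun t : ℝ => ∑ k ∈ Finset.range (n + 1),
      (-(t : ℂ)) ^ k / k.factorial * G k t) ((-(t : ℂ)) ^ n / n.factorial * G (n + 1) t) t := by
    intro n t
    induction n with
    | zero => simpa using hG 0 t
    | succ n ih =>
      simp_rw [Finset.sum_range_succ _ (n + 1)]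
      have ht : HasDerivAt (fun t : ℝ => -(t : ℂ)) (-1) t := (Complex.ofRealCLM.hasDerivAt).neg
      have h1 := (((ht.pow (n + 1)).div_const ((n + 1).factorial : ℂ)).mul (hG (n + 1) t))
      refine (ih.add h1).congr_deriv ?_
      have h2 : ((n + 1 : ℕ) : ℂ) ≠ 0 := by exact_mod_cast Nat.succ_ne_zero n
      have h3 : ((n.factorial : ℕ) : ℂ) ≠ 0 := by exact_mod_cast n.factorial_ne_zero
      simp only [Nat.factorial_succ, Pi.pow_apply]
      push_cast at h2 ⊢
      field_simp
      simp
  have h1 := norm_image_sub_le_of_norm_deriv_le_segment_01' (f := fun t : ℝ =>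
    ∑ k ∈ Finset.range (n + 1), (-(t : ℂ)) ^ k / k.factorial * G k t) (C := B / n.factorial)
    (fun t _ => (hd n t).hasDerivWithinAt) (fun t ht => by
      have ht' : t ∈ Set.Icc (0 : ℝ) 1 := ⟨ht.1, ht.2.le⟩
      rw [norm_mul, norm_div, norm_pow, norm_neg, Complex.norm_natCast, Complex.norm_real,
        Real.norm_of_nonneg ht'.1, div_mul_eq_mul_div]
      gcongr
      calc t ^ n * ‖G (n + 1) t‖ ≤ 1 * B :=
            mul_le_mul (pow_le_one₀ ht'.1 ht'.2) (hB t ht') (norm_nonneg _) zero_le_one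
        _ = B := one_mul B)
  have h2 : (∑ k ∈ Finset.range (n + 1), (-((0 : ℝ) : ℂ)) ^ k / k.factorial * G k 0) = G 0 0 := by
    rw [Finset.sum_range_succ']
    simp
  rw [norm_sub_rev]
  simpa only [h2, Complex.ofReal_one] using h1

/-- The contour shift for symbols which need not be analytic: a Taylor expansion of order `n`
replaces the analytic continuation. -/
lemma norm_integral_sub_shift_le {R : E →L[ℝ] E →L[ℝ] ℝ} (hR : ∀ v w, R v w = R w v) {ρ : ℝ}
    (hρ : 0 < ρ) (hR' : ∀ v, ρ * ‖v‖ ^ 2 ≤ R v v) (ζ η : E) {q : E → ℂ}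
    (hq : ∀ J, ∃ A, SymbBdd J 0 A q) (n : ℕ) {B : ℝ}
    (hB : ∀ t ∈ Set.Icc (0 : ℝ) 1, ‖shiftInt μ R ζ η ((dird η)^[n + 1] q) t‖ ≤ B) :
    ‖∫ v, q v * oscGauss R ζ v ∂μ - ∑ k ∈ Finset.range (n + 1),
      Complex.I ^ k / k.factorial * shiftInt μ R ζ η ((dird η)^[k] q) 1‖ ≤ B / n.factorial := by
  have hk : ∀ k J, ∃ A, SymbBdd J 0 A ((dird η)^[k] q) := by
    intro k
    induction k with
    | zero => simpa using hq
    | succ k ih =>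
      intro J
      obtain ⟨A, hA⟩ := ih (J + 1)
      rw [Function.iterate_succ_apply']
      exact ⟨_, hA.dird η⟩
  -- By `hasDerivAt_shiftInt` the functions `(-i)^k · shiftInt (∂_η^k q)` form a tower of successive
  -- derivatives.
  have hG : ∀ k t, HasDerivAt (fun t => (-Complex.I) ^ k * shiftInt μ R ζ η ((dird η)^[k] q) t)
      ((-Complex.I) ^ (k + 1) * shiftInt μ R ζ η ((dird η)^[k + 1] q) t) t := by
    intro k t
    obtain ⟨A, hA⟩ := hk k 1
    refine ((hasDerivAt_shiftInt (μ := μ) hR hρ hR' ζ η hA t).const_mul _).congr_deriv ?_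
    rw [Function.iterate_succ_apply']; ring
  have key := norm_taylor_sub_le hG n (B := B) (fun t ht => by
    rw [norm_mul, norm_pow, norm_neg, Complex.norm_I, one_pow, one_mul]; exact hB t ht)
  convert key using 3
  · simp [shiftInt]
  · refine Finset.sum_congr rfl fun k _ => ?_
    have h1 : Complex.I ^ k = (-1) ^ k * (-Complex.I) ^ k := by rw [← mul_pow]; simp
    rw [h1]; ring

end Shift

/-! ### Truncated Taylor expansions of Gevrey symbols at complex points. -/

section Gevrey

variable {E : Type*} [NormedAddCommGroup E] [NormedSpace ℝ E]

/-- Gevrey bounds of order `s` for all derivatives in operator norm. -/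
def GevreyNorm (s M r : ℝ) (σ : E → ℂ) : Prop :=
  ContDiff ℝ ∞ σ ∧ ∀ j v, ‖iteratedFDeriv ℝ j σ v‖ ≤ M * r ^ j * (j.factorial : ℝ) ^ s

/-- The Taylor polynomial replacing `σ (v + i η)`. -/
def taylorShift (σ : E → ℂ) (η : E) (n : ℕ) (v : E) : ℂ :=
  ∑ k ∈ Finset.range n, (Complex.I ^ k / k.factorial) * (dird η)^[k] σ v

variable {s M r δ : ℝ} {σ : E → ℂ}

lemma GevreyNorm.nonneg (h : GevreyNorm s M r σ) : 0 ≤ M := by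
  simpa using (norm_nonneg _).trans (h.2 0 0)

lemma factorial_add_le (j k : ℕ) : (j + k).factorial ≤ 2 ^ (j + k) * (j.factorial * k.factorial) := by
  rw [← Nat.add_choose_mul_factorial_mul_factorial j k, mul_assoc]
  exact Nat.mul_le_mul_right _ (Nat.choose_le_two_pow _ _)

lemma factorial_add_rpow_le (hs : 0 ≤ s) (j k : ℕ) : ((j + k).factorial : ℝ) ^ s ≤
    ((2 : ℝ) ^ s) ^ j * ((2 : ℝ) ^ s) ^ k * ((j.factorial : ℝ) ^ s * (k.factorial : ℝ) ^ s) := by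
  calc ((j + k).factorial : ℝ) ^ s ≤ ((2 : ℝ) ^ (j + k) * (j.factorial * k.factorial)) ^ s := by
        refine Real.rpow_le_rpow (by positivity) ?_ hs
        exact_mod_cast factorial_add_le j k
    _ = _ := by
        rw [Real.mul_rpow (by positivity) (by positivity),
          Real.mul_rpow (by positivity) (by positivity), ← pow_add, ← Real.rpow_natCast_mul
            (by norm_num : (0 : ℝ) ≤ 2), ← Real.rpow_mul_natCast (by norm_num : (0 : ℝ) ≤ 2),
          mul_comm s]

lemma factorial_rpow_le (hs : 0 ≤ s) {k n : ℕ} (hk : k ≤ n) :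
    (k.factorial : ℝ) ^ s ≤ ((n : ℝ) ^ s) ^ k := by
  rw [← Real.rpow_mul_natCast (by positivity), mul_comm, Real.rpow_natCast_mul (by positivity)]
  refine Real.rpow_le_rpow (by positivity) ?_ hs
  exact_mod_cast (Nat.factorial_le_pow k).trans (Nat.pow_le_pow_left hk k)

/-- One power of `n` fewer than in `factorial_rpow_le`: in the Lipschitz bound in `η`, the term of
order `k + 1` offers only `k` factors `δ` to compensate. -/
lemma factorial_rpow_le_pred (hs : 0 ≤ s) {k n : ℕ} (hk : k + 1 ≤ n) :
    ((k + 1).factorial : ℝ) ^ s ≤ ((n : ℝ) ^ s) ^ k := by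
  rw [← Real.rpow_mul_natCast (by positivity), mul_comm, Real.rpow_natCast_mul (by positivity)]
  refine Real.rpow_le_rpow (by positivity) ?_ hs
  have : (k + 1).factorial ≤ (k + 1) ^ k := by
    induction k with
    | zero => simp
    | succ k ih =>
      rw [Nat.factorial_succ, pow_succ, mul_comm]
      exact Nat.mul_le_mul_right _ ((ih (by omega)).trans (Nat.pow_le_pow_left (by omega) k))
  exact_mod_cast this.trans (Nat.pow_le_pow_left hk k)

lemma factorial_rpow_div (k : ℕ) (s : ℝ) :
    (k.factorial : ℝ) ^ s / k.factorial = (k.factorial : ℝ) ^ (s - 1) := by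
  rw [Real.rpow_sub_one (by positivity)]

lemma contDiff_taylorShift (hσ : ContDiff ℝ ∞ σ) (η : E) (n : ℕ) :
    ContDiff ℝ ∞ (taylorShift σ η n) := by
  unfold taylorShift
  exact ContDiff.sum fun k _ => contDiff_const.mul (contDiff_iterate_dird hσ η k)

lemma GevreyNorm.iterate_dird_le (h : GevreyNorm s M r σ) (hs : 0 ≤ s) (hr : 0 ≤ r) {η : E}
    (hη : ‖η‖ * r ≤ δ) (j k : ℕ) (v : E) :
    ‖iteratedFDeriv ℝ j ((dird η)^[k] σ) v‖ ≤
      M * (r * 2 ^ s) ^ j * (j.factorial : ℝ) ^ s * ((δ * 2 ^ s) ^ k * (k.factorial : ℝ) ^ s) := by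
  have hM := h.nonneg
  refine (norm_iteratedFDeriv_iterate_dird_le h.1 η k j v).trans ?_
  calc _ ≤ ‖η‖ ^ k * (M * r ^ (j + k) * (((2 : ℝ) ^ s) ^ j * ((2 : ℝ) ^ s) ^ k *
        ((j.factorial : ℝ) ^ s * (k.factorial : ℝ) ^ s))) := by
        gcongr
        exact (h.2 _ v).trans (by gcongr; exact factorial_add_rpow_le hs j k)
    _ = M * (r * 2 ^ s) ^ j * (j.factorial : ℝ) ^ s *
        (((‖η‖ * r) * 2 ^ s) ^ k * (k.factorial : ℝ) ^ s) := by
        rw [pow_add]; simp only [mul_pow]; ring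
    _ ≤ _ := by gcongr

/-- For `s > 1` the full Taylor series may diverge. Below order `n`, however, `k!^(s-1) ≤
n^((s-1)k)`, so the `k`-th term is at most `(2^s δ n^(s-1))^k ≤ 2^{-k}` times the size of the
symbol, and the truncated sum is harmless together with all its derivatives. -/
lemma GevreyNorm.taylorShift_le (h : GevreyNorm s M r σ) (hs : 1 ≤ s) (hr : 0 ≤ r) {η : E}
    (hη : ‖η‖ * r ≤ δ) {n : ℕ} (hn : 2 ^ (s + 1) * δ * (n : ℝ) ^ (s - 1) ≤ 1) (j : ℕ) (v : E) :
    ‖iteratedFDeriv ℝ j (taylorShift σ η n) v‖ ≤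
      2 * (M * (r * 2 ^ s) ^ j * (j.factorial : ℝ) ^ s) := by
  have hM := h.nonneg
  have hδ : 0 ≤ δ := le_trans (by positivity) hη
  have hc : ∀ k : ℕ, ContDiffAt ℝ j (fun v => (Complex.I ^ k / k.factorial) * (dird η)^[k] σ v) v :=
    fun k => (contDiff_const.mul (contDiff_iterate_dird h.1 η k)).contDiffAt.of_le
      (by exact_mod_cast le_top)
  have e : iteratedFDeriv ℝ j (taylorShift σ η n) v = ∑ k ∈ Finset.range n,
      (Complex.I ^ k / k.factorial : ℂ) • iteratedFDeriv ℝ j ((dird η)^[k] σ) v := by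
    unfold taylorShift
    rw [iteratedFDeriv_fun_sum_apply (fun k _ => hc k)]
    refine Finset.sum_congr rfl fun k _ => ?_
    have := iteratedFDeriv_const_smul_apply (𝕜 := ℝ) (i := j)
      (a := (Complex.I ^ k / k.factorial : ℂ)) (x := v) (f := (dird η)^[k] σ)
      ((contDiff_iterate_dird h.1 η k).contDiffAt.of_le (by exact_mod_cast le_top))
    exact this
  rw [e]
  calc _ ≤ ∑ k ∈ Finset.range n, ‖(Complex.I ^ k / k.factorial : ℂ) •
        iteratedFDeriv ℝ j ((dird η)^[k] σ) v‖ := norm_sum_le _ _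
    _ ≤ ∑ k ∈ Finset.range n, (M * (r * 2 ^ s) ^ j * (j.factorial : ℝ) ^ s) * (1 / 2) ^ k := by
        refine Finset.sum_le_sum fun k hk => ?_
        have hk' : k ≤ n := (Finset.mem_range.1 hk).le
        rw [norm_smul, norm_div, norm_pow, Complex.norm_I, one_pow, Complex.norm_natCast]
        calc _ ≤ 1 / (k.factorial : ℝ) * (M * (r * 2 ^ s) ^ j * (j.factorial : ℝ) ^ s *
              ((δ * 2 ^ s) ^ k * (k.factorial : ℝ) ^ s)) := by
              gcongr; exact h.iterate_dird_le (by linarith) hr hη j k v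
          _ = M * (r * 2 ^ s) ^ j * (j.factorial : ℝ) ^ s *
              ((δ * 2 ^ s) ^ k * (k.factorial : ℝ) ^ (s - 1)) := by
              rw [← factorial_rpow_div]; ring
          _ ≤ M * (r * 2 ^ s) ^ j * (j.factorial : ℝ) ^ s *
              ((δ * 2 ^ s) ^ k * ((n : ℝ) ^ (s - 1)) ^ k) := by
              gcongr; exact factorial_rpow_le (by linarith) hk'
          _ ≤ _ := by
              rw [← mul_pow]
              gcongr
              rw [Real.rpow_add_one (by norm_num)] at hn
              linarith
    _ = (M * (r * 2 ^ s) ^ j * (j.factorial : ℝ) ^ s) * ∑ k ∈ Finset.range n, (1 / 2 : ℝ) ^ k := by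
        rw [Finset.mul_sum]
    _ ≤ (M * (r * 2 ^ s) ^ j * (j.factorial : ℝ) ^ s) * 2 := by
        gcongr
        exact sum_geometric_two_le n
    _ = _ := by ring

/-- The `k`-th term is a `k`-linear form evaluated on the diagonal, so its difference at `η` and
`η'` has the factor `k |η - η'|`. The factor `k` is absorbed by `2^k`, which requires the ratio
`1/4` instead of `1/2`; the hypothesis provides it because `2^(s+1) ≥ 4`. -/
lemma GevreyNorm.taylorShift_sub_le (h : GevreyNorm s M r σ) (hs : 1 ≤ s) (hr : 0 ≤ r) {η η' : E}
    (hη : ‖η‖ * r ≤ δ) (hη' : ‖η'‖ * r ≤ δ) {n : ℕ}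
    (hn : 2 ^ (s + 1) * δ * (n : ℝ) ^ (s - 1) ≤ 1) (v : E) :
    ‖taylorShift σ η n v - taylorShift σ η' n v‖ ≤ 8 * (M * r * ‖η - η'‖) := by
  have hM := h.nonneg
  have hδ : 0 ≤ δ := le_trans (by positivity) hη
  unfold taylorShift
  rw [← Finset.sum_sub_distrib]
  have hn4 : δ * (n : ℝ) ^ (s - 1) ≤ 1 / 4 := by
    have h4 : (4 : ℝ) ≤ 2 ^ (s + 1) := by
      calc (4 : ℝ) = 2 ^ (2 : ℝ) := by norm_num
        _ ≤ _ := Real.rpow_le_rpow_of_exponent_le (by norm_num) (by linarith)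
    have : 0 ≤ δ * (n : ℝ) ^ (s - 1) := by positivity
    nlinarith
  calc _ ≤ ∑ k ∈ Finset.range n, ‖Complex.I ^ k / k.factorial * (dird η)^[k] σ v -
        Complex.I ^ k / k.factorial * (dird η')^[k] σ v‖ := norm_sum_le _ _
    _ ≤ ∑ k ∈ Finset.range n, (4 * (M * r * ‖η - η'‖)) * (1 / 2) ^ k := by
        refine Finset.sum_le_sum fun k hk => ?_
        rw [← mul_sub, norm_mul, norm_div, norm_pow, Complex.norm_I, one_pow, Complex.norm_natCast]
        match k, hk with
        | 0, _ => simp; positivity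
        | k + 1, hk =>
          rw [iterate_dird_eq h.1, iterate_dird_eq h.1]
          have h1 := (iteratedFDeriv ℝ (k + 1) σ v).norm_image_sub_le (fun _ => η) (fun _ => η')
          rw [Fintype.card_fin, Nat.add_sub_cancel] at h1
          have h2 : ‖(fun _ : Fin (k + 1) => η) - fun _ => η'‖ = ‖η - η'‖ :=
            pi_norm_const (ι := Fin (k + 1)) (η - η')
          rw [pi_norm_const, pi_norm_const, h2] at h1
          have h3 : max ‖η‖ ‖η'‖ ^ k * r ^ k ≤ δ ^ k := by
            rw [← mul_pow]
            refine pow_le_pow_left₀ (by positivity) ?_ k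
            rcases max_choice ‖η‖ ‖η'‖ with h | h <;> rw [h] <;> assumption
          calc _ ≤ 1 / ((k + 1).factorial : ℝ) * ((M * r ^ (k + 1) * ((k + 1).factorial : ℝ) ^ s) *
                (k + 1 : ℕ) * max ‖η‖ ‖η'‖ ^ k * ‖η - η'‖) := by
                gcongr
                exact h1.trans (by gcongr; exact h.2 _ v)
            _ = (M * r * ‖η - η'‖) * ((k + 1 : ℕ) * (max ‖η‖ ‖η'‖ ^ k * r ^ k *
                ((k + 1).factorial : ℝ) ^ (s - 1))) := by
                rw [← factorial_rpow_div, pow_succ]; ring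
            _ ≤ (M * r * ‖η - η'‖) * (2 ^ (k + 1) * (δ ^ k * ((n : ℝ) ^ (s - 1)) ^ k)) := by
                gcongr
                · exact_mod_cast (Nat.lt_two_pow_self).le
                · exact factorial_rpow_le_pred (by linarith) (Finset.mem_range.1 hk).le
            _ ≤ (M * r * ‖η - η'‖) * (2 ^ (k + 1) * (1 / 4) ^ k) := by
                rw [← mul_pow]; gcongr
            _ = _ := by
                rw [pow_succ, pow_succ, show (1 / 4 : ℝ) = 1 / 2 * (1 / 2) by norm_num, mul_pow]
                have : (2 : ℝ) ^ k * (1 / 2) ^ k = 1 := by rw [← mul_pow]; norm_num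
                linear_combination (2 * (M * r * ‖η - η'‖) * (1 / 2) ^ k) * this
    _ = (4 * (M * r * ‖η - η'‖)) * ∑ k ∈ Finset.range n, (1 / 2 : ℝ) ^ k := by
        rw [Finset.mul_sum]
    _ ≤ (4 * (M * r * ‖η - η'‖)) * 2 := by
        gcongr
        exact sum_geometric_two_le n
    _ = _ := by ring

lemma taylorShift_zero (σ : E → ℂ) (v : E) {n : ℕ} (hn : n ≠ 0) : taylorShift σ 0 n v = σ v := by
  obtain ⟨n, rfl⟩ := Nat.exists_eq_succ_of_ne_zero hn
  unfold taylorShift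
  rw [Finset.sum_range_succ', Finset.sum_eq_zero]
  · simp
  · intro k _
    rw [Function.iterate_succ_apply']
    simp [dird]

lemma GevreyNorm.symbBdd (h : GevreyNorm s M r σ) (J : ℕ) : ∃ A, SymbBdd J 0 A σ := by
  have : ∀ j : ℕ, 0 ≤ M * |r| ^ j * (j.factorial : ℝ) ^ s := fun j => by
    have := h.nonneg; positivity
  refine ⟨∑ j ∈ Finset.range (J + 1), M * |r| ^ j * (j.factorial : ℝ) ^ s, h.1, fun j hj v => ?_⟩
  rw [pow_zero, mul_one]
  refine (h.2 j v).trans (le_trans ?_ (Finset.single_le_sum (fun i _ => this i)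
    (Finset.mem_range.2 (Nat.lt_succ_of_le hj))))
  have := h.nonneg
  rw [← abs_pow]
  gcongr
  exact le_abs_self _

lemma SymbBdd.const (b : ℂ) (J : ℕ) : SymbBdd J 0 ‖b‖ (fun _ : E => b) := by
  refine ⟨contDiff_const, fun j _ v => ?_⟩
  rw [pow_zero, mul_one]
  rcases Nat.eq_zero_or_pos j with rfl | hj
  · simp
  · rw [iteratedFDeriv_const_of_ne hj.ne']; simp

variable [FiniteDimensional ℝ E] [MeasurableSpace E] [BorelSpace E] {μ : Measure E}
  [μ.IsAddHaarMeasure]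

/-- The kernel estimate: up to an exponentially small error, `∫ (σ - b)` against an oscillating
Gaussian is controlled by the Gaussian shifted by `i η`, if `b` approximates `σ (v₀ + i η₀)`. -/
lemma exists_kernel_bound (μ : Measure E) [μ.IsAddHaarMeasure]
    {R : E →L[ℝ] E →L[ℝ] ℝ} (hR : ∀ v w, R v w = R w v) {ρ : ℝ}
    (hρ : 0 < ρ) (hR' : ∀ v, ρ * ‖v‖ ^ 2 ≤ R v v) (N : ℕ) {s : ℝ} (hs : 1 ≤ s) :
    ∃ C : ℝ, 0 ≤ C ∧ ∀ (σ : E → ℂ) (M r δ : ℝ) (η η₀ ζ v₀ : E) (n : ℕ) (W : ℝ),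
      GevreyNorm s M r σ → 0 ≤ r → r ≤ 1 → ‖η‖ * r ≤ δ → ‖η₀‖ * r ≤ δ → n ≠ 0 →
      Real.exp 1 * (2 ^ (s + 1) * δ * (n : ℝ) ^ (s - 1)) ≤ 1 →
      (∀ t ∈ Set.Icc (0 : ℝ) 1, Real.exp (4 * (t ^ 2 * R η η + t * R ζ η)) ≤
        W * (1 + ‖ζ + (2 * t) • η‖) ^ N) →
      ‖∫ v, (σ v - taylorShift σ η₀ n v₀) * oscGauss R ζ v ∂μ‖ ≤
        C * M * (r * (1 + ‖v₀‖ + ‖η - η₀‖) * (Real.exp (4 * (R η η + R ζ η)) *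
          ((1 + ‖ζ + (2 : ℝ) • η‖) ^ N)⁻¹) + Real.exp (-n) * W) := by
  obtain ⟨C₁, hC₁, h₁⟩ := exists_osc_bound μ hR hρ hR' N 1
  obtain ⟨C₀, hC₀, h₀⟩ := exists_osc_bound μ hR hρ hR' N 0
  set D : ℝ := (2 ^ s) ^ N * (N.factorial : ℝ) ^ s with hD
  have hD1 : ∀ j ≤ N, ((2 : ℝ) ^ s) ^ j * (j.factorial : ℝ) ^ s ≤ D := fun j hj => by
    have : (1 : ℝ) ≤ 2 ^ s := Real.one_le_rpow (by norm_num) (by linarith)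
    rw [hD]; gcongr
  have hD0 : 1 ≤ D := by simpa using hD1 0 (Nat.zero_le _)
  refine ⟨C₁ * (2 * D + 2 * 2 ^ s + 8) + C₀ * D, by positivity, fun σ M r δ η η₀ ζ v₀ n W hσ hr hr1
    hη hη₀ hn0 hn hW => ?_⟩
  have hM := hσ.nonneg
  have hδ : 0 ≤ δ := le_trans (by positivity) hη
  have hW0 : 0 ≤ W := by
    have := (Real.exp_pos _).le.trans (hW 0 (by simp))
    exact nonneg_of_mul_nonneg_left this (by positivity)
  have he1 : 1 ≤ Real.exp 1 := Real.one_le_exp zero_le_one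
  have hn1 : 2 ^ (s + 1) * δ * (n : ℝ) ^ (s - 1) ≤ 1 := by
    have : 0 ≤ 2 ^ (s + 1) * δ * (n : ℝ) ^ (s - 1) := by positivity
    nlinarith
  set b := taylorShift σ η₀ n v₀ with hb
  obtain ⟨n, rfl⟩ := Nat.exists_eq_succ_of_ne_zero hn0
  -- Every bound carries a factor `r`. For the value it comes from the Lipschitz estimates in `v`
  -- and in `η`, the former causing linear growth (exponent `1`); for derivatives of order `j ≥ 1`
  -- it comes from `r^j ≤ r`.
  have hσq : SymbBdd N 1 (M * (2 * D + 2 * 2 ^ s + 8) * (r * (1 + ‖v₀‖ + ‖η - η₀‖)))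
      (fun v => taylorShift σ η (n + 1) v - b) := by
    refine ⟨(contDiff_taylorShift hσ.1 η _).sub contDiff_const, fun j hj v => ?_⟩
    rcases Nat.eq_zero_or_pos j with rfl | hj0
    · rw [norm_iteratedFDeriv_zero, pow_one]
      have l1 : ‖taylorShift σ η (n + 1) v - taylorShift σ η (n + 1) v₀‖ ≤
          (2 * (M * (r * 2 ^ s))) * ‖v - v₀‖ := by
        refine Convex.norm_image_sub_le_of_norm_fderiv_le (𝕜 := ℝ) (s := Set.univ)
          (fun x _ => ((contDiff_taylorShift hσ.1 η _).differentiable (by simp)) x)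
          (fun x _ => ?_) convex_univ (Set.mem_univ _) (Set.mem_univ _)
        have := hσ.taylorShift_le hs hr hη hn1 1 x
        rw [← norm_iteratedFDeriv_one (𝕜 := ℝ)]
        simpa using this
      have l2 := hσ.taylorShift_sub_le hs hr hη hη₀ hn1 v₀
      have l3 : ‖v - v₀‖ ≤ (1 + ‖v₀‖ + ‖η - η₀‖) * (1 + ‖v‖) := by
        have := norm_sub_le v v₀
        nlinarith [norm_nonneg v, norm_nonneg v₀, norm_nonneg (η - η₀),
          mul_nonneg (norm_nonneg v) (norm_nonneg v₀),
          mul_nonneg (norm_nonneg v) (norm_nonneg (η - η₀))]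
      have l4 : ‖η - η₀‖ ≤ (1 + ‖v₀‖ + ‖η - η₀‖) * (1 + ‖v‖) := by
        nlinarith [norm_nonneg v, norm_nonneg v₀, norm_nonneg (η - η₀),
          mul_nonneg (norm_nonneg v) (norm_nonneg v₀),
          mul_nonneg (norm_nonneg v) (norm_nonneg (η - η₀))]
      calc _ ≤ ‖taylorShift σ η (n + 1) v - taylorShift σ η (n + 1) v₀‖ +
            ‖taylorShift σ η (n + 1) v₀ - b‖ := norm_sub_le_norm_sub_add_norm_sub _ _ _
        _ ≤ (2 * (M * (r * 2 ^ s))) * ((1 + ‖v₀‖ + ‖η - η₀‖) * (1 + ‖v‖)) +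
            8 * (M * r * ((1 + ‖v₀‖ + ‖η - η₀‖) * (1 + ‖v‖))) :=
            add_le_add (l1.trans (by gcongr)) (l2.trans (by gcongr))
        _ = M * (2 * 2 ^ s + 8) * (r * (1 + ‖v₀‖ + ‖η - η₀‖)) * (1 + ‖v‖) := by ring
        _ ≤ _ := by gcongr; linarith
    · have e : iteratedFDeriv ℝ j (fun v => taylorShift σ η (n + 1) v - b) v =
          iteratedFDeriv ℝ j (taylorShift σ η (n + 1)) v := by
        have := iteratedFDeriv_sub_apply (𝕜 := ℝ) (i := j) (x := v)
          (f := taylorShift σ η (n + 1)) (g := fun _ => b)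
          ((contDiff_taylorShift hσ.1 η _).contDiffAt.of_le (by exact_mod_cast le_top))
          contDiff_const.contDiffAt
        rw [iteratedFDeriv_const_of_ne hj0.ne', Pi.zero_apply, sub_zero] at this
        exact this
      rw [e]
      calc _ ≤ _ := hσ.taylorShift_le hs hr hη hn1 j v
        _ = (2 * M) * (r ^ j * ((2 ^ s) ^ j * (j.factorial : ℝ) ^ s)) := by rw [mul_pow]; ring
        _ ≤ (2 * M) * (r * D) := by
            gcongr
            · exact pow_le_of_le_one hr hr1 hj0.ne'
            · exact hD1 j hj
        _ = M * (2 * D) * (r * 1) * 1 := by ring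
        _ ≤ _ := by
            have h2s : (0 : ℝ) ≤ 2 * 2 ^ s := by positivity
            have := norm_nonneg v
            gcongr
            · linarith
            · linarith [norm_nonneg v₀, norm_nonneg (η - η₀)]
            · rw [pow_one]; linarith
  -- the remainder
  have hrem : ∀ t ∈ Set.Icc (0 : ℝ) 1, ‖shiftInt μ R ζ η ((dird η)^[n + 1] σ) t‖ ≤
      C₀ * (M * D * ((δ * 2 ^ s) ^ (n + 1) * ((n + 1).factorial : ℝ) ^ s)) * W := by
    intro t ht
    have hS : SymbBdd N 0 (M * D * ((δ * 2 ^ s) ^ (n + 1) * ((n + 1).factorial : ℝ) ^ s))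
        ((dird η)^[n + 1] σ) := by
      refine ⟨contDiff_iterate_dird hσ.1 η _, fun j hj v => ?_⟩
      rw [pow_zero, mul_one]
      refine (hσ.iterate_dird_le (by linarith) hr hη j (n + 1) v).trans ?_
      refine mul_le_mul_of_nonneg_right ?_ (by positivity)
      calc _ = M * (r ^ j * ((2 ^ s) ^ j * (j.factorial : ℝ) ^ s)) := by rw [mul_pow]; ring
        _ ≤ M * (1 * D) := by
            gcongr
            · exact pow_le_one₀ hr hr1
            · exact hD1 j hj
        _ = M * D := by ring
    have h5 := h₀ _ _ (ζ + (2 * t) • η) hS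
    rw [shiftInt, norm_mul, Complex.norm_exp, Complex.ofReal_re]
    calc _ ≤ (W * (1 + ‖ζ + (2 * t) • η‖) ^ N) *
          ‖∫ v, (dird η)^[n + 1] σ v * oscGauss R (ζ + (2 * t) • η) v ∂μ‖ := by
          gcongr; exact hW t ht
      _ = W * ((1 + ‖ζ + (2 * t) • η‖) ^ N *
          ‖∫ v, (dird η)^[n + 1] σ v * oscGauss R (ζ + (2 * t) • η) v ∂μ‖) := by ring
      _ ≤ W * (C₀ * (M * D * ((δ * 2 ^ s) ^ (n + 1) * ((n + 1).factorial : ℝ) ^ s))) :=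
          mul_le_mul_of_nonneg_left h5 hW0
      _ = _ := by ring
  -- The Gevrey loss `(n+1)!^s` is divided by `n!` only; the extra factor `n + 1` is put into
  -- `2^(n+1)`. The factor `e` in the hypothesis on `δ` then turns the geometric rate into `e^{-1}`
  -- per order.
  have hexp : (δ * 2 ^ s) ^ (n + 1) * ((n + 1).factorial : ℝ) ^ s / n.factorial ≤
      Real.exp (-((n + 1 : ℕ) : ℝ)) := by
    have h6 : δ * 2 ^ s * ((n + 1 : ℕ) : ℝ) ^ (s - 1) ≤ Real.exp (-1) / 2 := by
      rw [Real.rpow_add_one (by norm_num)] at hn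
      rw [Real.exp_neg, inv_eq_one_div, div_div, le_div_iff₀ (by positivity)]
      simp only [Nat.succ_eq_add_one] at hn
      linarith
    calc _ = (n + 1 : ℕ) * ((δ * 2 ^ s) ^ (n + 1) * ((n + 1).factorial : ℝ) ^ (s - 1)) := by
          rw [← factorial_rpow_div, Nat.factorial_succ]
          push_cast
          field_simp
      _ ≤ 2 ^ (n + 1) * ((δ * 2 ^ s) ^ (n + 1) * (((n + 1 : ℕ) : ℝ) ^ (s - 1)) ^ (n + 1)) := by
          gcongr
          · exact_mod_cast (Nat.lt_two_pow_self).le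
          · exact factorial_rpow_le (by linarith) le_rfl
      _ = (2 * (δ * 2 ^ s * ((n + 1 : ℕ) : ℝ) ^ (s - 1))) ^ (n + 1) := by
          rw [← mul_pow, ← mul_pow]
      _ ≤ (Real.exp (-1)) ^ (n + 1) := by
          gcongr; linarith
      _ = _ := by rw [← Real.exp_nat_mul]; congr 1; push_cast; ring
  have hσi : ∀ ζ, Integrable (fun v => σ v * oscGauss R ζ v) μ := fun ζ => by
    obtain ⟨A, hA⟩ := hσ.symbBdd 0
    exact integrable_symb_mul_oscGauss hρ hR' ζ hσ.1.continuous hA.norm_le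
  have hci : ∀ (b : ℂ) ζ, Integrable (fun v => b * oscGauss R ζ v) μ := fun b ζ =>
    integrable_symb_mul_oscGauss hρ hR' ζ continuous_const (SymbBdd.const b 0).norm_le
  have hki : ∀ (k : ℕ) ζ, Integrable (fun v => (dird η)^[k] σ v * oscGauss R ζ v) μ := fun k ζ =>
    integrable_symb_mul_oscGauss (k := 0) (A := M * (r * 2 ^ s) ^ 0 * ((0).factorial : ℝ) ^ s *
      ((δ * 2 ^ s) ^ k * (k.factorial : ℝ) ^ s)) hρ hR' ζ
      (contDiff_iterate_dird hσ.1 η k).continuous (fun v => by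
        simpa using hσ.iterate_dird_le (by linarith) hr hη 0 k v)
  have key1 := norm_integral_sub_shift_le (μ := μ) hR hρ hR' ζ η hσ.symbBdd n hrem
  -- A constant symbol has no Taylor remainder, even at order `0`: its integral is exactly the
  -- shifted one, so `b` can be subtracted after the shift.
  have key2 := norm_integral_sub_shift_le (μ := μ) hR hρ hR' ζ η (q := fun _ => b)
    (fun J => ⟨_, SymbBdd.const b J⟩) 0 (B := 0) (fun t _ => by
      have : dird η (fun _ : E => b) = fun _ => 0 := by ext v; simp [dird]
      simp [shiftInt, this])
  rw [zero_div, norm_le_zero_iff, sub_eq_zero] at key2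
  have e1 : ∑ k ∈ Finset.range (n + 1), Complex.I ^ k / k.factorial *
      shiftInt μ R ζ η ((dird η)^[k] σ) 1 =
      shiftInt μ R ζ η (fun v => taylorShift σ η (n + 1) v) 1 := by
    simp only [shiftInt, taylorShift, Finset.sum_mul]
    rw [integral_finsetSum _ (fun k _ => by
      simp_rw [mul_assoc]; exact (hki k _).const_mul _), Finset.mul_sum]
    refine Finset.sum_congr rfl fun k _ => ?_
    simp_rw [mul_assoc]
    rw [integral_const_mul]; ring
  have e2 : shiftInt μ R ζ η (fun v => taylorShift σ η (n + 1) v - b) 1 =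
      shiftInt μ R ζ η (fun v => taylorShift σ η (n + 1) v) 1 - shiftInt μ R ζ η (fun _ => b) 1 := by
    simp only [shiftInt, sub_mul]
    rw [integral_sub _ (hci b _), mul_sub]
    simp only [taylorShift, Finset.sum_mul]
    exact integrable_finsetSum _ fun k _ => by simp_rw [mul_assoc]; exact (hki k _).const_mul _
  have e3 : ∫ v, (σ v - b) * oscGauss R ζ v ∂μ =
      (∫ v, σ v * oscGauss R ζ v ∂μ - ∑ k ∈ Finset.range (n + 1), Complex.I ^ k / k.factorial *
      shiftInt μ R ζ η ((dird η)^[k] σ) 1) +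
      shiftInt μ R ζ η (fun v => taylorShift σ η (n + 1) v - b) 1 := by
    simp only [sub_mul]
    rw [integral_sub (hσi ζ) (hci b ζ), key2, e1, e2]
    simp
  have hmain : ‖shiftInt μ R ζ η (fun v => taylorShift σ η (n + 1) v - b) 1‖ ≤
      C₁ * (M * (2 * D + 2 * 2 ^ s + 8)) * (r * (1 + ‖v₀‖ + ‖η - η₀‖) *
        (Real.exp (4 * (R η η + R ζ η)) * ((1 + ‖ζ + (2 : ℝ) • η‖) ^ N)⁻¹)) := by
    have h7 := h₁ _ _ (ζ + (2 : ℝ) • η) hσq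
    rw [shiftInt, norm_mul, Complex.norm_exp, Complex.ofReal_re]
    simp only [one_pow, one_mul, mul_one]
    rw [← le_div_iff₀' (by positivity)] at h7
    refine (mul_le_mul_of_nonneg_left h7 (Real.exp_pos _).le).trans (le_of_eq ?_)
    field_simp
  rw [e3]
  calc _ ≤ _ := norm_add_le _ _
    _ ≤ C₀ * (M * D * ((δ * 2 ^ s) ^ (n + 1) * ((n + 1).factorial : ℝ) ^ s)) * W / n.factorial + _ :=
        add_le_add key1 hmain
    _ = C₀ * (M * D * W) * ((δ * 2 ^ s) ^ (n + 1) * ((n + 1).factorial : ℝ) ^ s / n.factorial) + _ := by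
        congr 1; ring
    _ ≤ C₀ * (M * D * W) * Real.exp (-((n + 1 : ℕ) : ℝ)) + _ := by gcongr
    _ ≤ (C₀ * D + C₁ * (2 * D + 2 * 2 ^ s + 8)) * M * (Real.exp (-((n + 1 : ℕ) : ℝ)) * W) + 
        (C₁ * (2 * D + 2 * 2 ^ s + 8) + C₀ * D) * M * (r * (1 + ‖v₀‖ + ‖η - η₀‖) *
        (Real.exp (4 * (R η η + R ζ η)) * ((1 + ‖ζ + (2 : ℝ) • η‖) ^ N)⁻¹)) := by
        refine add_le_add ?_ ?_
        · calc _ = C₀ * D * M * (Real.exp (-((n + 1 : ℕ) : ℝ)) * W) := by ring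
            _ ≤ _ := by gcongr; exact le_add_of_nonneg_right (by positivity)
        · rw [show C₁ * (M * (2 * D + 2 * 2 ^ s + 8)) = C₁ * (2 * D + 2 * 2 ^ s + 8) * M by ring]
          gcongr; exact le_add_of_nonneg_right (by positivity)
    _ = _ := by simp only [Nat.succ_eq_add_one]; ring

end Gevrey

/-! ### Young's inequality, and holomorphic dependence on parameters. -/

section Tools

variable {E : Type*} [NormedAddCommGroup E] [NormedSpace ℝ E] [FiniteDimensional ℝ E]
  [MeasurableSpace E] [BorelSpace E] {μ : Measure E} [μ.IsAddHaarMeasure]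

/-- Young's inequality `‖g * w‖₂ ≤ ‖g‖₁ ‖w‖₂`. -/
lemma lintegral_conv_sq_le {g w : E → ℝ≥0∞} (hg : Measurable g) (hw : AEMeasurable w μ) :
    ∫⁻ x, (∫⁻ y, g (x - y) * w y ∂μ) ^ (2 : ℝ) ∂μ ≤
      (∫⁻ x, g x ∂μ) ^ (2 : ℝ) * ∫⁻ y, w y ^ (2 : ℝ) ∂μ := by
  have hg2 : Measurable fun p : E × E => g (p.1 - p.2) := hg.comp (measurable_fst.sub measurable_snd)
  have hG : ∀ x, ∫⁻ y, g (x - y) ∂μ = ∫⁻ y, g y ∂μ := fun x => lintegral_sub_left_eq_self g x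
  have hG' : ∀ y, ∫⁻ x, g (x - y) ∂μ = ∫⁻ y, g y ∂μ := fun y => lintegral_sub_right_eq_self g y
  have h1 : ∀ x, (∫⁻ y, g (x - y) * w y ∂μ) ^ (2 : ℝ) ≤
      (∫⁻ y, g y ∂μ) * ∫⁻ y, g (x - y) * w y ^ (2 : ℝ) ∂μ := by
    intro x
    have hgx : Measurable fun y => g (x - y) := hg.comp (measurable_const.sub measurable_id)
    have h := ENNReal.lintegral_mul_le_Lp_mul_Lq μ (p := 2) (q := 2) (by constructor <;> norm_num)
      (f := fun y => g (x - y) ^ (1 / 2 : ℝ)) (g := fun y => g (x - y) ^ (1 / 2 : ℝ) * w y)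
      (hgx.pow_const _).aemeasurable ((hgx.pow_const _).aemeasurable.mul hw)
    have e1 : ((fun y => g (x - y) ^ (1 / 2 : ℝ)) * fun y => g (x - y) ^ (1 / 2 : ℝ) * w y) =
        fun y => g (x - y) * w y := by
      ext y
      simp only [Pi.mul_apply]
      rw [← mul_assoc, ← ENNReal.rpow_add_of_nonneg _ _ (by norm_num) (by norm_num)]
      norm_num
    have e2 : ∀ y, (g (x - y) ^ (1 / 2 : ℝ)) ^ (2 : ℝ) = g (x - y) := fun y => by
      rw [← ENNReal.rpow_mul]; norm_num
    rw [e1] at h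
    simp only [ENNReal.mul_rpow_of_nonneg _ _ (zero_le_two (α := ℝ)), e2, hG] at h
    calc _ ≤ ((∫⁻ y, g y ∂μ) ^ (1 / 2 : ℝ) * (∫⁻ y, g (x - y) * w y ^ (2 : ℝ) ∂μ) ^ (1 / 2 : ℝ)) ^
          (2 : ℝ) := ENNReal.rpow_le_rpow h (by norm_num)
      _ = _ := by
        rw [ENNReal.mul_rpow_of_nonneg _ _ (by norm_num), ← ENNReal.rpow_mul, ← ENNReal.rpow_mul]
        norm_num
  calc _ ≤ ∫⁻ x, (∫⁻ y, g y ∂μ) * ∫⁻ y, g (x - y) * w y ^ (2 : ℝ) ∂μ ∂μ := lintegral_mono h1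
    _ = (∫⁻ y, g y ∂μ) * ∫⁻ x, ∫⁻ y, g (x - y) * w y ^ (2 : ℝ) ∂μ ∂μ := by
        refine lintegral_const_mul'' _ (AEMeasurable.lintegral_prod_right' (μ := μ) (ν := μ)
          (f := fun p : E × E => g (p.1 - p.2) * w p.2 ^ (2 : ℝ)) ?_)
        exact hg2.aemeasurable.mul ((hw.pow_const _).comp_snd)
    _ = (∫⁻ y, g y ∂μ) * ∫⁻ y, ∫⁻ x, g (x - y) * w y ^ (2 : ℝ) ∂μ ∂μ := by
        rw [lintegral_lintegral_swap]
        exact hg2.aemeasurable.mul ((hw.pow_const _).comp_snd)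
    _ = (∫⁻ y, g y ∂μ) * ∫⁻ y, (∫⁻ z, g z ∂μ) * w y ^ (2 : ℝ) ∂μ := by
        congr 1
        refine lintegral_congr fun y => ?_
        have hgy : Measurable fun x => g (x - y) := hg.comp (measurable_id.sub measurable_const)
        rw [lintegral_mul_const _ hgy, hG' y]
    _ = _ := by
        rw [lintegral_const_mul'' _ (hw.pow_const _), ← mul_assoc, ENNReal.rpow_two, sq]

/-- No measurability of `φ` is required, since only monotonicity of the lower integral is applied to
it. This matters because `φ` will involve a function `b` built from pointwise choices of `β`. -/
lemma eLpNorm_le_of_conv_le {φ w : E → ℂ} {g : E → ℝ≥0∞} (hg : Measurable g)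
    (hw : AEStronglyMeasurable w μ) {S : Set E} {c : ℝ≥0∞}
    (h : ∀ x, ‖φ x‖ₑ ≤ c * ∫⁻ y, g (x - y) * ‖w y‖ₑ ∂μ) :
    eLpNorm φ 2 (μ.restrict S) ≤ c * (∫⁻ x, g x ∂μ) * eLpNorm w 2 μ := by
  have h2 := lintegral_conv_sq_le (μ := μ) hg hw.enorm
  have : eLpNorm φ 2 (μ.restrict S) ≤ eLpNorm φ 2 μ :=
    eLpNorm_mono_measure _ Measure.restrict_le_self
  refine this.trans ?_
  rw [eLpNorm_eq_lintegral_rpow_enorm_toReal (by norm_num) (by norm_num),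
    eLpNorm_eq_lintegral_rpow_enorm_toReal (by norm_num) (by norm_num)]
  simp only [ENNReal.toReal_ofNat]
  have hm : AEMeasurable (fun x => (∫⁻ y, g (x - y) * ‖w y‖ₑ ∂μ) ^ (2 : ℝ)) μ := by
    refine AEMeasurable.pow_const ?_ _
    refine (AEMeasurable.lintegral_prod_right' (μ := μ) (ν := μ)
          (f := fun p : E × E => g (p.1 - p.2) * ‖w p.2‖ₑ) ?_)
    exact (hg.comp (measurable_fst.sub measurable_snd)).aemeasurable.mul (hw.enorm.comp_snd)
  calc _ ≤ (∫⁻ x, c ^ (2 : ℝ) * (∫⁻ y, g (x - y) * ‖w y‖ₑ ∂μ) ^ (2 : ℝ) ∂μ) ^ (1 / 2 : ℝ) := by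
        refine ENNReal.rpow_le_rpow (lintegral_mono fun x => ?_) (by norm_num)
        rw [← ENNReal.mul_rpow_of_nonneg _ _ (by norm_num)]
        exact ENNReal.rpow_le_rpow (h x) (by norm_num)
    _ = (c ^ (2 : ℝ) * ∫⁻ x, (∫⁻ y, g (x - y) * ‖w y‖ₑ ∂μ) ^ (2 : ℝ) ∂μ) ^ (1 / 2 : ℝ) := by
        rw [lintegral_const_mul'' _ hm]
    _ ≤ (c ^ (2 : ℝ) * ((∫⁻ x, g x ∂μ) ^ (2 : ℝ) * ∫⁻ y, ‖w y‖ₑ ^ (2 : ℝ) ∂μ)) ^ (1 / 2 : ℝ) := by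
        gcongr
    _ = _ := by
        rw [ENNReal.mul_rpow_of_nonneg _ _ (by norm_num), ENNReal.mul_rpow_of_nonneg _ _ (by norm_num),
          ← ENNReal.rpow_mul, ← ENNReal.rpow_mul, mul_assoc]
        norm_num

/-- Integrals depending holomorphically on a parameter. -/
lemma differentiable_integral_of_locally_dominated {α H : Type*} [MeasurableSpace α] {ν : Measure α}
    [NormedAddCommGroup H] [NormedSpace ℂ H] [FiniteDimensional ℂ H] {F : H → α → ℂ}
    (hm : ∀ x, AEStronglyMeasurable (F x) ν) (hd : ∀ a, Differentiable ℂ fun x => F x a)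
    (hb : ∀ x₀, ∃ r > 0, ∃ G : α → ℝ, Integrable G ν ∧ ∀ x ∈ Metric.ball x₀ r, ∀ a, ‖F x a‖ ≤ G a) :
    Differentiable ℂ fun x => ∫ a, F x a ∂ν := by
  intro x₀
  obtain ⟨r, hr, G, hG, hFG⟩ := hb x₀
  have hr2 : 0 < r / 2 := by positivity
  have hsub : ∀ x ∈ Metric.ball x₀ (r / 2), Metric.ball x (r / 2) ⊆ Metric.ball x₀ r := by
    intro x hx y hy
    rw [Metric.mem_ball] at *
    linarith [dist_triangle y x x₀]
  -- Cauchy's estimate: a bound for the integrand on a ball bounds its derivative on the ball of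
  -- half the radius, so domination of the functions suffices.
  have hbound : ∀ a, ∀ x ∈ Metric.ball x₀ (r / 2),
      ‖fderiv ℂ (fun x => F x a) x‖ ≤ (2 * G a) / (r / 2) := by
    intro a x hx
    refine Complex.norm_fderiv_le_div_of_mapsTo_ball (hd a).differentiableOn (fun y hy => ?_) hr2
    rw [mem_closedBall_iff_norm]
    have h1 := hFG y (hsub x hx hy) a
    have h2 := hFG x (hsub x hx (Metric.mem_ball_self hr2)) a
    exact (norm_sub_le _ _).trans (by linarith)
  -- Each directional derivative is a pointwise limit of measurable difference quotients; a basis of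
  -- the finite-dimensional space then assembles the whole derivative.
  have hmeas : AEStronglyMeasurable (fun a => fderiv ℂ (fun x => F x a) x₀) ν := by
    have hlim : ∀ v : H, AEStronglyMeasurable (fun a => fderiv ℂ (fun x => F x a) x₀ v) ν := by
      intro v
      refine aestronglyMeasurable_of_tendsto_ae (u := (atTop : Filter ℕ))
        (f := fun (k : ℕ) a => ((k + 1 : ℕ) : ℂ) • (F (x₀ + ((k + 1 : ℕ) : ℂ)⁻¹ • v) a - F x₀ a))
        (fun k => ((hm (x₀ + ((k + 1 : ℕ) : ℂ)⁻¹ • v)).sub (hm x₀)).const_smul ((k + 1 : ℕ) : ℂ))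
        (ae_of_all _ fun a => ?_)
      have h1 := ((hd a) x₀).hasFDerivAt.lim v (l := (atTop : Filter ℕ))
        (c := fun k : ℕ => ((k + 1 : ℕ) : ℂ)) (by
          simp only [Complex.norm_natCast]
          exact tendsto_natCast_atTop_atTop.comp (tendsto_add_atTop_nat 1))
      exact h1
    let b := Module.finBasis ℂ H
    let T : H →L[ℂ] (Fin (Module.finrank ℂ H) → ℂ) := b.equivFunL
    have e : (fun a => fderiv ℂ (fun x => F x a) x₀) = fun a =>
        ∑ i, (fderiv ℂ (fun x => F x a) x₀ (b i)) •
          ((ContinuousLinearMap.proj (R := ℂ) (φ := fun _ => ℂ) i).comp T) := by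
      ext a v
      simp only [sum_apply, smul_apply, ContinuousLinearMap.comp_apply,
        ContinuousLinearMap.proj_apply, smul_eq_mul]
      conv_lhs => rw [← b.sum_repr v, map_sum]
      refine Finset.sum_congr rfl fun i _ => ?_
      rw [map_smul, smul_eq_mul, mul_comm]
      rfl
    rw [e]
    refine Finset.aestronglyMeasurable_fun_sum _ fun i _ => ?_
    exact (hlim (b i)).smul_const _
  exact (hasFDerivAt_integral_of_dominated_of_fderiv_le (𝕜 := ℂ)
    (F' := fun x a => fderiv ℂ (fun x => F x a) x) (bound := fun a => (2 * G a) / (r / 2))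
    (Metric.ball_mem_nhds x₀ hr2) (Eventually.of_forall hm)
    (hG.mono' (hm x₀) (ae_of_all _ (hFG x₀ (Metric.mem_ball_self hr))))
    hmeas (ae_of_all _ hbound) ((hG.const_mul 2).div_const _)
    (ae_of_all _ fun a x _ => ((hd a) x).hasFDerivAt)).differentiableAt

end Tools

/-! ### The mean value property over rotations. -/

section CnTools

variable {n : ℕ}

/-- Scalar multiplication by `e^{iθ}` preserves Lebesgue measure. -/
lemma measurePreserving_rot (c : ℂ) (hc : ‖c‖ = 1) :
    MeasurePreserving (fun z : Cn n => c • z) volume volume := by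
  let f : Cn n →ₗᵢ[ℝ] Cn n :=
    ⟨(LinearMap.lsmul ℂ (Cn n) c).restrictScalars ℝ, fun z => by simp [norm_smul, hc]⟩
  exact (f.toLinearIsometryEquiv rfl).measurePreserving

lemma circle_mean {F : ℂ → ℂ} (hF : Differentiable ℂ F) :
    ∫ θ in Set.Ioc 0 (2 * Real.pi), F (Complex.exp (θ * Complex.I)) = 2 * Real.pi * F 0 := by
  have h := DiffContOnCl.circleAverage (f := F) (c := 0) (R := 1) hF.diffContOnCl
  rw [Real.circleAverage_def, intervalIntegral.integral_of_le (by positivity), inv_smul_eq_iff₀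
    (by positivity)] at h
  simpa [circleMap] using h

/-- The mean value property against a circle invariant density. -/
lemma integral_mul_circleInvariant {F g : Cn n → ℂ}
    (hF : ∀ z, Differentiable ℂ fun c : ℂ => F (c • z))
    (hFc : Continuous F) (hgc : Continuous g) (hg : ∀ (c : ℂ) z, ‖c‖ = 1 → g (c • z) = g z)
    (hi : Integrable fun z => F z * g z) :
    ∫ z, F z * g z = F 0 * ∫ z, g z := by
  have hn : ∀ θ : ℝ, ‖Complex.exp (θ * Complex.I)‖ = 1 := Complex.norm_exp_ofReal_mul_I
  set ν : Measure ℝ := volume.restrict (Set.Ioc 0 (2 * Real.pi)) with hν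
  have hce : Continuous fun θ : ℝ => Complex.exp (θ * Complex.I) := by fun_prop
  have hemb : ∀ θ : ℝ, MeasurableEmbedding fun z : Cn n => Complex.exp (θ * Complex.I) • z :=
    fun θ => (Homeomorph.smulOfNeZero _ (Complex.exp_ne_zero (θ * Complex.I))).measurableEmbedding
  -- Rotating the argument of `F` leaves the integral unchanged. Averaging over `θ` and exchanging
  -- the integrals replaces `F` by its mean over the circle through `z`, which is `F 0`.
  have h1 : ∀ θ : ℝ, ∫ z, F (Complex.exp (θ * Complex.I) • z) * g z = ∫ z, F z * g z := by
    intro θ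
    rw [← (measurePreserving_rot _ (hn θ)).integral_comp (hemb θ) fun z => F z * g z]
    simp only [hg _ _ (hn θ)]
  have hi' : ∀ θ : ℝ, Integrable fun z => F (Complex.exp (θ * Complex.I) • z) * g z := by
    intro θ
    have := ((measurePreserving_rot _ (hn θ)).integrable_comp_emb (hemb θ)).2 hi
    refine this.congr (ae_of_all _ fun z => ?_)
    simp [hg _ _ (hn θ)]
  have h1' : ∀ θ : ℝ, ∫ z, ‖F (Complex.exp (θ * Complex.I) • z) * g z‖ = ∫ z, ‖F z * g z‖ := by
    intro θ
    rw [← (measurePreserving_rot _ (hn θ)).integral_comp (hemb θ) fun z => ‖F z * g z‖]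
    simp only [hg _ _ (hn θ)]
  have hprod : Integrable (fun p : ℝ × Cn n => F (Complex.exp (p.1 * Complex.I) • p.2) * g p.2)
      (ν.prod volume) := by
    rw [integrable_prod_iff (by
      refine Continuous.aestronglyMeasurable ?_
      exact (hFc.comp ((hce.comp continuous_fst).smul continuous_snd)).mul
        (hgc.comp continuous_snd))]
    refine ⟨ae_of_all _ hi', ?_⟩
    simp only [h1']
    exact integrable_const _
  have h2 : ∫ θ, (∫ z, F (Complex.exp (θ * Complex.I) • z) * g z) ∂ν =
      ∫ z, (∫ θ, F (Complex.exp (θ * Complex.I) • z) * g z ∂ν) := integral_integral_swap hprod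
  have h3 : ∀ z, ∫ θ, F (Complex.exp (θ * Complex.I) • z) * g z ∂ν =
      2 * Real.pi * F 0 * g z := by
    intro z
    rw [integral_mul_const, circle_mean (hF z), zero_smul]
  simp only [h1, h3] at h2
  rw [integral_const, integral_const_mul] at h2
  have h4 : ν.real Set.univ = 2 * Real.pi := by
    simp [hν, Measure.real, Real.pi_pos.le]
  rw [h4, Complex.real_smul] at h2
  push_cast at h2
  have h5 : (2 * Real.pi : ℂ) ≠ 0 := by exact_mod_cast (by positivity : (2 * Real.pi : ℝ) ≠ 0)
  exact mul_left_cancel₀ h5 (by rw [h2]; ring)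

end CnTools

/-! ### From coordinate Gevrey bounds to operator norm bounds. -/

section GevreyCn

variable {n : ℕ}

/-- The real coordinates of a vector with respect to `realDirs`. -/
def realCoord : Fin n ⊕ Fin n → Cn n → ℝ :=
  Sum.elim (fun j v => (v j).re) (fun j v => (v j).im)

lemma sum_realCoord (v : Cn n) : ∑ i, realCoord i v • realDirs i = v := by
  ext j
  simp only [Fintype.sum_sum_type, realCoord, realDirs, Sum.elim_inl, Sum.elim_inr, e,
    PiLp.add_apply, WithLp.ofLp_sum, WithLp.ofLp_smul, Finset.sum_apply, Pi.smul_apply]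
  simp only [EuclideanSpace.single, PiLp.single, Pi.single_apply, smul_eq_mul]
  simp

lemma abs_realCoord_le (i : Fin n ⊕ Fin n) (v : Cn n) : |realCoord i v| ≤ ‖v‖ := by
  rcases i with j | j
  · exact (Complex.abs_re_le_norm _).trans (PiLp.norm_apply_le v j)
  · exact (Complex.abs_im_le_norm _).trans (PiLp.norm_apply_le v j)

lemma norm_multilinear_le {k : ℕ} (f : ContinuousMultilinearMap ℝ (fun _ : Fin k => Cn n) ℂ) {B : ℝ}
    (hB : ∀ c : Fin k → Fin n ⊕ Fin n, ‖f fun l => realDirs (c l)‖ ≤ B) :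
    ‖f‖ ≤ (n + n) ^ k * B := by
  have hB0 : 0 ≤ (n + n : ℝ) ^ k * B := by
    rcases Nat.eq_zero_or_pos k with rfl | hk
    · simpa using (norm_nonneg _).trans (hB Fin.elim0)
    rcases Nat.eq_zero_or_pos n with rfl | hn
    · simp [hk.ne']
    · have := (norm_nonneg _).trans (hB fun _ => Sum.inl ⟨0, hn⟩)
      positivity
  refine f.opNorm_le_bound hB0 fun v => ?_
  have e1 : f v = ∑ c : Fin k → Fin n ⊕ Fin n,
      (∏ l, realCoord (c l) (v l)) • f fun l => realDirs (c l) := by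
    conv_lhs => rw [show v = fun l => ∑ i, realCoord i (v l) • realDirs i from
      funext fun l => (sum_realCoord (v l)).symm]
    rw [f.map_sum]
    exact Finset.sum_congr rfl fun c _ => f.map_smul_univ _ _
  rw [e1]
  calc _ ≤ ∑ c : Fin k → Fin n ⊕ Fin n, ‖(∏ l, realCoord (c l) (v l)) • f fun l => realDirs (c l)‖ :=
        norm_sum_le _ _
    _ ≤ ∑ c : Fin k → Fin n ⊕ Fin n, (∏ l, ‖v l‖) * B := by
        refine Finset.sum_le_sum fun c _ => ?_
        rw [norm_smul, norm_prod]
        gcongr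
        · exact abs_realCoord_le _ _
        · exact hB c
    _ = _ := by simp; ring

lemma GevreyBdd.gevreyNorm {s : ℝ} (hs : 0 ≤ s) {u : Cn n → ℂ} (hu : GevreyBdd realDirs s u) :
    ∃ M r : ℝ, 0 < r ∧ GevreyNorm s M r u := by
  obtain ⟨hc, C, hC, h⟩ := hu
  -- Expanding in the `2n` real directions costs `(2n)^k`, and `∏ α_i!` divides `k!`. The additional
  -- `1` keeps the radius positive when `n = 0`.
  refine ⟨C, (n + n + 1) * C, by positivity, hc, fun k x => ?_⟩
  refine (norm_multilinear_le _ (B := C ^ (1 + k) * (k.factorial : ℝ) ^ s) fun c =>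
    (h k c x).trans ?_).trans ?_
  · gcongr
    have h1 := Nat.prod_factorial_dvd_factorial_sum Finset.univ
      fun i => (Finset.univ.filter fun l => c l = i).card
    have h2 : ∑ i, (Finset.univ.filter fun l => c l = i).card = k := by
      have := Finset.card_eq_sum_card_fiberwise (s := (Finset.univ : Finset (Fin k)))
        (t := Finset.univ) (f := c) (fun _ _ => by simp)
      rw [← this]; simp
    rw [h2] at h1
    exact Nat.le_of_dvd k.factorial_pos h1
  · rw [mul_pow, pow_add, pow_one]
    calc _ = C * ((n + n : ℝ) ^ k * C ^ k) * (k.factorial : ℝ) ^ s := by ring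
      _ ≤ C * ((n + n + 1 : ℝ) ^ k * C ^ k) * (k.factorial : ℝ) ^ s := by
          have : (n + n : ℝ) ^ k ≤ (n + n + 1 : ℝ) ^ k :=
            pow_le_pow_left₀ (by positivity) (by linarith) k
          gcongr
      _ = _ := by ring

end GevreyCn

/-! ### The Levi form, the holomorphic part of the weight, and the phase. -/

section Forms

variable {n : ℕ} (Φ : QuadraticForm ℝ (Cn n))

/-- The real bilinear form with `Φ x = B x x`. -/
def polarB : Cn n →L[ℝ] Cn n →L[ℝ] ℝ :=
  LinearMap.toContinuousBilinearMap (QuadraticMap.associated (R := ℝ) Φ)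

lemma polarB_self (x : Cn n) : polarB Φ x x = Φ x :=
  QuadraticMap.associated_eq_self_apply ℝ Φ x

lemma polarB_symm (x y : Cn n) : polarB Φ x y = polarB Φ y x :=
  QuadraticMap.associated_isSymm ℝ Φ x y

/-- Multiplication by `i` as a real linear map. -/
def mulI : Cn n →L[ℝ] Cn n := (ContinuousLinearMap.lsmul ℂ ℂ Complex.I).restrictScalars ℝ

@[simp] lemma mulI_apply (x : Cn n) : mulI x = Complex.I • x := rfl

lemma I_smul_I_smul (x : Cn n) : Complex.I • Complex.I • x = -x := by
  rw [smul_smul, Complex.I_mul_I, neg_one_smul]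

/-- The real part of the Levi form. -/
def leviR : Cn n →L[ℝ] Cn n →L[ℝ] ℝ :=
  (1 / 2 : ℝ) • (polarB Φ + (polarB Φ).bilinearComp mulI mulI)

lemma leviR_apply (x y : Cn n) :
    leviR Φ x y = (polarB Φ x y + polarB Φ (Complex.I • x) (Complex.I • y)) / 2 := by
  simp [leviR]; ring

lemma leviR_symm (x y : Cn n) : leviR Φ x y = leviR Φ y x := by
  rw [leviR_apply, leviR_apply, polarB_symm Φ x, polarB_symm Φ (Complex.I • x)]

lemma leviR_I_I (x y : Cn n) : leviR Φ (Complex.I • x) (Complex.I • y) = leviR Φ x y := by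
  rw [leviR_apply, leviR_apply, I_smul_I_smul, I_smul_I_smul]; simp; ring

lemma leviR_I_left (x y : Cn n) : leviR Φ (Complex.I • x) y = -leviR Φ x (Complex.I • y) := by
  rw [← leviR_I_I Φ x, I_smul_I_smul]; simp

lemma leviR_I_self (x : Cn n) : leviR Φ (Complex.I • x) x = 0 := by
  have := leviR_I_left Φ x x
  rw [leviR_symm Φ x] at this
  linarith

variable {Φ} in
lemma exists_leviR_coercive (hΦ : StrictlyPSH Φ) :
    ∃ ρ : ℝ, 0 < ρ ∧ ∀ v, ρ * ‖v‖ ^ 2 ≤ leviR Φ v v := by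
  have hpos : ∀ v, v ≠ 0 → 0 < leviR Φ v v := fun v hv => by
    rw [leviR_apply, polarB_self, polarB_self]; exact hΦ v hv
  have hc : Continuous fun v => leviR Φ v v := (leviR Φ).continuous.clm_apply continuous_id
  rcases (Metric.sphere (0 : Cn n) 1).eq_empty_or_nonempty with h | h
  · refine ⟨1, one_pos, fun v => ?_⟩
    have : v = 0 := by
      by_contra hv
      have h1 : (‖v‖⁻¹ : ℝ) • v ∈ Metric.sphere (0 : Cn n) 1 := by
        simp [norm_smul, norm_ne_zero_iff.2 hv]
      rw [h] at h1; exact h1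
    simp [this]
  · obtain ⟨v₀, hv₀, hmin⟩ := (isCompact_sphere (0 : Cn n) 1).exists_isMinOn h hc.continuousOn
    have hv₀' : v₀ ≠ 0 := by
      rintro rfl; simp at hv₀
    refine ⟨leviR Φ v₀ v₀, hpos _ hv₀', fun v => ?_⟩
    rcases eq_or_ne v 0 with rfl | hv
    · simp
    have hv' : ‖v‖ ≠ 0 := norm_ne_zero_iff.2 hv
    have h1 : (‖v‖⁻¹ : ℝ) • v ∈ Metric.sphere (0 : Cn n) 1 := by simp [norm_smul, hv']
    have h2 := hmin h1
    simp only [Set.mem_ofPred_eq, map_smul, smul_apply, smul_eq_mul] at h2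
    calc leviR Φ v₀ v₀ * ‖v‖ ^ 2 ≤ (‖v‖⁻¹ * (‖v‖⁻¹ * leviR Φ v v)) * ‖v‖ ^ 2 := by gcongr
      _ = leviR Φ v v := by field_simp

/-- The complex linear form `t ↦ ∂Φ(w)·t`. -/
def lam (w : Cn n) : Cn n →L[ℂ] ℂ := StrongDual.extendRCLike (𝕜 := ℂ) (polarB Φ w)

lemma lam_apply (w t : Cn n) :
    lam Φ w t = polarB Φ w t - Complex.I * polarB Φ w (Complex.I • t) :=
  Module.Dual.extendRCLike_apply (𝕜 := ℂ) _ _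

/-- The sesquilinear Levi form, linear in its second argument. -/
def lev (y : Cn n) : Cn n →L[ℂ] ℂ := StrongDual.extendRCLike (𝕜 := ℂ) (leviR Φ y)

lemma lev_apply (y t : Cn n) :
    lev Φ y t = leviR Φ y t - Complex.I * leviR Φ y (Complex.I • t) :=
  Module.Dual.extendRCLike_apply (𝕜 := ℂ) _ _

lemma lam_add (w w' t : Cn n) : lam Φ (w + w') t = lam Φ w t + lam Φ w' t := by
  simp only [lam_apply, map_add, add_apply]; push_cast; ring

lemma lam_smul (r : ℝ) (w t : Cn n) : lam Φ (r • w) t = r * lam Φ w t := by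
  simp only [lam_apply, map_smul, smul_apply, smul_eq_mul]; push_cast; ring

lemma lam_re (w t : Cn n) : (lam Φ w t).re = polarB Φ w t := by simp [lam_apply]

lemma lev_re (w t : Cn n) : (lev Φ w t).re = leviR Φ w t := by simp [lev_apply]

/-- The holomorphic quadratic part of `Φ`: `Φ x = leviR Φ x x + Re (holQ Φ x)`. -/
def holQ (z : Cn n) : ℂ := lam Φ z z - leviR Φ z z

lemma holQ_re (z : Cn n) : (holQ Φ z).re = Φ z - leviR Φ z z := by
  simp [holQ, lam_re, polarB_self]

/-- The weight minus its Levi part is pluriharmonic and `holQ` completes it to a holomorphic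
quadratic form. Concretely, the real derivative at `z` is `2 (lam z - lev z)`, which is complex
linear. -/
lemma differentiable_holQ : Differentiable ℂ (holQ Φ) := by
  intro z
  have h1 : HasFDerivAt (fun z => polarB Φ z z)
      ((polarB Φ).precompR _ z (ContinuousLinearMap.id ℝ _) +
        (polarB Φ).precompL _ (ContinuousLinearMap.id ℝ _) z) z :=
    (polarB Φ).hasFDerivAt_of_bilinear (hasFDerivAt_id z) (hasFDerivAt_id z)
  have h2 : HasFDerivAt (fun z => leviR Φ z z)
      ((leviR Φ).precompR _ z (ContinuousLinearMap.id ℝ _) +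
        (leviR Φ).precompL _ (ContinuousLinearMap.id ℝ _) z) z :=
    (leviR Φ).hasFDerivAt_of_bilinear (hasFDerivAt_id z) (hasFDerivAt_id z)
  have h3 : HasFDerivAt (fun z => polarB Φ z (mulI z))
      ((polarB Φ).precompR _ z mulI +
        (polarB Φ).precompL _ (ContinuousLinearMap.id ℝ _) (mulI z)) z :=
    (polarB Φ).hasFDerivAt_of_bilinear (hasFDerivAt_id z) (mulI.hasFDerivAt)
  have h1' := Complex.ofRealCLM.hasFDerivAt.comp z h1
  have h2' := Complex.ofRealCLM.hasFDerivAt.comp z h2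
  have h3' := Complex.ofRealCLM.hasFDerivAt.comp z h3
  have h := (h1'.sub (h3'.const_mul Complex.I)).sub h2'
  have key : HasFDerivAt (𝕜 := ℝ) (holQ Φ) (((2 : ℂ) • (lam Φ z - lev Φ z)).restrictScalars ℝ) z := by
    refine (h.congr_fderiv ?_).congr_of_eventuallyEq (Eventually.of_forall fun z => ?_)
    · ext t
      have e1 := polarB_symm Φ t z
      have e2 := polarB_symm Φ t (Complex.I • z)
      have e3 := leviR_symm Φ t z
      have e4 : leviR Φ z (Complex.I • t) = (polarB Φ z (Complex.I • t) -
          polarB Φ (Complex.I • z) t) / 2 := by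
        rw [leviR_apply, I_smul_I_smul]; simp; ring
      simp [lam_apply, lev_apply, e1, e2, e3, e4]
      ring
    · simp [holQ, lam_apply]
  exact (hasFDerivAt_of_restrictScalars ℝ key rfl).differentiableAt

/-- The asymmetry of `lam` is exactly the Levi form. This is the origin of the oscillating factor in
the kernel. -/
lemma lam_sub_lam (w p : Cn n) :
    lam Φ w p - lam Φ p w = -2 * Complex.I * leviR Φ (Complex.I • p) w := by
  have e1 := polarB_symm Φ w p
  have e2 := polarB_symm Φ w (Complex.I • p)
  simp only [lam_apply, leviR_apply, I_smul_I_smul, e1, e2, map_neg, neg_apply]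
  push_cast; ring

/-- The exponent of the kernel after the change of variables `y₀ = y - z`, `z = -(2 w + β)`. -/
lemma exponent_identity (x y β w : Cn n) :
    2 * lam Φ (mid x (y + ((2 : ℝ) • w + β))) (x - (y + ((2 : ℝ) • w + β))) -
      (2 * lam Φ (y + ((2 : ℝ) • w + β)) (-((2 : ℝ) • w + β)) + holQ Φ (-((2 : ℝ) • w + β)) +
        2 * lev Φ β (-((2 : ℝ) • w + β))) - 2 * leviR Φ (-((2 : ℝ) • w + β)) (-((2 : ℝ) • w + β)) =
    2 * lam Φ (mid x y) (x - y) + (leviR Φ β β - 2 * Complex.I * leviR Φ (Complex.I • (x - y)) β) -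
      4 * (leviR Φ w w + Complex.I * leviR Φ (Complex.I • (x - y - β)) w) := by
  set p := x - y with hp
  set w' := w + (1 / 2 : ℝ) • β with hw'
  have ez : (2 : ℝ) • w + β = (2 : ℝ) • w' := by
    rw [hw', smul_add, smul_smul]; norm_num
  have em : mid x (y + ((2 : ℝ) • w + β)) = y + (1 / 2 : ℝ) • p + w' := by
    rw [ez, mid, hp]; module
  have em' : mid x y = y + (1 / 2 : ℝ) • p := by rw [mid, hp]; module
  have ex : x - (y + ((2 : ℝ) • w + β)) = p - (2 : ℝ) • w' := by rw [ez, hp]; module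
  have s1 : ∀ a b (r : ℝ), lam Φ a (r • b) = r * lam Φ a b := fun a b r => by
    rw [(lam Φ a).map_smul_of_tower r b, Complex.real_smul]
  have s2 : ∀ b (r : ℝ), lev Φ β (r • b) = r * lev Φ β b := fun b r => by
    rw [(lev Φ β).map_smul_of_tower r b, Complex.real_smul]
  rw [em, ex, ez, em']
  have a1 := lam_sub_lam Φ w' p
  have c1 : leviR Φ β w = leviR Φ w β := leviR_symm Φ β w
  have c2 : leviR Φ β (Complex.I • w) = -leviR Φ (Complex.I • β) w := by
    rw [leviR_I_left]; ring
  have c3 : leviR Φ β (Complex.I • β) = 0 := by rw [leviR_symm]; exact leviR_I_self Φ β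
  have f1 : leviR Φ w' w' = leviR Φ w w + leviR Φ w β + leviR Φ β β / 4 := by
    rw [hw']; simp only [map_add, map_smul, add_apply, smul_apply, smul_eq_mul, c1]; ring
  have f2 : lev Φ β w' = leviR Φ w β + leviR Φ β β / 2 + Complex.I * leviR Φ (Complex.I • β) w := by
    rw [lev_apply, hw', smul_add, smul_comm Complex.I (1 / 2 : ℝ) β]
    simp only [map_add, map_smul, smul_eq_mul, c1, c2, c3]; push_cast; ring
  have f3 : leviR Φ (Complex.I • p) w' = leviR Φ (Complex.I • p) w +
      leviR Φ (Complex.I • p) β / 2 := by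
    rw [hw']; simp only [map_add, map_smul, smul_eq_mul]; ring
  rw [f3] at a1
  rw [show Complex.I • (p - β) = Complex.I • p - Complex.I • β from smul_sub _ _ _,
    show -((2 : ℝ) • w') = (-2 : ℝ) • w' by module]
  clear_value p w'
  simp only [holQ, map_sub, sub_apply, lam_add, lam_smul, s1, s2, map_smul, smul_apply,
    smul_eq_mul, f1, f2]
  push_cast at a1 ⊢
  linear_combination 2 * a1

/-- The real part of the exponent before integrating in `z`. -/
lemma exponent_re (y z : Cn n) :
    Φ (y + z) - Φ y - (2 * lam Φ y z + holQ Φ z).re = leviR Φ z z := by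
  have h : Φ (y + z) = Φ y + 2 * polarB Φ y z + Φ z := by
    rw [← polarB_self, ← polarB_self, ← polarB_self]
    simp only [map_add, add_apply, polarB_symm Φ z y]; ring
  rw [h, Complex.add_re, holQ_re, Complex.mul_re, lam_re]
  simp; ring

lemma two_lam_mid_re (x y : Cn n) : (2 * lam Φ (mid x y) (x - y)).re = Φ x - Φ y := by
  rw [Complex.mul_re, lam_re, mid, ← polarB_self, ← polarB_self]
  simp only [map_smul, map_add, map_sub, smul_apply, add_apply, smul_eq_mul, polarB_symm Φ y x]
  simp; ring

lemma continuous_lam {X : Type*} [TopologicalSpace X] {f g : X → Cn n} (hf : Continuous f)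
    (hg : Continuous g) : Continuous fun x => lam Φ (f x) (g x) := by
  simp only [lam_apply]
  have h1 : Continuous fun x => polarB Φ (f x) (g x) := ((polarB Φ).continuous.comp hf).clm_apply hg
  have h3 : Continuous fun x => Complex.I • g x := by fun_prop
  have h2 : Continuous fun x => polarB Φ (f x) (Complex.I • g x) :=
    ((polarB Φ).continuous.comp hf).clm_apply h3
  fun_prop

lemma continuous_holQ : Continuous (holQ Φ) := (differentiable_holQ Φ).continuous

lemma continuous_leviR {X : Type*} [TopologicalSpace X] {f g : X → Cn n} (hf : Continuous f)
    (hg : Continuous g) : Continuous fun x => leviR Φ (f x) (g x) :=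
  ((leviR Φ).continuous.comp hf).clm_apply hg

lemma continuous_quadForm : Continuous fun x => Φ x := by
  simp only [← polarB_self]
  exact (polarB Φ).continuous.clm_apply continuous_id

/-! ### The contour -/

lemma fderiv_quadForm (w t : Cn n) : fderiv ℝ (fun x => Φ x) w t = 2 * polarB Φ w t := by
  have h1 : HasFDerivAt (fun z => polarB Φ z z)
      ((polarB Φ).precompR _ w (ContinuousLinearMap.id ℝ _) +
        (polarB Φ).precompL _ (ContinuousLinearMap.id ℝ _) w) w :=
    (polarB Φ).hasFDerivAt_of_bilinear (hasFDerivAt_id w) (hasFDerivAt_id w)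
  simp only [polarB_self] at h1
  rw [h1.fderiv]
  simp [polarB_symm Φ t w]; ring

lemma xi_apply (w : Cn n) (j : Fin n) : xi Φ w j = (2 / Complex.I) * lam Φ w (e j) := by
  have h := fderiv_quadForm Φ w
  simp only [xi, holGrad, PiLp.smul_apply, smul_eq_mul]
  rw [show fderiv ℝ (⇑Φ) w = fderiv ℝ (fun x => Φ x) w from rfl, h, h, lam_apply]
  push_cast; ring

lemma sum_smul_e (t : Cn n) : ∑ j, t j • (e j : Cn n) = t := by
  ext k
  simp [e, Pi.single_apply]

lemma phase_eq (w t : Cn n) : Complex.I * ∑ j, t j * xi Φ w j = 2 * lam Φ w t := by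
  have : lam Φ w t = ∑ j, t j * lam Φ w (e j) := by
    conv_lhs => rw [← sum_smul_e t, map_sum]
    simp
  rw [this, Finset.mul_sum, Finset.mul_sum]
  refine Finset.sum_congr rfl fun j _ => ?_
  rw [xi_apply]
  field_simp

/-- `xi` as a real linear map. -/
def xiLin : Cn n →ₗ[ℝ] Cn n where
  toFun := xi Φ
  map_add' x y := by ext j; simp [xi_apply, lam_add, mul_add]
  map_smul' r x := by ext j; simp [xi_apply, lam_smul]; ring

/-- The density of the contour, which is constant. -/
def contourConst : ℂ := contourDensity (fun y' => xi Φ (mid (0 : Cn n) y')) 0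

lemma fderiv_xi_mid (x y v : Cn n) :
    fderiv ℝ (fun y' => xi Φ (mid x y')) y v = (1 / 2 : ℝ) • xi Φ v := by
  let T : Cn n →L[ℝ] Cn n := (xiLin Φ).toContinuousLinearMap
  have h : (fun y' => xi Φ (mid x y')) = fun y' => T ((1 / 2 : ℝ) • x) + ((1 / 2 : ℝ) • T) y' := by
    ext1 y'
    change T (mid x y') = _
    rw [mid, smul_add, map_add]; simp
  rw [h, fderiv_const_add, ContinuousLinearMap.fderiv]
  rfl

lemma contourDensity_eq (x y : Cn n) :
    contourDensity (fun y' => xi Φ (mid x y')) y = contourConst Φ := by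
  simp only [contourConst, contourDensity, fderiv_xi_mid]

-- The density is the determinant of the matrix `2 lev(e_k)(e_j)`. A null vector `c` gives, for its
-- conjugate `w`, `lev w = 0` on every basis vector, hence `R(w,w) = 0`, against coercivity. The
-- exact value of the constant is never needed.
variable {Φ} in
lemma contourConst_ne_zero (hΦ : StrictlyPSH Φ) : contourConst Φ ≠ 0 := by
  obtain ⟨ρ, hρ, hR⟩ := exists_leviR_coercive hΦ
  intro h0
  unfold contourConst contourDensity at h0
  obtain ⟨c, hc, hM⟩ := Matrix.exists_mulVec_eq_zero_iff.2 h0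
  have hentry : ∀ j k : Fin n, Complex.I * ((fderiv ℝ (fun y' => xi Φ (mid (0 : Cn n) y')) 0 (e k)) j +
      Complex.I * (fderiv ℝ (fun y' => xi Φ (mid (0 : Cn n) y')) 0 (Complex.I • e k)) j) =
      2 * lev Φ (e k) (e j) := by
    intro j k
    rw [fderiv_xi_mid, fderiv_xi_mid]
    simp only [PiLp.smul_apply, xi_apply, Complex.real_smul]
    have e4 : leviR Φ (e k) (Complex.I • e j) = (polarB Φ (e k) (Complex.I • e j) -
          polarB Φ (Complex.I • e k) (e j)) / 2 := by
        rw [leviR_apply, I_smul_I_smul]; simp; ring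
    rw [lev_apply, lam_apply, lam_apply, e4, leviR_apply]
    push_cast
    field_simp
    linear_combination (-(polarB Φ (Complex.I • e k) (Complex.I • e j) : ℂ)) * Complex.I_sq
  set w : Cn n := WithLp.toLp 2 fun k => (starRingEnd ℂ) (c k) with hw
  have hconj : ∀ (a : ℂ) (y t : Cn n), lev Φ ((starRingEnd ℂ) a • y) t = a * lev Φ y t := by
    intro a y t
    have h1 : (starRingEnd ℂ) a • y = a.re • y - a.im • (Complex.I • y) := by
      rw [← Complex.coe_smul, ← Complex.coe_smul, smul_smul, ← sub_smul]
      congr 1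
      apply Complex.ext <;> simp
    have h2 : leviR Φ (Complex.I • y) (Complex.I • t) = leviR Φ y t := leviR_I_I Φ y t
    have h3 := leviR_I_left Φ y t
    rw [h1, lev_apply, lev_apply]
    simp only [map_sub, map_smul, sub_apply, smul_apply, smul_eq_mul, h2, h3]
    conv_rhs => rw [← Complex.re_add_im a]
    push_cast
    linear_combination ((a.im : ℂ) * (leviR Φ y (Complex.I • t) : ℂ)) * Complex.I_sq
  have hlev : ∀ t, lev Φ w t = ∑ k, c k * lev Φ (e k) t := by
    intro t
    have hsum : ∀ s : Finset (Fin n), lev Φ (∑ k ∈ s, w k • (e k : Cn n)) t =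
        ∑ k ∈ s, c k * lev Φ (e k) t := by
      intro s
      induction s using Finset.induction_on with
      | empty => simp [lev_apply]
      | insert a s ha ih =>
        rw [Finset.sum_insert ha, Finset.sum_insert ha, ← ih]
        have h4 : ∀ a b : Cn n, lev Φ (a + b) t = lev Φ a t + lev Φ b t := fun a b => by
          simp only [lev_apply, map_add, add_apply]; push_cast; ring
        rw [h4, ← hconj]
    have := hsum Finset.univ
    rwa [sum_smul_e] at this
  have hz : ∀ j, lev Φ w (e j) = 0 := by
    intro j
    have h5 := congrFun hM j
    simp only [Matrix.mulVec, dotProduct, Matrix.of_apply, hentry, Pi.zero_apply] at h5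
    rw [hlev]
    have : ∑ k, 2 * lev Φ (e k) (e j) * c k = 2 * ∑ k, c k * lev Φ (e k) (e j) := by
      rw [Finset.mul_sum]; exact Finset.sum_congr rfl fun k _ => by ring
    rw [this] at h5
    simpa using h5
  have hww : lev Φ w w = 0 := by
    conv_lhs => rw [← sum_smul_e w]
    rw [sum_smul_e w, ← sum_smul_e w, map_sum]
    refine Finset.sum_eq_zero fun j _ => ?_
    rw [map_smul, sum_smul_e w, hz, smul_zero]
  have h6 : leviR Φ w w = 0 := by rw [← lev_re, hww]; rfl
  have h7 : w = 0 := by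
    have := hR w
    rw [h6] at this
    have h8 : ‖w‖ ^ 2 ≤ 0 := by
      by_contra h9
      push Not at h9
      nlinarith
    exact norm_eq_zero.1 (pow_eq_zero_iff two_ne_zero |>.1 (le_antisymm h8 (by positivity)))
  apply hc
  ext k
  have : w k = 0 := by rw [h7]; rfl
  simpa [hw] using this

lemma weylGamma_eq (a : Lambda Φ → ℂ) (h : ℝ) (u : Cn n → ℂ) (x : Cn n) :
    weylGamma Φ a h u x = ((1 / (2 * Real.pi * h) ^ n : ℝ) * contourConst Φ) *
      ∫ y, Complex.exp (2 * lam Φ (mid x y) (x - y) / h) * a (lift Φ (mid x y)) * u y := by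
  unfold weylGamma
  simp only [contourDensity_eq]
  rw [integral_mul_const, mul_comm _ (contourConst Φ), ← mul_assoc]
  congr 2
  ext y
  rw [← phase_eq]
  congr 3
  simp only [PiLp.sub_apply]
  ring

end Forms

/-! ### Gaussian reproducing formulas. -/

section Formula

variable {n : ℕ} {Φ : QuadraticForm ℝ (Cn n)} {ρ : ℝ}

lemma integrable_gauss_linear (hρ : 0 < ρ) (hR : ∀ v, ρ * ‖v‖ ^ 2 ≤ leviR Φ v v) {c : ℝ}
    (hc : 0 < c) (l : Cn n →L[ℝ] ℝ) :
    Integrable fun z => Real.exp (-c * leviR Φ z z + l z) := by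
  have hI := integrable_poly_mul_gauss (volume : Measure (Cn n)) 0 (c := c * ρ / 2) (by positivity)
  refine (hI.const_mul (Real.exp (‖l‖ ^ 2 / (2 * (c * ρ))))).mono' ?_ (ae_of_all _ fun z => ?_)
  · refine Continuous.aestronglyMeasurable ?_
    have := continuous_leviR Φ (f := fun z : Cn n => z) continuous_id continuous_id
    fun_prop
  · rw [Real.norm_of_nonneg (Real.exp_pos _).le, pow_zero, one_mul, ← Real.exp_add]
    refine Real.exp_le_exp.2 ?_
    have h1 : l z ≤ ‖l‖ * ‖z‖ := (le_abs_self _).trans (l.le_opNorm z)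
    have h2 : c * (ρ * ‖z‖ ^ 2) ≤ c * leviR Φ z z := by gcongr; exact hR z
    have hcρ : 0 < c * ρ := by positivity
    have h3 : ‖l‖ * ‖z‖ ≤ ‖l‖ ^ 2 / (2 * (c * ρ)) + c * ρ / 2 * ‖z‖ ^ 2 := by
      have : 0 ≤ (‖l‖ - c * ρ * ‖z‖) ^ 2 / (2 * (c * ρ)) := by positivity
      have e : (‖l‖ - c * ρ * ‖z‖) ^ 2 / (2 * (c * ρ)) =
          ‖l‖ ^ 2 / (2 * (c * ρ)) + c * ρ / 2 * ‖z‖ ^ 2 - ‖l‖ * ‖z‖ := by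
        field_simp; ring
      linarith
    linarith

/-- The total mass of the Gaussian `exp (-c R(z,z) / h)`. -/
def gaussMass (Φ : QuadraticForm ℝ (Cn n)) (c h : ℝ) : ℝ :=
  ∫ z, Real.exp (-(c * leviR Φ z z) / h)

lemma integrable_gaussMass (hρ : 0 < ρ) (hR : ∀ v, ρ * ‖v‖ ^ 2 ≤ leviR Φ v v) {c h : ℝ}
    (hc : 0 < c) (hh : 0 < h) : Integrable fun z => Real.exp (-(c * leviR Φ z z) / h) := by
  refine (integrable_gauss_linear hρ hR (c := c / h) (by positivity) 0).congr
    (ae_of_all _ fun z => ?_)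
  simp only [zero_apply, add_zero]
  congr 1; ring

lemma gaussMass_pos (hρ : 0 < ρ) (hR : ∀ v, ρ * ‖v‖ ^ 2 ≤ leviR Φ v v) {c h : ℝ}
    (hc : 0 < c) (hh : 0 < h) : 0 < gaussMass Φ c h := by
  unfold gaussMass
  exact integral_exp_pos (integrable_gaussMass hρ hR hc hh)

lemma gaussMass_scale (c : ℝ) {t : ℝ} (ht : 0 < t) :
    gaussMass Φ c (t ^ 2) = t ^ Module.finrank ℝ (Cn n) * gaussMass Φ c 1 := by
  have h := Measure.integral_comp_smul (volume : Measure (Cn n))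
    (fun z => Real.exp (-(c * leviR Φ z z) / t ^ 2)) t
  have e : ∀ z : Cn n, -(c * leviR Φ (t • z) (t • z)) / t ^ 2 = -(c * leviR Φ z z) / 1 := by
    intro z
    simp only [map_smul, smul_apply, smul_eq_mul]
    field_simp
  simp only [e] at h
  unfold gaussMass
  rw [h, abs_of_pos (by positivity), smul_eq_mul]
  field_simp

lemma integral_cexp_gauss (c h : ℝ) :
    ∫ z, Complex.exp (-(c * leviR Φ z z) / h) = gaussMass Φ c h := by
  unfold gaussMass
  have := integral_complex_ofReal (μ := (volume : Measure (Cn n)))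
    (f := fun z => Real.exp (-(c * leviR Φ z z) / h))
  rw [← this]
  congr 1; ext z; push_cast; rfl

lemma norm_kernel_eq (u : Cn n → ℂ) (y₀ z β : Cn n) (c h : ℝ) :
    ‖u (y₀ + z) * Complex.exp (-(2 * lam Φ y₀ z + holQ Φ z + 2 * lev Φ β z) / h) *
      Complex.exp (-(c * leviR Φ z z) / h)‖ =
    Real.exp (Φ y₀ / h) * (‖u (y₀ + z)‖ * Real.exp (-Φ (y₀ + z) / h) *
      Real.exp (((1 - c) * leviR Φ z z - 2 * leviR Φ β z) / h)) := by
  have h1 := exponent_re Φ y₀ z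
  have h2 : (2 * lev Φ β z).re = 2 * leviR Φ β z := by rw [Complex.mul_re, lev_re]; simp
  have h3 : (-(2 * lam Φ y₀ z + holQ Φ z + 2 * lev Φ β z) / (h : ℂ)).re =
      -(Φ (y₀ + z) - Φ y₀ - leviR Φ z z + 2 * leviR Φ β z) / h := by
    rw [Complex.div_ofReal_re, Complex.neg_re, Complex.add_re, h2, ← h1]; ring
  have h4 : (-(c * leviR Φ z z) / h : ℂ).re = -(c * leviR Φ z z) / h := by
    rw [Complex.div_ofReal_re, Complex.neg_re, ← Complex.ofReal_mul, Complex.ofReal_re]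
  rw [norm_mul, norm_mul, Complex.norm_exp, Complex.norm_exp, h3, h4, mul_assoc, mul_assoc,
    mul_left_comm (Real.exp _), ← Real.exp_add, ← Real.exp_add, ← Real.exp_add]
  congr 2
  ring

/-- The factor multiplying the Gaussian is holomorphic in `z` with value `u y₀` at `0`, and the
Gaussian in the Levi form is circle invariant, so the mean value property applies. The parameters
`c` and `β` are free: `c = 1`, `β = 0` gives the action of the symbol `1`, `c = 2`, `β = 0` the
Bergman kernel, and `c = 2` with general `β` the tilted kernel used for the perturbed weight. -/
lemma reproducing {u : Cn n → ℂ} (hu : Differentiable ℂ u) (y₀ β : Cn n) (c h : ℝ)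
    (hi : Integrable fun z => ‖u (y₀ + z)‖ * Real.exp (-Φ (y₀ + z) / h) *
      Real.exp (((1 - c) * leviR Φ z z - 2 * leviR Φ β z) / h)) :
    ∫ z, u (y₀ + z) * Complex.exp (-(2 * lam Φ y₀ z + holQ Φ z + 2 * lev Φ β z) / h) *
      Complex.exp (-(c * leviR Φ z z) / h) = u y₀ * gaussMass Φ c h := by
  have hF : Differentiable ℂ fun z => u (y₀ + z) *
      Complex.exp (-(2 * lam Φ y₀ z + holQ Φ z + 2 * lev Φ β z) / h) := by
    have h1 := differentiable_holQ Φ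
    have h2 : Differentiable ℂ fun z => u (y₀ + z) := hu.comp (differentiable_id.const_add y₀)
    have h3 := (lam Φ y₀).differentiable
    have h4 := (lev Φ β).differentiable
    fun_prop
  have hgc : Continuous fun z => Complex.exp (-(c * leviR Φ z z) / h) := by
    have := continuous_leviR Φ (f := fun z : Cn n => z) continuous_id continuous_id
    fun_prop
  have key := integral_mul_circleInvariant
    (F := fun z => u (y₀ + z) *
      Complex.exp (-(2 * lam Φ y₀ z + holQ Φ z + 2 * lev Φ β z) / h))
    (g := fun z => Complex.exp (-(c * leviR Φ z z) / h))
    (fun z => hF.comp (differentiable_id.smul_const z)) hF.continuous hgc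
    (fun a z ha => by
      have : leviR Φ (a • z) (a • z) = leviR Φ z z := by
        have h1 : a • z = a.re • z + a.im • (Complex.I • z) := by
          rw [← Complex.coe_smul, ← Complex.coe_smul, smul_smul, ← add_smul, Complex.re_add_im]
        have h2 := leviR_I_self Φ z
        have h3 := leviR_symm Φ z (Complex.I • z)
        have h4 := leviR_I_I Φ z z
        have h5 : a.re ^ 2 + a.im ^ 2 = 1 := by
          have := Complex.sq_norm a
          rw [ha, Complex.normSq_apply] at this
          nlinarith
        rw [h1]
        simp only [map_add, map_smul, add_apply, smul_apply, smul_eq_mul, h3, h2, h4]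
        linear_combination (leviR Φ z z) * h5
      simp only [this])
    (by
      refine (hi.const_mul (Real.exp (Φ y₀ / h))).mono' ?_ (ae_of_all _ fun z => ?_)
      · exact (hF.continuous.mul hgc).aestronglyMeasurable
      · exact (norm_kernel_eq u y₀ z β c h).le)
  rw [key, integral_cexp_gauss]
  simp [holQ]

lemma RapidDecay.exists_bound {h : ℝ} {u : Cn n → ℂ} (hu : RapidDecay Φ h u) (N : ℕ) :
    ∃ C, ∀ y, ‖u y‖ * Real.exp (-Φ y / h) ≤ C * ((1 + ‖y‖) ^ N)⁻¹ := by
  obtain ⟨C, hC⟩ := hu.2 N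
  refine ⟨2 ^ N * C, fun y => ?_⟩
  have h1 : 1 + ‖y‖ ≤ 2 * Real.sqrt (1 + ‖y‖ ^ 2) := by
    have h2 : 1 ≤ Real.sqrt (1 + ‖y‖ ^ 2) := Real.one_le_sqrt.2 (by nlinarith [norm_nonneg y])
    have h3 : ‖y‖ ≤ Real.sqrt (1 + ‖y‖ ^ 2) := Real.le_sqrt_of_sq_le (by linarith)
    linarith
  have hs : 0 < Real.sqrt (1 + ‖y‖ ^ 2) := by positivity
  have hC0 : 0 ≤ C := by
    have := (norm_nonneg _).trans (hC 0)
    simp at this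
    exact this
  have h4 : (Real.sqrt (1 + ‖y‖ ^ 2) ^ N)⁻¹ ≤ 2 ^ N * ((1 + ‖y‖) ^ N)⁻¹ := by
    rw [← div_eq_mul_inv, inv_eq_one_div, div_le_div_iff₀ (by positivity) (by positivity), one_mul,
      ← mul_pow]
    gcongr
  calc _ ≤ C * (Real.sqrt (1 + ‖y‖ ^ 2) ^ N)⁻¹ * Real.exp (Φ y / h) * Real.exp (-Φ y / h) := by
        gcongr; exact hC y
    _ = C * (Real.sqrt (1 + ‖y‖ ^ 2) ^ N)⁻¹ := by
        rw [mul_assoc, ← Real.exp_add, neg_div, add_neg_cancel, Real.exp_zero, mul_one]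
    _ ≤ C * (2 ^ N * ((1 + ‖y‖) ^ N)⁻¹) := by gcongr
    _ = _ := by ring

lemma RapidDecay.integrable {h : ℝ} {u : Cn n → ℂ} (hu : RapidDecay Φ h u) :
    Integrable fun y => ‖u y‖ * Real.exp (-Φ y / h) := by
  set d : ℕ := Module.finrank ℝ (Cn n) + 1
  have hd : ((Module.finrank ℝ (Cn n) : ℕ) : ℝ) < (d : ℝ) := by simp [d]
  have hI := integrable_one_add_norm (E := Cn n) (μ := volume) hd
  obtain ⟨C, hC⟩ := hu.exists_bound d
  refine (hI.const_mul C).mono' ?_ (ae_of_all _ fun y => ?_)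
  · have h1 := hu.1.continuous
    have h2 := continuous_quadForm Φ
    exact Continuous.aestronglyMeasurable (by fun_prop)
  · rw [Real.norm_of_nonneg (by positivity), Real.rpow_neg (by positivity), Real.rpow_natCast]
    exact hC y

/-- The symbol `1` is quantized to a multiple of the identity. -/
lemma integral_one_symbol {h : ℝ} {u : Cn n → ℂ} (hu : RapidDecay Φ h u) (x : Cn n) :
    ∫ y, Complex.exp (2 * lam Φ (mid x y) (x - y) / h) * u y = u x * gaussMass Φ 1 h := by
  have hi : Integrable fun z => ‖u (x + z)‖ * Real.exp (-Φ (x + z) / h) *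
      Real.exp (((1 - 1) * leviR Φ z z - 2 * leviR Φ 0 z) / h) := by
    simpa using hu.integrable.comp_add_left x
  rw [← reproducing hu.1 x 0 1 h hi, ← integral_add_left_eq_self _ x]
  congr 1; ext z
  have e : 2 * lam Φ (mid x (x + z)) (x - (x + z)) =
      -(2 * lam Φ x z + holQ Φ z + 2 * lev Φ 0 z) - leviR Φ z z := by
    have e1 : mid x (x + z) = x + (1 / 2 : ℝ) • z := by rw [mid]; module
    have e2 : x - (x + z) = -z := by abel
    rw [e1, e2, map_neg, lam_add, lam_smul, holQ, lev_apply]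
    simp; ring
  rw [e, mul_assoc, ← Complex.exp_add, mul_comm]
  congr 2
  push_cast; ring

end Formula

/-! ### The Weyl integral composed with the tilted reproducing kernel. -/

section KernelFormula

variable {n : ℕ} {Φ : QuadraticForm ℝ (Cn n)} {ρ : ℝ}

/-- The integrand of the oscillatory integral composed with the reproducing kernel. -/
def reproKernel (Φ : QuadraticForm ℝ (Cn n)) (h : ℝ) (β : Cn n) (τ u : Cn n → ℂ)
    (x y₀ y : Cn n) : ℂ :=
  Complex.exp (2 * lam Φ (mid x y₀) (x - y₀) / h) * τ (mid x y₀) *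
    (u y * Complex.exp (-(2 * lam Φ y₀ (y - y₀) + holQ Φ (y - y₀) + 2 * lev Φ β (y - y₀)) / h) *
      Complex.exp (-((2 : ℝ) * leviR Φ (y - y₀) (y - y₀)) / h))

lemma norm_reproKernel (h : ℝ) (β : Cn n) (τ u : Cn n → ℂ) (x y₀ y : Cn n) :
    ‖reproKernel Φ h β τ u x y₀ y‖ = ‖τ (mid x y₀)‖ * (Real.exp (Φ x / h) *
      (‖u y‖ * Real.exp (-Φ y / h) * Real.exp ((-leviR Φ (y₀ - y) (y₀ - y) +
        2 * leviR Φ β (y₀ - y)) / h))) := by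
  have h1 := norm_kernel_eq (Φ := Φ) u y₀ (y - y₀) β 2 h
  rw [add_sub_cancel] at h1
  have h2 : (2 * lam Φ (mid x y₀) (x - y₀) / (h : ℂ)).re = Φ x / h - Φ y₀ / h := by
    rw [Complex.div_ofReal_re, two_lam_mid_re]; ring
  rw [reproKernel, norm_mul, norm_mul, h1, Complex.norm_exp, h2, Real.exp_sub,
    ← neg_sub y₀ y]
  simp only [map_neg, neg_apply, neg_neg]
  rw [show (1 - 2) * leviR Φ (y₀ - y) (y₀ - y) - 2 * -(leviR Φ β) (y₀ - y) =
    -leviR Φ (y₀ - y) (y₀ - y) + 2 * leviR Φ β (y₀ - y) by ring]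
  field_simp

lemma continuous_reproKernel {h : ℝ} {β : Cn n} {τ u : Cn n → ℂ} (hτ : Continuous τ)
    (hu : Continuous u) (x : Cn n) :
    Continuous fun p : Cn n × Cn n => reproKernel Φ h β τ u x p.1 p.2 := by
  unfold reproKernel
  have hm : Continuous fun p : Cn n × Cn n => mid x p.1 := by unfold mid; fun_prop
  have hz : Continuous fun p : Cn n × Cn n => p.2 - p.1 := by fun_prop
  have h1 := continuous_lam Φ hm (f := fun p : Cn n × Cn n => mid x p.1)
    (g := fun p => x - p.1) (by fun_prop)
  have h2 := continuous_lam Φ continuous_fst hz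
  have h3 := (continuous_holQ Φ).comp hz
  have h4 := (lev Φ β).continuous.comp hz
  have h5 := continuous_leviR Φ hz hz
  have h6 := hτ.comp hm
  have h7 := hu.comp (continuous_snd : Continuous fun p : Cn n × Cn n => p.2)
  simp only [Function.comp_def] at h3 h4 h6 h7
  fun_prop

/-- The majorant is a convolution integrand: the integrable function `|u| e^{-Φ/h}` against a
Gaussian multiplied by the exponential of the linear form given by `β`. The choice `c = 2` leaves
this Gaussian after the growth of the weight has been compensated. -/
lemma integrable_reproKernel (hρ : 0 < ρ) (hR : ∀ v, ρ * ‖v‖ ^ 2 ≤ leviR Φ v v) {h M : ℝ}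
    (hh : 0 < h) {τ u : Cn n → ℂ} (hτ : Continuous τ) (hM : ∀ v, ‖τ v‖ ≤ M)
    (hu : RapidDecay Φ h u) (x β : Cn n) :
    Integrable (Function.uncurry (reproKernel Φ h β τ u x)) := by
  have hg := integrable_gauss_linear hρ hR (c := 1 / h) (by positivity) ((2 / h) • leviR Φ β)
  have hc := Integrable.convolution_integrand (ContinuousLinearMap.mul ℝ ℝ) hu.integrable hg
  refine (hc.const_mul (M * Real.exp (Φ x / h))).mono'
    (continuous_reproKernel hτ hu.1.continuous x).aestronglyMeasurable (ae_of_all _ fun p => ?_)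
  rw [Function.uncurry, norm_reproKernel]
  simp only [ContinuousLinearMap.mul_apply', smul_apply, smul_eq_mul]
  rw [mul_assoc M]
  have e : (-leviR Φ (p.1 - p.2) (p.1 - p.2) + 2 * leviR Φ β (p.1 - p.2)) / h =
      -(1 / h) * leviR Φ (p.1 - p.2) (p.1 - p.2) + 2 / h * leviR Φ β (p.1 - p.2) := by ring
  rw [e]
  gcongr
  exact hM _

lemma integral_reproKernel_right (hρ : 0 < ρ) (hR : ∀ v, ρ * ‖v‖ ^ 2 ≤ leviR Φ v v) {h : ℝ}
    (hh : 0 < h) {τ u : Cn n → ℂ} (hu : RapidDecay Φ h u) (x β y₀ : Cn n) :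
    ∫ y, reproKernel Φ h β τ u x y₀ y =
      Complex.exp (2 * lam Φ (mid x y₀) (x - y₀) / h) * τ (mid x y₀) * u y₀ *
        gaussMass Φ 2 h := by
  unfold reproKernel
  rw [integral_const_mul, ← integral_add_left_eq_self _ y₀]
  simp only [add_sub_cancel_left]
  rw [reproducing hu.1 y₀ β 2 h, ← mul_assoc]
  obtain ⟨C, hC⟩ := hu.exists_bound 0
  have hg := integrable_gauss_linear hρ hR (c := 1 / h) (by positivity) ((-2 / h) • leviR Φ β)
  refine (hg.const_mul C).mono' ?_ (ae_of_all _ fun z => ?_)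
  · have h1 := hu.1.continuous
    have h2 := continuous_quadForm Φ
    have h3 := continuous_leviR Φ (f := fun z : Cn n => z) continuous_id continuous_id
    exact Continuous.aestronglyMeasurable (by fun_prop)
  · rw [Real.norm_of_nonneg (by positivity)]
    have := hC (y₀ + z)
    simp only [smul_apply, smul_eq_mul]
    have e : ((1 - 2) * leviR Φ z z - 2 * leviR Φ β z) / h =
      -(1 / h) * leviR Φ z z + -2 / h * leviR Φ β z := by ring
    rw [e]
    gcongr
    simpa using this

/-- The substitution `y₀ = y + 2tv + β` puts the exponent into the normal form of
`exponent_identity`: the terms linear in `v` become purely oscillating, and the real factor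
`exp(R(β,β)/h)` comes out. The symbol is then sampled around `mid x y + β/2` on the scale `t`. -/
lemma integral_reproKernel_left {t : ℝ} (ht : 0 < t) (τ u : Cn n → ℂ) (x β y : Cn n) :
    ∫ y₀, reproKernel Φ (t ^ 2) β τ u x y₀ y =
      Complex.exp (2 * lam Φ (mid x y) (x - y) / (t ^ 2 : ℝ)) * u y *
        (Complex.exp ((leviR Φ β β - 2 * Complex.I * leviR Φ (Complex.I • (x - y)) β) /
          (t ^ 2 : ℝ)) * (((2 * t) ^ Module.finrank ℝ (Cn n) : ℝ) *
            ∫ v, τ (mid x y + (1 / 2 : ℝ) • β + t • v) *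
              oscGauss (leviR Φ) (t⁻¹ • Complex.I • (x - y - β)) v)) := by
  set G : Cn n → ℂ := fun w => reproKernel Φ (t ^ 2) β τ u x (y + w) y with hG
  have h1 : ∫ y₀, reproKernel Φ (t ^ 2) β τ u x y₀ y = ∫ w, G (w + β) := by
    rw [integral_add_right_eq_self G β, hG,
      integral_add_left_eq_self (fun y₀ => reproKernel Φ (t ^ 2) β τ u x y₀ y) y]
  have h2 := Measure.integral_comp_smul (volume : Measure (Cn n)) (fun w => G (w + β)) (2 * t)
  have h3 : ∫ w, G (w + β) = ((2 * t) ^ Module.finrank ℝ (Cn n) : ℝ) *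
      ∫ v, G ((2 * t) • v + β) := by
    rw [h2, abs_of_pos (by positivity), ← Complex.real_smul, smul_smul,
      mul_inv_cancel₀ (by positivity), one_smul]
  have h4 : ∀ v, G ((2 * t) • v + β) =
      Complex.exp (2 * lam Φ (mid x y) (x - y) / (t ^ 2 : ℝ)) * u y *
        Complex.exp ((leviR Φ β β - 2 * Complex.I * leviR Φ (Complex.I • (x - y)) β) /
          (t ^ 2 : ℝ)) * (τ (mid x y + (1 / 2 : ℝ) • β + t • v) *
            oscGauss (leviR Φ) (t⁻¹ • Complex.I • (x - y - β)) v) := by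
    intro v
    have e1 := exponent_identity Φ x y β (t • v)
    have e2 : (2 * t) • v + β = (2 : ℝ) • (t • v) + β := by rw [smul_smul]
    have e3 : y - (y + ((2 : ℝ) • (t • v) + β)) = -((2 : ℝ) • (t • v) + β) := by abel
    have e4 : mid x (y + ((2 : ℝ) • (t • v) + β)) = mid x y + (1 / 2 : ℝ) • β + t • v := by
      unfold mid; module
    have e5 : -4 * ((leviR Φ v v : ℂ) +
        Complex.I * leviR Φ (t⁻¹ • Complex.I • (x - y - β)) v) =
        -(4 * (leviR Φ (t • v) (t • v) + Complex.I * leviR Φ (Complex.I • (x - y - β)) (t • v))) /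
          (t ^ 2 : ℝ) := by
      have : (t : ℂ) ≠ 0 := by exact_mod_cast ht.ne'
      simp only [map_smul, smul_apply, smul_eq_mul]
      push_cast
      field_simp
    rw [hG]
    simp only [reproKernel]
    rw [e2, e3, oscGauss, e5]
    rw [show ∀ a b c d e : ℂ, a * b * (c * d * e) = c * b * (a * d * e) by intros; ring,
      show ∀ a b c d e : ℂ, a * b * c * (d * e) = b * d * (a * c * e) by intros; ring, e4,
      ← Complex.exp_add, ← Complex.exp_add, ← Complex.exp_add, ← Complex.exp_add]
    rw [e4] at e1
    congr 2
    rw [← add_div, ← add_div, ← add_div, ← add_div]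
    congr 1
  rw [h1, h3]
  simp only [h4]
  rw [integral_const_mul]
  ring

/-- The conjugated form of the Weyl kernel: the symbol enters through an oscillatory Gaussian
integral. -/
lemma weyl_integral_eq (hρ : 0 < ρ) (hR : ∀ v, ρ * ‖v‖ ^ 2 ≤ leviR Φ v v) {t M : ℝ}
    (ht : 0 < t) {τ u : Cn n → ℂ} (hτ : Continuous τ) (hM : ∀ v, ‖τ v‖ ≤ M)
    (hu : RapidDecay Φ (t ^ 2) u) (x β : Cn n) :
    (∫ y, Complex.exp (2 * lam Φ (mid x y) (x - y) / (t ^ 2 : ℝ)) * τ (mid x y) * u y) *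
      gaussMass Φ 2 (t ^ 2) =
    ∫ y, Complex.exp (2 * lam Φ (mid x y) (x - y) / (t ^ 2 : ℝ)) * u y *
        (Complex.exp ((leviR Φ β β - 2 * Complex.I * leviR Φ (Complex.I • (x - y)) β) /
          (t ^ 2 : ℝ)) * (((2 * t) ^ Module.finrank ℝ (Cn n) : ℝ) *
            ∫ v, τ (mid x y + (1 / 2 : ℝ) • β + t • v) *
              oscGauss (leviR Φ) (t⁻¹ • Complex.I • (x - y - β)) v)) := by
  rw [← integral_mul_const]
  simp only [← integral_reproKernel_right hρ hR (show 0 < t ^ 2 by positivity) hu x β]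
  rw [integral_integral_swap (integrable_reproKernel hρ hR (by positivity) hτ hM hu x β)]
  simp only [integral_reproKernel_left ht]

end KernelFormula

/-! ### Behaviour of Gevrey bounds and Taylor shifts under scaling. -/

section Rescaling

variable {E : Type*} [NormedAddCommGroup E] [NormedSpace ℝ E] {σ : E → ℂ} {s M r : ℝ}

lemma iteratedFDeriv_comp_affine (hσ : ContDiff ℝ ∞ σ) (c : E) (t : ℝ) (j : ℕ) (v : E) :
    iteratedFDeriv ℝ j (fun v => σ (c + t • v)) v = t ^ j • iteratedFDeriv ℝ j σ (c + t • v) := by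
  have h1 : ContDiff ℝ j fun v => σ (c + v) :=
    (hσ.comp (contDiff_const.add contDiff_id)).of_le (by exact_mod_cast le_top)
  have h2 := congrFun (iteratedFDeriv_comp_const_smul (i := j) t h1) v
  rw [h2, iteratedFDeriv_comp_add_left]

lemma GevreyNorm.comp_affine (h : GevreyNorm s M r σ) (c : E) {t : ℝ} (ht : 0 ≤ t) :
    GevreyNorm s M (t * r) (fun v => σ (c + t • v)) := by
  refine ⟨h.1.comp (contDiff_const.add (contDiff_const.smul contDiff_id)), fun j v => ?_⟩
  rw [iteratedFDeriv_comp_affine h.1, norm_smul, norm_pow, Real.norm_of_nonneg ht, mul_pow]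
  calc _ ≤ t ^ j * (M * r ^ j * (j.factorial : ℝ) ^ s) := by gcongr; exact h.2 _ _
    _ = _ := by ring

lemma taylorShift_comp_affine (hσ : ContDiff ℝ ∞ σ) (c η : E) (t : ℝ) (m : ℕ) (v : E) :
    taylorShift (fun v => σ (c + t • v)) η m v = taylorShift σ (t • η) m (c + t • v) := by
  unfold taylorShift
  refine Finset.sum_congr rfl fun k _ => ?_
  have h1 : ContDiff ℝ ∞ fun v => σ (c + t • v) :=
    hσ.comp (contDiff_const.add (contDiff_const.smul contDiff_id))
  rw [iterate_dird_eq h1, iterate_dird_eq hσ, iteratedFDeriv_comp_affine hσ,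
    ContinuousMultilinearMap.map_smul_univ]
  simp

end Rescaling

/-! ### The vector dual to the gradient of the perturbation, and Taylor remainders. -/

section Geometry

variable {n : ℕ} {Φ : QuadraticForm ℝ (Cn n)} {ρ : ℝ}

/-- Coercivity makes the map from vectors to forms injective, hence bijective in finite dimension.
-/
lemma exists_leviR_dual (hρ : 0 < ρ) (hR : ∀ v, ρ * ‖v‖ ^ 2 ≤ leviR Φ v v)
    (l : Cn n →L[ℝ] ℝ) : ∃ β, ∀ v, 2 * leviR Φ v β = l v := by
  let T : Cn n →ₗ[ℝ] Module.Dual ℝ (Cn n) :=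
    { toFun := fun x => (leviR Φ x : Cn n →ₗ[ℝ] ℝ)
      map_add' := fun x y => by ext; simp
      map_smul' := fun c x => by ext; simp }
  have hinj : Function.Injective T := by
    rw [← LinearMap.ker_eq_bot, LinearMap.ker_eq_bot']
    intro x hx
    have h1 : leviR Φ x x = 0 := LinearMap.congr_fun hx x
    have h2 := hR x
    rw [h1] at h2
    have h3 : ‖x‖ ^ 2 ≤ 0 := nonpos_of_mul_nonpos_right h2 hρ
    exact norm_eq_zero.1 (pow_eq_zero_iff two_ne_zero |>.1 (le_antisymm h3 (by positivity)))
  have hsurj := (LinearMap.injective_iff_surjective_of_finrank_eq_finrank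
    (Subspace.dual_finrank_eq (K := ℝ) (V := Cn n)).symm).1 hinj
  obtain ⟨b, hb⟩ := hsurj ((1 / 2 : ℝ) • (l : Cn n →ₗ[ℝ] ℝ))
  refine ⟨b, fun v => ?_⟩
  have := LinearMap.congr_fun hb v
  change leviR Φ b v = (1 / 2 : ℝ) * l v at this
  rw [leviR_symm, this]; ring

/-- Testing with `v = β`: `2ρ|β|² ≤ 2R(β,β) = l β ≤ ε|β|`. -/
lemma norm_le_of_leviR_dual (hρ : 0 < ρ) (hR : ∀ v, ρ * ‖v‖ ^ 2 ≤ leviR Φ v v)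
    {l : Cn n →L[ℝ] ℝ} {β : Cn n} (h : ∀ v, 2 * leviR Φ v β = l v) {ε : ℝ} (hl : ‖l‖ ≤ ε) :
    ‖β‖ ≤ ε / (2 * ρ) := by
  rw [le_div_iff₀ (by positivity)]
  rcases eq_or_ne β 0 with rfl | hβ
  · simpa using (norm_nonneg _).trans hl
  have hβ' : 0 < ‖β‖ := norm_pos_iff.2 hβ
  have h1 := hR β
  have h2 := h β
  have h3 : l β ≤ ε * ‖β‖ := (le_abs_self _).trans ((l.le_opNorm β).trans (by gcongr))
  nlinarith

/-- The first order Taylor remainder of a `C^{1,1}`-small function. -/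
lemma C11Small.taylor_le {f : Cn n → ℝ} {ε : ℝ} (hf : ContDiff ℝ 1 f) (h : C11Small f ε)
    (x y : Cn n) :
    f y - f x + fderiv ℝ f x (x - y) ≤ 4 * (ε * ‖x - y‖ ^ 2 / (1 + ‖x - y‖)) := by
  obtain ⟨h0, h1, h2⟩ := h
  have hd : Differentiable ℝ f := hf.differentiable (by norm_num)
  have hε : 0 ≤ ε := (norm_nonneg _).trans (h1 0)
  have hs : f y - f x + fderiv ℝ f x (x - y) = f y - f x - fderiv ℝ f x (y - x) := by
    rw [← neg_sub y x, map_neg]; ring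
  set P := ‖x - y‖ with hP
  have hP0 : 0 ≤ P := norm_nonneg _
  have b1 : f y - f x + fderiv ℝ f x (x - y) ≤ ε * P * P := by
    have := (convex_closedBall x P).norm_image_sub_le_of_norm_fderiv_le' (𝕜 := ℝ) (f := f)
      (φ := fderiv ℝ f x) (C := ε * P) (fun z _ => hd z) (fun z hz => (h2 z x).trans (by
        gcongr; simpa [dist_eq_norm] using hz))
      (Metric.mem_closedBall_self hP0) (y := y) (by simp [hP, dist_eq_norm, norm_sub_rev])
    rw [hs]
    refine (le_abs_self _).trans (this.trans_eq ?_)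
    rw [norm_sub_rev]
  have b2 : f y - f x + fderiv ℝ f x (x - y) ≤ 2 * ε * P := by
    have := convex_univ.norm_image_sub_le_of_norm_fderiv_le' (𝕜 := ℝ) (f := f)
      (φ := fderiv ℝ f x) (C := 2 * ε) (fun z _ => hd z) (fun z _ => by
        linarith [norm_sub_le (fderiv ℝ f z) (fderiv ℝ f x), h1 x, h1 z])
      (Set.mem_univ x) (Set.mem_univ y)
    rw [hs]
    refine (le_abs_self _).trans (this.trans_eq ?_)
    rw [norm_sub_rev]
  rw [← mul_div_assoc, le_div_iff₀ (by positivity)]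
  have hmul := mul_nonneg hε hP0
  -- Near the diagonal the quadratic bound from the Lipschitz gradient is used, far away the linear
  -- one from the bounded gradient; `4P²/(1+P)` dominates both.
  rcases le_total P 1 with hP1 | hP1
  · refine (mul_le_mul_of_nonneg_right b1 (by positivity)).trans ?_
    nlinarith [mul_nonneg hmul hP0]
  · refine (mul_le_mul_of_nonneg_right b2 (by positivity)).trans ?_
    nlinarith

end Geometry

/-! ### The weighted kernel and the choice of the imaginary shift. -/

section KernelEstimate

variable {n : ℕ} {Φ : QuadraticForm ℝ (Cn n)} {ρ : ℝ}

lemma norm_smul_I_smul {t : ℝ} (ht : 0 < t) (w : Cn n) : ‖t⁻¹ • Complex.I • w‖ = ‖w‖ / t := by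
  rw [norm_smul, norm_smul, Complex.norm_I, one_mul, norm_inv, Real.norm_of_nonneg ht.le]
  ring

lemma leviR_smul_I_smul (t : ℝ) (v w : Cn n) :
    leviR Φ (t⁻¹ • Complex.I • v) (t⁻¹ • Complex.I • w) = leviR Φ v w / t ^ 2 := by
  simp only [map_smul, smul_apply, smul_eq_mul, leviR_I_I]
  ring

/-- The exponents produced by the contour shift `κ`. -/
lemma shift_exponent_le (hρ : 0 < ρ) (hR : ∀ v, ρ * ‖v‖ ^ 2 ≤ leviR Φ v v) {f : Cn n → ℝ} {ε : ℝ}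
    (hε : ε ≤ ρ / 8) (hf : ContDiff ℝ 1 f) (hfε : C11Small f ε) {x y β : Cn n}
    (hβ : ∀ v, 2 * leviR Φ v β = fderiv ℝ f x v) {κ : ℝ}
    (hκ : κ = 2 * ε / (ρ * (1 + ‖x - y‖))) :
    4 * (leviR Φ (-κ • (x - y) + (1 / 2 : ℝ) • β) (-κ • (x - y) + (1 / 2 : ℝ) • β) +
        leviR Φ (x - y - β) (-κ • (x - y) + (1 / 2 : ℝ) • β)) +
      (f y - f x + leviR Φ β β) ≤ 0 := by
  have hε0 : 0 ≤ ε := (norm_nonneg _).trans (hfε.2.1 0)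
  have hT := hfε.taylor_le hf x y
  set p := x - y with hp
  -- The component `β/2` of the shift yields `2R(p,β) = df(x) p`, which completes `f y - f x` to a
  -- Taylor remainder, and a `-R(β,β)` that cancels the one from the kernel. The component `-κ p`
  -- yields a negative multiple of `R(p,p)`.
  have hV : 4 * (leviR Φ (-κ • p + (1 / 2 : ℝ) • β) (-κ • p + (1 / 2 : ℝ) • β) +
      leviR Φ (p - β) (-κ • p + (1 / 2 : ℝ) • β)) =
      2 * leviR Φ p β - 4 * (κ * (1 - κ)) * leviR Φ p p - leviR Φ β β := by
    have := leviR_symm Φ β p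
    simp only [map_add, map_sub, map_smul, add_apply, sub_apply, smul_apply, smul_eq_mul, this]
    ring
  have hP0 : 0 ≤ ‖p‖ := norm_nonneg _
  have hκ0 : 0 ≤ κ := by rw [hκ]; positivity
  have hκ1 : κ ≤ 1 / 4 := by
    rw [hκ, div_le_iff₀ (by positivity)]
    nlinarith [mul_nonneg hρ.le hP0]
  -- `κ` is chosen so that this gain is exactly the bound of `C11Small.taylor_le`.
  have h1 : 2 * κ * (ρ * ‖p‖ ^ 2) = 4 * (ε * ‖p‖ ^ 2 / (1 + ‖p‖)) := by
    rw [hκ]; field_simp; ring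
  have h2 : 2 * κ * (ρ * ‖p‖ ^ 2) ≤ 4 * (κ * (1 - κ)) * leviR Φ p p := by
    have h3 : 2 * κ ≤ 4 * (κ * (1 - κ)) := by nlinarith
    exact mul_le_mul h3 (hR p) (by positivity) (by nlinarith)
  rw [hV, hβ p]
  linarith

/-- The crude growth without any shift, needed for the Taylor remainder: `2ε` from the values of
`f`, and `R(β,β) = df(x)β/2`, which is a small fraction of `ε` because `|β| ≤ 1/16`. -/
lemma base_exponent_le (hρ : 0 < ρ) (hR : ∀ v, ρ * ‖v‖ ^ 2 ≤ leviR Φ v v) {f : Cn n → ℝ} {ε : ℝ}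
    (hε : ε ≤ ρ / 8) (hfε : C11Small f ε) {x β : Cn n}
    (hβ : ∀ v, 2 * leviR Φ v β = fderiv ℝ f x v) (y : Cn n) :
    f y - f x + leviR Φ β β ≤ 3 * ε := by
  have hε0 : 0 ≤ ε := (norm_nonneg _).trans (hfε.2.1 0)
  have h1 := norm_le_of_leviR_dual hρ hR hβ (hfε.2.1 x)
  have h2 : ‖β‖ ≤ 1 / 16 := h1.trans (by rw [div_le_iff₀ (by positivity)]; linarith)
  have h3 : fderiv ℝ f x β ≤ ε * ‖β‖ :=
    (le_abs_self _).trans ((ContinuousLinearMap.le_opNorm _ _).trans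
      (mul_le_mul_of_nonneg_right (hfε.2.1 x) (norm_nonneg _)))
  have h4 := hβ β
  have h5 := abs_le.1 (hfε.1 x)
  have h6 := abs_le.1 (hfε.1 y)
  nlinarith [mul_nonneg hε0 (norm_nonneg β)]

/-- Along the shift, `τ²A ≤ τA`, so the left side is at most `τ · 4(A+B) ≤ -τF`; and `(1-τ)F ≤ 3ε`.
Thus intermediate shifts lose no more than the crude growth. -/
lemma homotopy_exponent_le {A B F ε τ : ℝ} (hA : 0 ≤ A) (h : 4 * (A + B) + F ≤ 0)
    (hF : F ≤ 3 * ε) (hε : 0 ≤ ε) (hτ0 : 0 ≤ τ) (hτ1 : τ ≤ 1) :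
    4 * (τ ^ 2 * A + τ * B) ≤ 3 * ε - F := by
  have h1 := mul_le_mul_of_nonneg_left h hτ0
  have h2 := mul_le_mul_of_nonneg_left hF (sub_nonneg.2 hτ1)
  have h3 := mul_nonneg (mul_nonneg hτ0 (sub_nonneg.2 hτ1)) hA
  have h4 := mul_nonneg hε hτ0
  nlinarith

set_option maxHeartbeats 1000000 in
/-- The weighted kernel of the difference between the Weyl quantization and a multiplication
operator decays on the scale `t = √h` and gains a factor `t`. -/
lemma exists_weighted_kernel_bound (hρ : 0 < ρ) (hR : ∀ v, ρ * ‖v‖ ^ 2 ≤ leviR Φ v v) (N : ℕ)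
    {s : ℝ} (hs : 1 ≤ s) :
    ∃ C : ℝ, 0 ≤ C ∧ ∀ (σ : Cn n → ℂ) (φ : Cn n → ℝ) (M r t ε K : ℝ) (m : ℕ),
      GevreyNorm s M r σ → 0 ≤ r → 0 < t → t ≤ 1 → t * r ≤ 1 → ε ≤ ρ / 8 → m ≠ 0 →
      Real.exp 1 * (2 ^ (s + 1) * (3 * ε / ρ * r) * (m : ℝ) ^ (s - 1)) ≤ 1 →
      Real.exp (3 * ε / t ^ 2 - m) ≤ K * t ^ (N + 2) →
      ContDiff ℝ 1 φ → C11Small φ ε → ∀ x y β : Cn n,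
      (∀ v, 2 * leviR Φ v β = fderiv ℝ φ x v) →
      Real.exp ((φ y - φ x + leviR Φ β β) / t ^ 2) *
        ‖∫ v, (σ (mid x y + (1 / 2 : ℝ) • β + t • v) -
          taylorShift σ ((1 / 2 : ℝ) • Complex.I • β) m (x + (1 / 2 : ℝ) • β)) *
            oscGauss (leviR Φ) (t⁻¹ • Complex.I • (x - y - β)) v‖ ≤
        C * M * (r + K) * t * ((1 + ‖x - y‖ / t) ^ N)⁻¹ := by
  -- One decay power more than asked for: it is spent on the factor `1 + |v₀| + |η - η₀| ≤ X`.
  obtain ⟨C, hC, hker⟩ := exists_kernel_bound (volume : Measure (Cn n)) (leviR_symm Φ) hρ hR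
    (N + 1) hs
  refine ⟨C * 3 ^ (N + 1), by positivity, ?_⟩
  intro σ f M r t ε K m hσ hr ht ht1 htr hε hm hexp hK hf hfε x y β hβ
  have hM := hσ.nonneg
  have hε0 : 0 ≤ ε := (norm_nonneg _).trans (hfε.2.1 0)
  have hβ1 := norm_le_of_leviR_dual hρ hR hβ (hfε.2.1 x)
  have hβ2 : ‖β‖ ≤ 1 / 16 := hβ1.trans (by rw [div_le_iff₀ (by positivity)]; linarith)
  obtain ⟨κ, hκ⟩ : ∃ κ, κ = 2 * ε / (ρ * (1 + ‖x - y‖)) := ⟨_, rfl⟩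
  have hVF := shift_exponent_le hρ hR hε hf hfε hβ hκ
  have hF := base_exponent_le hρ hR hε hfε hβ y
  set F := f y - f x + leviR Φ β β with hFdef
  set c := mid x y + (1 / 2 : ℝ) • β with hc
  have hc0 : x + (1 / 2 : ℝ) • β = c + t • ((2 * t)⁻¹ • (x - y)) := by
    have : t * (2 * t)⁻¹ = 1 / 2 := by field_simp
    rw [smul_smul, this, hc, mid]; module
  set p := x - y with hp
  -- The Gaussian is shifted by `q`, which depends on `y`, whereas `b` must depend on `x` only and
  -- uses the shift `β/2`. The discrepancy `κ p` is paid for by the term `|η - η₀|` of the kernel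
  -- bound.
  set q := -κ • p + (1 / 2 : ℝ) • β with hq
  have hP0 : 0 ≤ ‖p‖ := norm_nonneg _
  have hκ0 : 0 ≤ κ := by rw [hκ]; positivity
  have hκ1 : κ ≤ 1 / 4 := by
    rw [hκ, div_le_iff₀ (by positivity)]
    nlinarith [mul_nonneg hρ.le hP0]
  have hκP : κ * ‖p‖ ≤ 2 * ε / ρ := by
    rw [hκ, div_mul_eq_mul_div, div_le_div_iff₀ (by positivity) hρ]
    nlinarith [mul_nonneg hε0 hρ.le]
  have hqn : ‖q‖ ≤ 3 * ε / ρ := by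
    calc ‖q‖ ≤ ‖-κ • p‖ + ‖(1 / 2 : ℝ) • β‖ := norm_add_le _ _
      _ = κ * ‖p‖ + 1 / 2 * ‖β‖ := by
        rw [norm_smul, norm_smul, norm_neg, Real.norm_of_nonneg hκ0]; norm_num
      _ ≤ 2 * ε / ρ + 1 / 2 * (ε / (2 * ρ)) := by gcongr
      _ ≤ 3 * ε / ρ := by
        rw [show 2 * ε / ρ + 1 / 2 * (ε / (2 * ρ)) = (9 / 4) * ε / ρ by ring]
        gcongr; norm_num
  have hbn : ‖(1 / 2 : ℝ) • β‖ ≤ 3 * ε / ρ := by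
    calc ‖(1 / 2 : ℝ) • β‖ = 1 / 2 * ‖β‖ := by rw [norm_smul]; norm_num
      _ ≤ 1 / 2 * (ε / (2 * ρ)) := by gcongr
      _ = (1 / 4) * ε / ρ := by ring
      _ ≤ 3 * ε / ρ := by gcongr; norm_num
  set X := 1 + ‖p‖ / t with hX
  have hX1 : 1 ≤ X := by rw [hX]; have : 0 ≤ ‖p‖ / t := by positivity
                         linarith
  have hX0 : 0 < X := by linarith
  set η := t⁻¹ • Complex.I • q with hη
  set η₀ := t⁻¹ • Complex.I • ((1 / 2 : ℝ) • β) with hη₀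
  set ζ := t⁻¹ • Complex.I • (p - β) with hζ
  set v₀ := (2 * t)⁻¹ • p with hv₀
  -- A common bound for all intermediate shifts. There `β/t` may be large, so the frequency is only
  -- known to satisfy `tX ≤ 3(1 + |ζ + 2τη|)`; the resulting loss `t^{-(N+1)}` is compensated by the
  -- power `t^(N+2)` in the hypothesis on `m`.
  set W := Real.exp ((3 * ε - F) / t ^ 2) * (3 / (t * X)) ^ (N + 1) with hW
  have hζη : ∀ τ : ℝ, ζ + (2 * τ) • η =
      t⁻¹ • Complex.I • ((1 - 2 * τ * κ) • p - (1 - τ) • β) := by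
    intro τ
    rw [hζ, hη, smul_comm (2 * τ) t⁻¹, smul_comm (2 * τ) Complex.I, ← smul_add, ← smul_add, hq]
    congr 2
    module
  have e1 : leviR Φ η η = leviR Φ q q / t ^ 2 := leviR_smul_I_smul t q q
  have e2 : leviR Φ ζ η = leviR Φ (p - β) q / t ^ 2 := leviR_smul_I_smul t _ q
  have hb : taylorShift σ ((1 / 2 : ℝ) • Complex.I • β) m (x + (1 / 2 : ℝ) • β) =
      taylorShift (fun v => σ (c + t • v)) η₀ m v₀ := by
    rw [taylorShift_comp_affine hσ.1, hc0, hη₀, smul_smul t t⁻¹, mul_inv_cancel₀ ht.ne', one_smul,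
      smul_comm Complex.I (1 / 2 : ℝ) β]
  have hmain := hker (fun v => σ (c + t • v)) M (t * r) (3 * ε / ρ * r) η η₀ ζ v₀ m W
    (hσ.comp_affine c ht.le) (by positivity) htr
    (by
      rw [hη, norm_smul_I_smul ht]
      calc ‖q‖ / t * (t * r) = ‖q‖ * r := by field_simp
        _ ≤ _ := by gcongr)
    (by
      rw [hη₀, norm_smul_I_smul ht]
      calc ‖(1 / 2 : ℝ) • β‖ / t * (t * r) = ‖(1 / 2 : ℝ) • β‖ * r := by field_simp
        _ ≤ _ := by gcongr)
    hm hexp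
    (by
      rintro τ ⟨hτ0, hτ1⟩
      have hqq : 0 ≤ leviR Φ q q := (by positivity : 0 ≤ ρ * ‖q‖ ^ 2).trans (hR q)
      have h1 : 4 * (τ ^ 2 * leviR Φ η η + τ * leviR Φ ζ η) ≤ (3 * ε - F) / t ^ 2 := by
        rw [e1, e2, show 4 * (τ ^ 2 * (leviR Φ q q / t ^ 2) + τ * (leviR Φ (p - β) q / t ^ 2)) =
          (4 * (τ ^ 2 * leviR Φ q q + τ * leviR Φ (p - β) q)) / t ^ 2 by ring]
        gcongr
        exact homotopy_exponent_le hqq hVF hF hε0 hτ0 hτ1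
      have h2 : t * X ≤ 3 * (1 + ‖ζ + (2 * τ) • η‖) := by
        have h3 : ‖p‖ / 2 - 1 / 16 ≤ ‖(1 - 2 * τ * κ) • p - (1 - τ) • β‖ := by
          have h4 := norm_sub_norm_le ((1 - 2 * τ * κ) • p) ((1 - τ) • β)
          have h6 : τ * κ ≤ 1 / 4 := (mul_le_of_le_one_left hκ0 hτ1).trans hκ1
          have h8 : τ * κ * ‖p‖ ≤ 1 / 4 * ‖p‖ := by gcongr
          have h9 : 0 ≤ τ * ‖β‖ := by positivity
          rw [norm_smul, norm_smul, Real.norm_of_nonneg (by linarith),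
            Real.norm_of_nonneg (by linarith)] at h4
          linarith
        have h5 : ‖(1 - 2 * τ * κ) • p - (1 - τ) • β‖ ≤
            ‖(1 - 2 * τ * κ) • p - (1 - τ) • β‖ / t := by
          rw [le_div_iff₀ ht]; exact mul_le_of_le_one_right (norm_nonneg _) ht1
        rw [hζη, norm_smul_I_smul ht, hX, mul_add, mul_div_cancel₀ _ ht.ne']
        linarith
      have h7 : 1 ≤ (3 / (t * X)) ^ (N + 1) * (1 + ‖ζ + (2 * τ) • η‖) ^ (N + 1) := by
        rw [← mul_pow]
        refine one_le_pow₀ ?_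
        rw [div_mul_eq_mul_div, le_div_iff₀ (by positivity)]
        linarith
      calc _ ≤ Real.exp ((3 * ε - F) / t ^ 2) * 1 := by
            rw [mul_one]; exact Real.exp_le_exp.2 h1
        _ ≤ Real.exp ((3 * ε - F) / t ^ 2) *
            ((3 / (t * X)) ^ (N + 1) * (1 + ‖ζ + (2 * τ) • η‖) ^ (N + 1)) := by gcongr
        _ = _ := by rw [hW]; ring)
  rw [hb]
  have hv₀n : 1 + ‖v₀‖ + ‖η - η₀‖ ≤ X := by
    have h1 : ‖v₀‖ = ‖p‖ / t / 2 := by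
      rw [hv₀, norm_smul, norm_inv, Real.norm_of_nonneg (by positivity)]; field_simp
    have h2 : ‖η - η₀‖ = κ * (‖p‖ / t) := by
      rw [hη, hη₀, ← smul_sub, ← smul_sub, norm_smul_I_smul ht, hq, add_sub_cancel_right, norm_smul,
        norm_neg, Real.norm_of_nonneg hκ0]
      ring
    rw [h1, h2, hX]
    have : 0 ≤ ‖p‖ / t := by positivity
    nlinarith
  -- At the full shift `β` drops out of the frequency, which becomes `i(1-2κ)(x-y)/t`. The main term
  -- thus decays on the scale `t` without loss.
  have hY : ((1 + ‖ζ + (2 : ℝ) • η‖) ^ (N + 1))⁻¹ ≤ 2 ^ (N + 1) * (X ^ (N + 1))⁻¹ := by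
    have h1 := hζη 1
    rw [mul_one, sub_self, zero_smul, sub_zero] at h1
    have h2 : X ≤ 2 * (1 + ‖ζ + (2 : ℝ) • η‖) := by
      rw [h1, norm_smul_I_smul ht, norm_smul, Real.norm_of_nonneg (by linarith), hX,
        mul_div_assoc]
      have : 0 ≤ ‖p‖ / t := by positivity
      nlinarith
    rw [← div_eq_mul_inv, inv_eq_one_div, div_le_div_iff₀ (by positivity) (by positivity), one_mul,
      ← mul_pow]
    gcongr
  have hE : Real.exp (F / t ^ 2) * Real.exp (4 * (leviR Φ η η + leviR Φ ζ η)) ≤ 1 := by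
    rw [← Real.exp_add, Real.exp_le_one_iff, e1, e2]
    rw [show F / t ^ 2 + 4 * (leviR Φ q q / t ^ 2 + leviR Φ (p - β) q / t ^ 2) =
      (4 * (leviR Φ q q + leviR Φ (p - β) q) + F) / t ^ 2 by ring]
    exact div_nonpos_of_nonpos_of_nonneg hVF (by positivity)
  have hK0 : 0 ≤ K := by
    by_contra h
    push Not at h
    have := (Real.exp_pos _).trans_le hK
    nlinarith [show 0 < t ^ (N + 2) by positivity]
  have hEW : Real.exp (F / t ^ 2) * (Real.exp (-m) * W) ≤
      K * t * 3 ^ (N + 1) * (X ^ (N + 1))⁻¹ := by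
    have h1 : Real.exp (F / t ^ 2) * (Real.exp (-m) * W) =
        Real.exp (3 * ε / t ^ 2 - m) * (3 / (t * X)) ^ (N + 1) := by
      rw [hW, ← mul_assoc, ← mul_assoc, ← Real.exp_add, ← Real.exp_add]
      congr 2; ring
    rw [h1]
    calc _ ≤ K * t ^ (N + 2) * (3 / (t * X)) ^ (N + 1) := by gcongr
      _ = _ := by rw [div_pow, mul_pow]; field_simp; ring
  have hXX : (X ^ (N + 1))⁻¹ ≤ (X ^ N)⁻¹ := by
    exact inv_anti₀ (by positivity) (pow_le_pow_right₀ hX1 (Nat.le_succ N))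
  calc _ ≤ Real.exp (F / t ^ 2) * (C * M * ((t * r) * (1 + ‖v₀‖ + ‖η - η₀‖) *
          (Real.exp (4 * (leviR Φ η η + leviR Φ ζ η)) * ((1 + ‖ζ + (2 : ℝ) • η‖) ^ (N + 1))⁻¹) +
            Real.exp (-m) * W)) := by gcongr
    _ = C * M * ((t * r) * (1 + ‖v₀‖ + ‖η - η₀‖) * ((Real.exp (F / t ^ 2) *
          Real.exp (4 * (leviR Φ η η + leviR Φ ζ η))) * ((1 + ‖ζ + (2 : ℝ) • η‖) ^ (N + 1))⁻¹) +
            Real.exp (F / t ^ 2) * (Real.exp (-m) * W)) := by ring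
    _ ≤ C * M * ((t * r) * X * (1 * (2 ^ (N + 1) * (X ^ (N + 1))⁻¹)) +
          K * t * 3 ^ (N + 1) * (X ^ (N + 1))⁻¹) := by gcongr
    _ = C * M * ((t * r) * (2 ^ (N + 1) * (X ^ N)⁻¹) +
          K * t * 3 ^ (N + 1) * (X ^ (N + 1))⁻¹) := by
        rw [pow_succ X]; field_simp
    _ ≤ C * M * ((t * r) * (3 ^ (N + 1) * (X ^ N)⁻¹) + K * t * 3 ^ (N + 1) * (X ^ N)⁻¹) := by
        gcongr
        norm_num
    _ = _ := by ring

end KernelEstimate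

/-! ### Pointwise comparison with a multiplication operator. -/

section OperatorEstimate

variable {n : ℕ} {Φ : QuadraticForm ℝ (Cn n)} {ρ : ℝ}

lemma finrank_real_Cn (n : ℕ) : Module.finrank ℝ (Cn n) = 2 * n := by
  rw [finrank_real_of_complex, finrank_euclideanSpace_fin]

lemma norm_exp_phase (x y : Cn n) (h : ℝ) :
    ‖Complex.exp (2 * lam Φ (mid x y) (x - y) / h)‖ =
      Real.exp (Φ x / h) * Real.exp (-Φ y / h) := by
  rw [Complex.norm_exp, Complex.div_ofReal_re, two_lam_mid_re, ← Real.exp_add]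
  congr 1; ring

lemma continuous_phase (x : Cn n) (h : ℝ) :
    Continuous fun y => Complex.exp (2 * lam Φ (mid x y) (x - y) / h) := by
  have h1 := continuous_lam Φ (f := fun y : Cn n => mid x y) (g := fun y => x - y)
    (by unfold mid; fun_prop) (by fun_prop)
  fun_prop

lemma integrable_weyl_integrand {h M : ℝ} {σ u : Cn n → ℂ} (hσ : Continuous σ)
    (hM : ∀ v, ‖σ v‖ ≤ M) (hu : RapidDecay Φ h u) (x : Cn n) :
    Integrable fun y => Complex.exp (2 * lam Φ (mid x y) (x - y) / h) * σ (mid x y) * u y := by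
  refine (hu.integrable.const_mul (Real.exp (Φ x / h) * M)).mono' ?_ (ae_of_all _ fun y => ?_)
  · have h1 := continuous_phase (Φ := Φ) x h
    have h2 : Continuous fun y => mid x y := by unfold mid; fun_prop
    exact ((h1.mul (hσ.comp h2)).mul hu.1.continuous).aestronglyMeasurable
  · rw [norm_mul, norm_mul, norm_exp_phase]
    calc _ ≤ Real.exp (Φ x / h) * Real.exp (-Φ y / h) * M * ‖u y‖ := by gcongr; exact hM _
      _ = _ := by ring

lemma GevreyNorm.norm_le {s M r : ℝ} {σ : Cn n → ℂ} (h : GevreyNorm s M r σ) (v : Cn n) :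
    ‖σ v‖ ≤ M := by simpa using h.2 0 v

lemma GevreyNorm.norm_sub_le {s M r : ℝ} {σ : Cn n → ℂ} (h : GevreyNorm s M r σ) (v w : Cn n) :
    ‖σ w - σ v‖ ≤ M * r * ‖w - v‖ := by
  refine convex_univ.norm_image_sub_le_of_norm_fderiv_le (𝕜 := ℝ)
    (fun z _ => h.1.differentiable (by simp) z) (fun z _ => ?_) (Set.mem_univ v) (Set.mem_univ w)
  have := h.2 1 z
  rw [norm_iteratedFDeriv_one] at this
  simpa using this

/-- The pointwise comparison of the Weyl quantization with multiplication by the shifted symbol,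
in an exponentially weighted form. -/
lemma exists_pointwise_bound (hρ : 0 < ρ) (hR : ∀ v, ρ * ‖v‖ ^ 2 ≤ leviR Φ v v) (N : ℕ)
    {s : ℝ} (hs : 1 ≤ s) :
    ∃ C : ℝ, 0 ≤ C ∧ ∀ (σ u : Cn n → ℂ) (Φ₁ : Cn n → ℝ) (M r t ε K : ℝ) (m : ℕ),
      GevreyNorm s M r σ → 0 ≤ r → 0 < t → t ≤ 1 → t * r ≤ 1 → ε ≤ ρ / 8 → m ≠ 0 →
      Real.exp 1 * (2 ^ (s + 1) * (3 * ε / ρ * r) * (m : ℝ) ^ (s - 1)) ≤ 1 →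
      Real.exp (3 * ε / t ^ 2 - m) ≤ K * t ^ (N + 2) →
      ContDiff ℝ 1 (fun x => Φ₁ x - Φ x) → C11Small (fun x => Φ₁ x - Φ x) ε →
      RapidDecay Φ (t ^ 2) u → ∀ x β : Cn n,
      (∀ v, 2 * leviR Φ v β = fderiv ℝ (fun x => Φ₁ x - Φ x) x v) →
      ‖((∫ y, Complex.exp (2 * lam Φ (mid x y) (x - y) / (t ^ 2 : ℝ)) * σ (mid x y) * u y) -
        taylorShift σ ((1 / 2 : ℝ) • Complex.I • β) m (x + (1 / 2 : ℝ) • β) *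
          (u x * gaussMass Φ 1 (t ^ 2))) * Real.exp (-Φ₁ x / t ^ 2)‖ₑ ≤
        ENNReal.ofReal (C * M * (r + K) * t) *
          ∫⁻ y, ENNReal.ofReal ((1 + ‖x - y‖ / t) ^ N)⁻¹ * ‖weighted Φ₁ (t ^ 2) u y‖ₑ := by
  obtain ⟨C, hC, hker⟩ := exists_weighted_kernel_bound hρ hR N hs
  set d := Module.finrank ℝ (Cn n) with hd
  have hg2 := gaussMass_pos hρ hR (c := 2) (h := 1) two_pos one_pos
  refine ⟨C * (2 ^ d / gaussMass Φ 2 1), by positivity, ?_⟩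
  intro σ u Φ₁ M r t ε K m hσ hr ht ht1 htr hε hm hexp hK hf hfε hu x β hβ
  have hM := hσ.nonneg
  set b := taylorShift σ ((1 / 2 : ℝ) • Complex.I • β) m (x + (1 / 2 : ℝ) • β) with hb
  have hσc := hσ.1.continuous
  have hτc : Continuous fun v => σ v - b := hσc.sub continuous_const
  have hτM : ∀ v, ‖σ v - b‖ ≤ M + ‖b‖ := fun v => (norm_sub_le _ _).trans (by
    gcongr; exact hσ.norm_le v)
  have hK1 := hker σ (fun x => Φ₁ x - Φ x) M r t ε K m hσ hr ht ht1 htr hε hm hexp hK hf hfε x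
  have hform := weyl_integral_eq hρ hR ht hτc hτM hu x β
  -- The symbol `1` acts as the constant `gaussMass Φ 1 h`, so subtracting `b` times it amounts to
  -- replacing the symbol by `σ - b`, with `b` fixed during the integration in `y`.
  have hsub : (∫ y, Complex.exp (2 * lam Φ (mid x y) (x - y) / (t ^ 2 : ℝ)) * σ (mid x y) * u y) -
      b * (u x * gaussMass Φ 1 (t ^ 2)) =
      ∫ y, Complex.exp (2 * lam Φ (mid x y) (x - y) / (t ^ 2 : ℝ)) * (σ (mid x y) - b) * u y := by
    have h1 := integrable_weyl_integrand hσc hσ.norm_le hu x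
    have h2 := integrable_weyl_integrand (σ := fun _ => 1) (M := 1) continuous_const (by simp) hu x
    simp only [mul_one] at h2
    rw [← integral_one_symbol hu x, ← integral_const_mul, ← integral_sub h1 (h2.const_mul b)]
    congr 1; ext y; ring
  have hgt := gaussMass_scale (Φ := Φ) 2 ht
  have hgt0 : (gaussMass Φ 2 (t ^ 2) : ℂ) ≠ 0 := by
    rw [hgt]; exact_mod_cast (by positivity)
  rw [hsub, ← mul_div_cancel_right₀ (∫ y, Complex.exp _ * (σ (mid x y) - b) * u y) hgt0, hform,
    div_mul_eq_mul_div, ← mul_div_assoc', ← integral_mul_const]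
  refine (enorm_integral_le_lintegral_enorm _).trans ?_
  rw [← lintegral_const_mul' _ _ ENNReal.ofReal_ne_top]
  refine lintegral_mono fun y => ?_
  rw [weighted, ← ofReal_norm, ← ofReal_norm,
    ← ENNReal.ofReal_mul (by positivity), ← ENNReal.ofReal_mul' (by positivity)]
  refine ENNReal.ofReal_le_ofReal ?_
  have hexpn : ‖Complex.exp ((leviR Φ β β - 2 * Complex.I * leviR Φ (Complex.I • (x - y)) β) /
      (t ^ 2 : ℝ))‖ = Real.exp (leviR Φ β β / t ^ 2) := by
    rw [Complex.norm_exp, Complex.div_ofReal_re]; simp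
  have hy := hK1 y β hβ
  set J := ‖∫ v, (σ (mid x y + (1 / 2 : ℝ) • β + t • v) - b) *
    oscGauss (leviR Φ) (t⁻¹ • Complex.I • (x - y - β)) v‖ with hJ
  rw [norm_mul, norm_mul, norm_mul, norm_mul, norm_mul, norm_exp_phase, hexpn, norm_div,
    Complex.norm_real, Complex.norm_real, Complex.norm_real, norm_mul, Complex.norm_real, ← hJ,
    Real.norm_of_nonneg (Real.exp_pos _).le, Real.norm_of_nonneg (Real.exp_pos _).le,
    Real.norm_of_nonneg (by positivity), Real.norm_of_nonneg (by rw [hgt]; positivity), hgt]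
  have e1 : Real.exp (Φ x / t ^ 2) * Real.exp (-Φ y / t ^ 2) * Real.exp (leviR Φ β β / t ^ 2) *
      Real.exp (-Φ₁ x / t ^ 2) =
      Real.exp ((Φ₁ y - Φ y - (Φ₁ x - Φ x) + leviR Φ β β) / t ^ 2) *
        Real.exp (-Φ₁ y / t ^ 2) := by
    simp only [← Real.exp_add]
    congr 1; ring
  calc _ = (Real.exp (Φ x / t ^ 2) * Real.exp (-Φ y / t ^ 2) * Real.exp (leviR Φ β β / t ^ 2) *
      Real.exp (-Φ₁ x / t ^ 2)) * (2 ^ d / gaussMass Φ 2 1) * ‖u y‖ * J := by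
        rw [mul_pow, ← hd]; field_simp
    _ = (Real.exp ((Φ₁ y - Φ y - (Φ₁ x - Φ x) + leviR Φ β β) / t ^ 2) * J) *
        (2 ^ d / gaussMass Φ 2 1) * (‖u y‖ * Real.exp (-Φ₁ y / t ^ 2)) := by rw [e1]; ring
    _ ≤ (C * M * (r + K) * t * ((1 + ‖x - y‖ / t) ^ N)⁻¹) *
        (2 ^ d / gaussMass Φ 2 1) * (‖u y‖ * Real.exp (-Φ₁ y / t ^ 2)) := by gcongr
    _ = _ := by ring

end OperatorEstimate

/-! ### The order of the Taylor expansion. -/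

section Parameters

/-- With `m ≈ 2 h^{-1/s}` the exponentials `exp (c h^{-1/s} - m)` beat every power of `h`. -/
lemma exists_order {s : ℝ} (hs : 1 < s) (N : ℕ) {A : ℝ} (hA : 0 ≤ A) :
    ∃ K : ℝ, 0 < K ∧ ∀ C₁ h : ℝ, 3 ≤ C₁ → A * 2 ^ (s - 1) ≤ C₁ → 0 < h → h ≤ 1 →
      ∃ m : ℕ, m ≠ 0 ∧ A * (C₁⁻¹ * h ^ (1 - 1 / s)) * (m : ℝ) ^ (s - 1) ≤ 1 ∧
        Real.exp (3 * (C₁⁻¹ * h ^ (1 - 1 / s)) / h - m) ≤ K * Real.sqrt h ^ N := by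
  -- With `z = h^(-1/s)`, `e^{-z}` is at most `k! z^{-k} = k! h^(k/s)`, which is below the required
  -- power `h^(N/2)` for this `k`.
  set k : ℕ := ⌈s * N⌉₊ with hk
  have hs0 : 0 < s := by linarith
  refine ⟨Real.exp 1 * k.factorial, by positivity, fun C₁ h hC₁ hAC hh hh1 => ?_⟩
  have hC0 : 0 < C₁ := by linarith
  set z : ℝ := h ^ (-(1 / s)) with hz
  have hz0 : 0 < z := by positivity
  have hz1 : 1 ≤ z := Real.one_le_rpow_of_pos_of_le_one_of_nonpos hh hh1 (by
    rw [neg_nonpos]; positivity)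
  have hm1 : (⌊2 * z⌋₊ : ℝ) ≤ 2 * z := Nat.floor_le (by positivity)
  have hm2 : 2 * z - 1 < (⌊2 * z⌋₊ : ℝ) := by have := Nat.lt_floor_add_one (2 * z); linarith
  refine ⟨⌊2 * z⌋₊, ?_, ?_, ?_⟩
  · intro h0
    rw [h0] at hm2
    norm_num at hm2
    linarith
  · have h1 : (⌊2 * z⌋₊ : ℝ) ^ (s - 1) ≤ 2 ^ (s - 1) * z ^ (s - 1) := by
      rw [← Real.mul_rpow (by norm_num) hz0.le]
      exact Real.rpow_le_rpow (by positivity) hm1 (by linarith)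
    -- The balance behind the size of the perturbation: `1 - 1/s = (s-1)/s`.
    have h2 : h ^ (1 - 1 / s) * z ^ (s - 1) = 1 := by
      rw [hz, ← Real.rpow_mul hh.le, ← Real.rpow_add hh]
      rw [show 1 - 1 / s + -(1 / s) * (s - 1) = 0 by field_simp; ring, Real.rpow_zero]
    calc _ ≤ A * (C₁⁻¹ * h ^ (1 - 1 / s)) * (2 ^ (s - 1) * z ^ (s - 1)) := by gcongr
      _ = A * 2 ^ (s - 1) * C₁⁻¹ * (h ^ (1 - 1 / s) * z ^ (s - 1)) := by ring
      _ = A * 2 ^ (s - 1) / C₁ := by rw [h2]; ring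
      _ ≤ 1 := by rw [div_le_one hC0]; exact hAC
  · have h1 : 3 * (C₁⁻¹ * h ^ (1 - 1 / s)) / h ≤ z := by
      have h2 : h ^ (1 - 1 / s) / h = z := by
        rw [hz, sub_eq_add_neg, Real.rpow_add hh, Real.rpow_one]; field_simp
      calc _ = 3 * C₁⁻¹ * (h ^ (1 - 1 / s) / h) := by ring
        _ = 3 / C₁ * z := by rw [h2]; ring
        _ ≤ 1 * z := by gcongr; rw [div_le_one hC0]; exact hC₁
        _ = z := one_mul z
    have h3 : z ^ k / k.factorial ≤ Real.exp z := Real.pow_div_factorial_le_exp z hz0.le k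
    have h4 : (z ^ k)⁻¹ ≤ Real.sqrt h ^ N := by
      rw [hz, ← Real.rpow_mul_natCast hh.le, ← Real.rpow_neg hh.le, neg_mul, neg_neg,
        Real.sqrt_eq_rpow, ← Real.rpow_mul_natCast hh.le]
      refine Real.rpow_le_rpow_of_exponent_ge hh hh1 ?_
      have h5 : s * N ≤ k := Nat.le_ceil _
      have h6 : (0 : ℝ) ≤ N := by positivity
      rw [show 1 / s * (k : ℝ) = k / s by ring, le_div_iff₀ hs0]
      nlinarith
    calc _ ≤ Real.exp (1 + -z) := Real.exp_le_exp.2 (by linarith)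
      _ = Real.exp 1 * (Real.exp z)⁻¹ := by rw [Real.exp_add, Real.exp_neg]
      _ ≤ Real.exp 1 * (z ^ k / k.factorial)⁻¹ := by gcongr
      _ = Real.exp 1 * k.factorial * (z ^ k)⁻¹ := by rw [inv_div]; ring
      _ ≤ _ := by gcongr

end Parameters

/-! ### Weighted `L²` comparison with a multiplication operator. -/

section OperatorEstimate

variable {n : ℕ} {Φ : QuadraticForm ℝ (Cn n)} {ρ : ℝ}

/-- The constant by which the symbol `1` acts. -/
def unitConst (Φ : QuadraticForm ℝ (Cn n)) : ℂ :=
  (1 / (2 * Real.pi) ^ n : ℝ) * contourConst Φ * gaussMass Φ 1 1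

lemma unitConst_ne_zero (hΦ : StrictlyPSH Φ) : unitConst Φ ≠ 0 := by
  obtain ⟨ρ, hρ, hR⟩ := exists_leviR_coercive hΦ
  have h1 := gaussMass_pos hρ hR (c := 1) (h := 1) one_pos one_pos
  refine mul_ne_zero (mul_ne_zero ?_ (contourConst_ne_zero hΦ)) (by exact_mod_cast h1.ne')
  have : 0 < 1 / (2 * Real.pi) ^ n := by positivity
  exact_mod_cast this.ne'

lemma lintegral_decay (N : ℕ) (hN : Module.finrank ℝ (Cn n) < N) :
    ∃ I : ℝ, 0 ≤ I ∧ ∀ t : ℝ, 0 < t → ∫⁻ x : Cn n, ENNReal.ofReal ((1 + ‖x‖ / t) ^ N)⁻¹ =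
      ENNReal.ofReal (t ^ Module.finrank ℝ (Cn n) * I) := by
  have hI := integrable_one_add_norm (E := Cn n) (μ := volume) (r := N) (by exact_mod_cast hN)
  simp only [Real.rpow_neg (show (0 : ℝ) ≤ 1 + ‖(_ : Cn n)‖ by positivity),
    Real.rpow_natCast] at hI
  refine ⟨∫ x : Cn n, ((1 + ‖x‖) ^ N)⁻¹, integral_nonneg fun x => by positivity, fun t ht => ?_⟩
  have e : ∀ x : Cn n, ((1 + ‖x‖ / t) ^ N)⁻¹ = ((1 + ‖t⁻¹ • x‖) ^ N)⁻¹ := fun x => by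
    rw [norm_smul, norm_inv, Real.norm_of_nonneg ht.le, inv_mul_eq_div]
  simp only [e]
  rw [← ofReal_integral_eq_lintegral_ofReal (hI.comp_smul (inv_ne_zero ht.ne'))
    (ae_of_all _ fun x => by positivity),
    Measure.integral_comp_smul volume (fun x : Cn n => ((1 + ‖x‖) ^ N)⁻¹) t⁻¹, smul_eq_mul]
  congr 2
  rw [abs_of_pos (by positivity), inv_pow, inv_inv]

/-- Weighted `L²` comparison of the Weyl quantization with multiplication by an approximate
value of the symbol. -/
theorem exists_operator_bound (hΦ : StrictlyPSH Φ) {s : ℝ} (hs : 1 < s) {a : Lambda Φ → ℂ}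
    {M r : ℝ} (hr : 0 < r) (hσ : GevreyNorm s M r fun x => a (lift Φ x)) :
    ∃ C₁ : ℝ, 0 < C₁ ∧ ∃ K : ℝ, 0 < K ∧ ∃ h₁ : ℝ, 0 < h₁ ∧ h₁ ≤ 1 ∧
      ∀ h : ℝ, 0 < h → h < h₁ → ∀ Φ₁ : Cn n → ℝ, ContDiff ℝ 1 (fun x => Φ₁ x - Φ x) →
      C11Small (fun x => Φ₁ x - Φ x) (C₁⁻¹ * h ^ (1 - 1 / s)) →
      ∃ b : Cn n → ℂ, (∀ x, ‖b x - a (lift Φ x)‖ ≤ K * h ^ (1 - 1 / s)) ∧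
        ∀ u, RapidDecay Φ h u → ∀ S : Set (Cn n),
          eLpNorm (fun x => (weylGamma Φ a h u x - unitConst Φ * b x * u x) *
            (Real.exp (-Φ₁ x / h) : ℂ)) 2 (volume.restrict S) ≤
          ENNReal.ofReal (K * Real.sqrt h) * eLpNorm (weighted Φ₁ h u) 2 volume := by
  obtain ⟨ρ, hρ, hR⟩ := exists_leviR_coercive hΦ
  set d := Module.finrank ℝ (Cn n) with hd
  -- Decay of order `d + 1`, with `d` the real dimension, makes the kernel integrable.
  obtain ⟨C, hC, hpt⟩ := exists_pointwise_bound hρ hR (d + 1) hs.le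
  obtain ⟨I, hI, hdec⟩ := lintegral_decay (n := n) (d + 1) (Nat.lt_succ_self _)
  have hM := hσ.nonneg
  set A : ℝ := Real.exp 1 * (2 ^ (s + 1) * (3 / ρ * r)) with hA
  obtain ⟨K₀, hK₀, hord⟩ := exists_order hs (d + 1 + 2) (A := A) (by positivity)
  -- The three terms ensure respectively `3ε/h ≤ h^(-1/s)`, convergence of the truncated Taylor sums
  -- at order `m`, and `ε ≤ ρ/8`. The bound `(r²)⁻¹` for `h` below gives `t r ≤ 1`.
  set C₁ : ℝ := 3 + A * 2 ^ (s - 1) + 8 / ρ with hC₁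
  have hC₁0 : 0 < C₁ := by positivity
  set K₁ : ℝ := ‖contourConst Φ‖ * (1 / (2 * Real.pi) ^ n) * (C * M * (r + K₀)) * I with hK₁
  have hK₁0 : 0 ≤ K₁ := by positivity
  set K₂ : ℝ := 9 * M * r / (4 * ρ) * C₁⁻¹ with hK₂
  have hK₂0 : 0 ≤ K₂ := by positivity
  refine ⟨C₁, hC₁0, K₁ + K₂ + 1, by positivity, min 1 ((r ^ 2)⁻¹), by positivity, min_le_left _ _,
    fun h hh hh1 Φ₁ hf hfε => ?_⟩
  have hh1' : h ≤ 1 := (hh1.trans_le (min_le_left _ _)).le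
  obtain ⟨m, hm, hm1, hm2⟩ := hord C₁ h (by rw [hC₁]; have : 0 ≤ A * 2 ^ (s - 1) := by positivity
                                            have : 0 ≤ 8 / ρ := by positivity
                                            linarith)
    (by rw [hC₁]; have : 0 ≤ 8 / ρ := by positivity
        linarith) hh hh1'
  set ε := C₁⁻¹ * h ^ (1 - 1 / s) with hε
  have hε0 : 0 ≤ ε := by positivity
  have hs1 : 0 ≤ 1 - 1 / s := by
    rw [sub_nonneg, div_le_one (by linarith)]; exact hs.le
  have hερ : ε ≤ ρ / 8 := by
    have h1 : h ^ (1 - 1 / s) ≤ 1 := Real.rpow_le_one hh.le hh1' hs1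
    have h2 : 8 / ρ ≤ C₁ := by
      rw [hC₁]; have : 0 ≤ A * 2 ^ (s - 1) := by positivity
      linarith
    calc ε ≤ C₁⁻¹ * 1 := by rw [hε]; gcongr
      _ ≤ (8 / ρ)⁻¹ := by rw [mul_one]; gcongr
      _ = ρ / 8 := inv_div _ _
  set t := Real.sqrt h with ht
  have ht0 : 0 < t := Real.sqrt_pos.2 hh
  have ht2 : t ^ 2 = h := Real.sq_sqrt hh.le
  have ht1 : t ≤ 1 := Real.sqrt_le_one.2 hh1'
  have htr : t * r ≤ 1 := by
    have h1 : (t * r) ^ 2 ≤ 1 := by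
      rw [mul_pow, ht2]
      have h2 := (hh1.trans_le (min_le_right _ _)).le
      calc h * r ^ 2 ≤ (r ^ 2)⁻¹ * r ^ 2 := by gcongr
        _ = 1 := inv_mul_cancel₀ (by positivity)
    exact (sq_le_one_iff₀ (by positivity)).1 h1
  have hexp : Real.exp 1 * (2 ^ (s + 1) * (3 * ε / ρ * r) * (m : ℝ) ^ (s - 1)) ≤ 1 :=
    (le_of_eq (by rw [hA]; ring)).trans hm1
  choose β hβ using fun x => exists_leviR_dual hρ hR (fderiv ℝ (fun x => Φ₁ x - Φ x) x)
  have hβn : ∀ x, ‖β x‖ ≤ ε / (2 * ρ) := fun x =>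
    norm_le_of_leviR_dual hρ hR (hβ x) (hfε.2.1 x)
  refine ⟨fun x => taylorShift (fun x => a (lift Φ x)) ((1 / 2 : ℝ) • Complex.I • β x) m
    (x + (1 / 2 : ℝ) • β x), fun x => ?_, fun u hu S => ?_⟩
  · have hn : ‖(1 / 2 : ℝ) • Complex.I • β x‖ = 1 / 2 * ‖β x‖ := by
      rw [norm_smul, norm_smul, Complex.norm_I]; norm_num
    have hn' : ‖(1 / 2 : ℝ) • β x‖ = 1 / 2 * ‖β x‖ := by rw [norm_smul]; norm_num
    have h1 := hσ.taylorShift_sub_le hs.le hr.le (η := (1 / 2 : ℝ) • Complex.I • β x) (η' := 0)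
      (δ := 3 * ε / ρ * r) (n := m)
      (by
        rw [hn]
        gcongr
        calc 1 / 2 * ‖β x‖ ≤ 1 / 2 * (ε / (2 * ρ)) := by gcongr; exact hβn x
          _ = 1 / 4 * ε / ρ := by ring
          _ ≤ 3 * ε / ρ := by gcongr; norm_num)
      (by rw [norm_zero, zero_mul]; positivity)
      (le_trans (le_mul_of_one_le_left (by positivity) (Real.one_le_exp zero_le_one)) hexp)
      (x + (1 / 2 : ℝ) • β x)
    rw [taylorShift_zero _ _ hm, sub_zero, hn] at h1
    have h2 := hσ.norm_sub_le x (x + (1 / 2 : ℝ) • β x)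
    rw [add_sub_cancel_left, hn'] at h2
    calc _ ≤ 8 * (M * r * (1 / 2 * ‖β x‖)) + M * r * (1 / 2 * ‖β x‖) := by
          refine (norm_sub_le_norm_sub_add_norm_sub _ _ _).trans (add_le_add h1 h2)
      _ ≤ 8 * (M * r * (1 / 2 * (ε / (2 * ρ)))) + M * r * (1 / 2 * (ε / (2 * ρ))) := by
          gcongr <;> exact hβn x
      _ = K₂ * h ^ (1 - 1 / s) := by rw [hK₂, hε]; ring
      _ ≤ _ := by gcongr; linarith
  · have hΦ₁c : Continuous Φ₁ :=
      (hf.continuous.add (continuous_quadForm Φ)).congr fun x => by simp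
    have hwm : AEStronglyMeasurable (weighted Φ₁ h u) volume := by
      have := hu.1.continuous
      unfold weighted
      exact Continuous.aestronglyMeasurable (by fun_prop)
    have hth : h ^ n = t ^ d := by rw [hd, finrank_real_Cn, pow_mul, ht2]
    have hgm : (gaussMass Φ 1 h : ℂ) = t ^ d * gaussMass Φ 1 1 := by
      rw [← ht2, gaussMass_scale 1 ht0]; push_cast; rfl
    have hpref : ((1 / (2 * Real.pi * h) ^ n : ℝ) : ℂ) = (1 / (2 * Real.pi) ^ n : ℝ) / t ^ d := by
      rw [mul_pow, hth]; push_cast; field_simp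
    have htC : (t : ℂ) ^ d ≠ 0 := pow_ne_zero _ (by exact_mod_cast ht0.ne')
    have key : ∀ x, ‖(weylGamma Φ a h u x - unitConst Φ *
        taylorShift (fun x => a (lift Φ x)) ((1 / 2 : ℝ) • Complex.I • β x) m
          (x + (1 / 2 : ℝ) • β x) * u x) * (Real.exp (-Φ₁ x / h) : ℂ)‖ₑ ≤
        ENNReal.ofReal (‖contourConst Φ‖ * (1 / (2 * Real.pi) ^ n) / t ^ d *
          (C * M * (r + K₀) * t)) *
          ∫⁻ y, ENNReal.ofReal ((1 + ‖x - y‖ / t) ^ (d + 1))⁻¹ * ‖weighted Φ₁ h u y‖ₑ := by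
      intro x
      have hx := hpt (fun x => a (lift Φ x)) u Φ₁ M r t ε K₀ m hσ hr.le ht0 ht1 htr hερ hm hexp
        (by rw [ht2]; exact hm2) hf hfε (by rw [ht2]; exact hu) x (β x) (hβ x)
      rw [ht2] at hx
      set b := taylorShift (fun x => a (lift Φ x)) ((1 / 2 : ℝ) • Complex.I • β x) m
          (x + (1 / 2 : ℝ) • β x)
      have e1 : (weylGamma Φ a h u x - unitConst Φ * b * u x) * (Real.exp (-Φ₁ x / h) : ℂ) =
          (contourConst Φ * (1 / (2 * Real.pi) ^ n : ℝ) / t ^ d) *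
          (((∫ y, Complex.exp (2 * lam Φ (mid x y) (x - y) / h) * a (lift Φ (mid x y)) * u y) -
            b * (u x * gaussMass Φ 1 h)) * Real.exp (-Φ₁ x / h)) := by
        rw [weylGamma_eq, hpref, hgm, unitConst]
        field_simp
      have e2 : ‖contourConst Φ * (1 / (2 * Real.pi) ^ n : ℝ) / (t : ℂ) ^ d‖ =
          ‖contourConst Φ‖ * (1 / (2 * Real.pi) ^ n) / t ^ d := by
        rw [norm_div, norm_mul, Complex.norm_real, norm_pow, Complex.norm_real,
          Real.norm_of_nonneg (by positivity), Real.norm_of_nonneg ht0.le]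
      rw [e1, enorm_mul, ← ofReal_norm (contourConst Φ * _ / _), e2,
        ENNReal.ofReal_mul (by positivity), mul_assoc]
      gcongr
    -- The mass of the kernel is proportional to `t^d` and cancels the normalization `t^{-d}` of the
    -- quantization; the factor `t = √h` gained in the kernel remains.
    refine (eLpNorm_le_of_conv_le (g := fun p => ENNReal.ofReal ((1 + ‖p‖ / t) ^ (d + 1))⁻¹)
      (by fun_prop) hwm key).trans ?_
    rw [hdec t ht0, ← hd, ← ENNReal.ofReal_mul (by positivity)]
    refine mul_le_mul' (ENNReal.ofReal_le_ofReal ?_) le_rfl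
    calc _ = K₁ * t := by rw [hK₁]; field_simp
      _ ≤ _ := by gcongr; linarith

end OperatorEstimate

/-! ### The Bergman projection: density of rapid decay and completeness. -/

section Projection

variable {n : ℕ} {Φ : QuadraticForm ℝ (Cn n)} {ρ h : ℝ}

/-- The Bergman kernel, acting on functions weighted by `e^{-Φ/h}`. -/
def bergKernel (Φ : QuadraticForm ℝ (Cn n)) (h : ℝ) (x y : Cn n) : ℂ :=
  Complex.exp ((holQ Φ x - holQ Φ y + 2 * lev Φ y x - 2 * leviR Φ y y + Φ y) / h)

/-- The definition displays holomorphy in `x`; this form displays the kernel of `reproducing` with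
`c = 2` and `β = 0`. -/
lemma bergKernel_eq (x y : Cn n) : bergKernel Φ h x y * (Real.exp (-Φ y / h) : ℂ) =
    Complex.exp (-(2 * lam Φ x (y - x) + holQ Φ (y - x) + 2 * lev Φ 0 (y - x)) / h) *
      Complex.exp (-((2 : ℝ) * leviR Φ (y - x) (y - x)) / h) := by
  rw [bergKernel, Complex.ofReal_exp, ← Complex.exp_add, ← Complex.exp_add]
  congr 1
  have h1 := lam_sub_lam Φ y x
  have h2 : leviR Φ y (Complex.I • x) = leviR Φ (Complex.I • x) y := leviR_symm Φ _ _
  have h3 : leviR Φ y x = leviR Φ x y := leviR_symm Φ _ _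
  have h4 : lev Φ 0 (y - x) = 0 := by simp [lev_apply]
  push_cast
  rw [← add_div, ← add_div, h4]
  congr 1
  simp only [holQ, map_sub, sub_apply, lev_apply, h2, h3]
  have h5 : ∀ t, lam Φ (y - x) t = lam Φ y t - lam Φ x t := fun t => by
    simp only [lam_apply, map_sub, sub_apply]; push_cast; ring
  rw [h5, h5]
  push_cast
  linear_combination -h1

lemma norm_bergKernel (x y : Cn n) : ‖bergKernel Φ h x y‖ =
    Real.exp (Φ x / h) * Real.exp (-leviR Φ (x - y) (x - y) / h) := by
  have h1 := norm_kernel_eq (Φ := Φ) (fun _ => 1) x (y - x) 0 2 h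
  simp only [one_mul, norm_one, add_sub_cancel] at h1
  have h2 := bergKernel_eq (Φ := Φ) (h := h) x y
  have h3 := congrArg norm h2
  rw [norm_mul, Complex.norm_real, Real.norm_of_nonneg (Real.exp_pos _).le] at h3
  rw [h1] at h3
  have h4 : leviR Φ (x - y) (x - y) = leviR Φ (y - x) (y - x) := by
    rw [← neg_sub y x, map_neg, map_neg, neg_apply, neg_neg]
  rw [h4]
  have h5 := Real.exp_pos (-Φ y / h)
  have h6 : ((1 - 2) * leviR Φ (y - x) (y - x) - 2 * leviR Φ 0 (y - x)) / h =
    -leviR Φ (y - x) (y - x) / h := by rw [map_zero, zero_apply]; ring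
  rw [h6] at h3
  refine mul_right_cancel₀ h5.ne' (h3.trans ?_)
  ring

lemma differentiable_bergKernel (y : Cn n) : Differentiable ℂ fun x => bergKernel Φ h x y := by
  unfold bergKernel
  have h1 := differentiable_holQ Φ
  have h2 := (lev Φ y).differentiable
  fun_prop

lemma continuous_bergKernel (x : Cn n) : Continuous fun y => bergKernel Φ h x y := by
  unfold bergKernel
  have h1 := continuous_holQ Φ
  have h2 : Continuous fun y : Cn n => lev Φ y x := by
    simp only [lev_apply]
    have h3 := continuous_leviR Φ (f := fun y : Cn n => y) (g := fun _ => x) continuous_id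
      continuous_const
    have h4 := continuous_leviR Φ (f := fun y : Cn n => y) (g := fun _ => Complex.I • x)
      continuous_id continuous_const
    fun_prop
  have h3 := continuous_leviR Φ (f := fun z : Cn n => z) continuous_id continuous_id
  have h4 := continuous_quadForm Φ
  fun_prop

/-- The Bergman projection of `g e^{Φ/h}`. -/
def bergProj (Φ : QuadraticForm ℝ (Cn n)) (h : ℝ) (g : Cn n → ℂ) (x : Cn n) : ℂ :=
  (gaussMass Φ 2 h : ℂ)⁻¹ * ∫ y, bergKernel Φ h x y * g y

lemma memLp_gauss (hρ : 0 < ρ) (hR : ∀ v, ρ * ‖v‖ ^ 2 ≤ leviR Φ v v) {c : ℝ} (hc : 0 < c)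
    (x : Cn n) : MemLp (fun y => Real.exp (-c * leviR Φ (x - y) (x - y))) 2 volume := by
  have hcont : Continuous fun y => Real.exp (-c * leviR Φ (x - y) (x - y)) := by
    have := continuous_leviR Φ (f := fun y : Cn n => x - y) (g := fun y => x - y)
      (by fun_prop) (by fun_prop)
    fun_prop
  rw [memLp_two_iff_integrable_sq hcont.aestronglyMeasurable]
  have h1 := integrable_gauss_linear hρ hR (c := 2 * c) (by positivity) 0
  refine (h1.comp_sub_left x).congr (ae_of_all _ fun y => ?_)
  simp only [zero_apply, add_zero]
  rw [← Real.exp_nat_mul]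
  congr 1
  push_cast; ring

lemma integrable_bergKernel_mul (hρ : 0 < ρ) (hR : ∀ v, ρ * ‖v‖ ^ 2 ≤ leviR Φ v v) (hh : 0 < h)
    {g : Cn n → ℂ} (hg : MemLp g 2 volume) (x : Cn n) :
    Integrable fun y => bergKernel Φ h x y * g y := by
  have h1 := memLp_gauss hρ hR (c := 1 / h) (by positivity) x
  have h2 := (h1.integrable_mul hg.norm).const_mul (Real.exp (Φ x / h))
  refine h2.mono' ((continuous_bergKernel x).aestronglyMeasurable.mul hg.1)
    (ae_of_all _ fun y => le_of_eq ?_)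
  rw [norm_mul, norm_bergKernel, Pi.mul_apply, mul_assoc]
  congr 3; ring

lemma bergProj_sub (hρ : 0 < ρ) (hR : ∀ v, ρ * ‖v‖ ^ 2 ≤ leviR Φ v v) (hh : 0 < h)
    {g g' : Cn n → ℂ} (hg : MemLp g 2 volume) (hg' : MemLp g' 2 volume) :
    bergProj Φ h (g - g') = bergProj Φ h g - bergProj Φ h g' := by
  ext x
  simp only [bergProj, Pi.sub_apply]
  rw [← mul_sub, ← integral_sub (integrable_bergKernel_mul hρ hR hh hg x)
    (integrable_bergKernel_mul hρ hR hh hg' x)]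
  congr 2; ext y; ring

lemma bergProj_weighted (hρ : 0 < ρ) (hR : ∀ v, ρ * ‖v‖ ^ 2 ≤ leviR Φ v v) (hh : 0 < h)
    {u : Cn n → ℂ} (hu : MemH Φ h u) : bergProj Φ h (weighted Φ h u) = u := by
  ext x
  have hgm := gaussMass_pos hρ hR (c := 2) two_pos hh
  have h1 := reproducing (Φ := Φ) hu.1 x 0 2 h (by
    have h2 := memLp_gauss hρ hR (c := 1 / h) (by positivity) (0 : Cn n)
    have h3 : MemLp (fun z => weighted Φ h u (x + z)) 2 volume :=
      hu.2.comp_measurePreserving (measurePreserving_add_left volume x)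
    refine (h3.norm.integrable_mul h2).congr (ae_of_all _ fun z => ?_)
    simp only [Pi.mul_apply, weighted, norm_mul, Complex.norm_real,
      Real.norm_of_nonneg (Real.exp_pos _).le, zero_sub, map_neg, neg_apply, neg_neg, map_zero,
      zero_apply, mul_zero, sub_zero]
    congr 2; ring)
  have h2 : ∫ y, bergKernel Φ h x y * weighted Φ h u y = u x * gaussMass Φ 2 h := by
    rw [← h1, ← integral_add_left_eq_self _ x]
    congr 1; ext z
    have := bergKernel_eq (Φ := Φ) (h := h) x (x + z)
    rw [add_sub_cancel_left] at this
    rw [weighted, mul_left_comm, this]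
    ring
  have hg : (gaussMass Φ 2 h : ℂ) ≠ 0 := by exact_mod_cast hgm.ne'
  rw [bergProj, h2, mul_comm, mul_assoc, mul_inv_cancel₀ hg, mul_one]

lemma eLpNorm_bergProj_le (hρ : 0 < ρ) (hR : ∀ v, ρ * ‖v‖ ^ 2 ≤ leviR Φ v v) (hh : 0 < h) :
    ∃ C : ℝ≥0∞, C ≠ ⊤ ∧ ∀ g : Cn n → ℂ, AEStronglyMeasurable g volume →
      eLpNorm (weighted Φ h (bergProj Φ h g)) 2 volume ≤ C * eLpNorm g 2 volume := by
  have hgm := gaussMass_pos hρ hR (c := 2) two_pos hh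
  have hI := integrable_gaussMass hρ hR one_pos hh
  refine ⟨‖(gaussMass Φ 2 h : ℂ)⁻¹‖ₑ * ∫⁻ z, ‖Real.exp (-(1 * leviR Φ z z) / h)‖ₑ,
    ENNReal.mul_ne_top enorm_ne_top hI.2.ne, fun g hg => ?_⟩
  have hcont : Continuous fun z => Real.exp (-(1 * leviR Φ z z) / h) := by
    have := continuous_leviR Φ (f := fun y : Cn n => y) (g := fun y => y) continuous_id
      continuous_id
    fun_prop
  have key := eLpNorm_le_of_conv_le (μ := (volume : Measure (Cn n))) (S := Set.univ)
    (φ := weighted Φ h (bergProj Φ h g)) (w := g)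
    (g := fun z => ‖Real.exp (-(1 * leviR Φ z z) / h)‖ₑ) (c := ‖(gaussMass Φ 2 h : ℂ)⁻¹‖ₑ)
    hcont.measurable.enorm hg (fun x => by
      rw [weighted, bergProj, mul_assoc, enorm_mul, ← integral_mul_const]
      gcongr
      refine (enorm_integral_le_lintegral_enorm _).trans (lintegral_mono fun y => ?_)
      rw [enorm_mul, enorm_mul, mul_right_comm, ← enorm_mul]
      gcongr
      refine le_of_eq ?_
      rw [← ofReal_norm, ← ofReal_norm, norm_mul, norm_bergKernel, Complex.norm_real,
        Real.norm_of_nonneg (Real.exp_pos _).le, Real.norm_of_nonneg (Real.exp_pos _).le,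
        ← Real.exp_add, ← Real.exp_add]
      congr 2; ring)
  rwa [Measure.restrict_univ] at key

lemma differentiable_bergProj (hρ : 0 < ρ) (hR : ∀ v, ρ * ‖v‖ ^ 2 ≤ leviR Φ v v) (hh : 0 < h)
    {g : Cn n → ℂ} (hg : MemLp g 2 volume) : Differentiable ℂ (bergProj Φ h g) := by
  unfold bergProj
  refine (differentiable_integral_of_locally_dominated (ν := volume)
    (F := fun x y => bergKernel Φ h x y * g y)
    (fun x => (continuous_bergKernel x).aestronglyMeasurable.mul hg.1)
    (fun y => (differentiable_bergKernel y).mul_const _) fun x₀ => ?_).const_mul _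
  obtain ⟨A, hA⟩ := (isCompact_closedBall x₀ 1).exists_bound_of_continuousOn
    (continuous_quadForm Φ).continuousOn
  obtain ⟨B, hB⟩ := (isCompact_closedBall (0 : Cn n) 1).exists_bound_of_continuousOn
    (continuous_leviR Φ (f := fun z : Cn n => z) continuous_id continuous_id).continuousOn
  have h1 := memLp_gauss hρ hR (c := 1 / (2 * h)) (by positivity) x₀
  refine ⟨1, one_pos, _, (h1.integrable_mul hg.norm).const_mul (Real.exp ((A + B) / h)),
    fun x hx y => ?_⟩
  rw [norm_mul, norm_bergKernel, Pi.mul_apply, ← mul_assoc, ← Real.exp_add, ← Real.exp_add]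
  refine mul_le_mul_of_nonneg_right (Real.exp_le_exp.2 ?_) (norm_nonneg _)
  have h2 : Φ x ≤ A := (le_abs_self _).trans (hA x (Metric.ball_subset_closedBall hx))
  have h3 : leviR Φ (x₀ - x) (x₀ - x) ≤ B := (le_abs_self _).trans (hB _ (by
    rw [mem_closedBall_zero_iff, norm_sub_rev, ← dist_eq_norm]; exact (Metric.mem_ball.1 hx).le))
  -- Gaussians centred at nearby points are compared by the parallelogram inequality, at the price
  -- of half the rate; this yields a majorant uniform for `x` near `x₀`.
  have h4 : leviR Φ (x₀ - y) (x₀ - y) ≤ 2 * leviR Φ (x₀ - x) (x₀ - x) +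
      2 * leviR Φ (x - y) (x - y) := by
    have h5 := hR ((x₀ - x) - (x - y))
    have h6 : 0 ≤ leviR Φ ((x₀ - x) - (x - y)) ((x₀ - x) - (x - y)) :=
      (by positivity : 0 ≤ ρ * ‖(x₀ - x) - (x - y)‖ ^ 2).trans h5
    have h7 : x₀ - y = (x₀ - x) + (x - y) := by abel
    have h8 := leviR_symm Φ (x₀ - x) (x - y)
    rw [h7]
    set a := x₀ - x
    set b := x - y
    simp only [map_sub, map_add, sub_apply, add_apply] at h6 ⊢
    linarith
  rw [show Φ x / h + -leviR Φ (x - y) (x - y) / h = (Φ x - leviR Φ (x - y) (x - y)) / h by ring,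
    show (A + B) / h + -(1 / (2 * h)) * leviR Φ (x₀ - y) (x₀ - y) =
      (A + B - leviR Φ (x₀ - y) (x₀ - y) / 2) / h by field_simp; ring]
  refine div_le_div_of_nonneg_right ?_ hh.le
  linarith

lemma memH_bergProj (hρ : 0 < ρ) (hR : ∀ v, ρ * ‖v‖ ^ 2 ≤ leviR Φ v v) (hh : 0 < h)
    {g : Cn n → ℂ} (hg : MemLp g 2 volume) : MemH Φ h (bergProj Φ h g) := by
  have hd := differentiable_bergProj hρ hR hh hg
  obtain ⟨C, hC, hb⟩ := eLpNorm_bergProj_le hρ hR hh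
  refine ⟨hd, ?_, (hb g hg.1).trans_lt (ENNReal.mul_lt_top hC.lt_top hg.2)⟩
  have h1 := hd.continuous
  have h2 := continuous_quadForm Φ
  unfold weighted
  exact Continuous.aestronglyMeasurable (by fun_prop)

lemma exists_pow_mul_gauss_le {c : ℝ} (hc : 0 < c) (N : ℕ) :
    ∃ C : ℝ, 0 ≤ C ∧ ∀ t : ℝ, 0 ≤ t → (1 + t) ^ N * Real.exp (-c * t ^ 2) ≤ C := by
  refine ⟨N.factorial * Real.exp (1 + 1 / (4 * c)), by positivity, fun t ht => ?_⟩
  have h1 := Real.pow_div_factorial_le_exp (1 + t) (by positivity) N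
  rw [div_le_iff₀ (by positivity)] at h1
  calc _ ≤ Real.exp (1 + t) * N.factorial * Real.exp (-c * t ^ 2) := by gcongr
    _ = N.factorial * Real.exp (1 + t + -c * t ^ 2) := by rw [Real.exp_add (1 + t)]; ring
    _ ≤ _ := by
      gcongr N.factorial * Real.exp ?_
      have : 0 ≤ (2 * c * t - 1) ^ 2 / (4 * c) := by positivity
      have e : (2 * c * t - 1) ^ 2 / (4 * c) = c * t ^ 2 - t + 1 / (4 * c) := by field_simp; ring
      linarith

lemma rapidDecay_bergProj (hρ : 0 < ρ) (hR : ∀ v, ρ * ‖v‖ ^ 2 ≤ leviR Φ v v) (hh : 0 < h)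
    {g : Cn n → ℂ} (hg : Continuous g) (hgs : HasCompactSupport g) :
    RapidDecay Φ h (bergProj Φ h g) := by
  refine ⟨differentiable_bergProj hρ hR hh (hg.memLp_of_hasCompactSupport hgs), fun N => ?_⟩
  obtain ⟨k, hk⟩ := hgs.isCompact.isBounded.exists_norm_le
  have hk' : ∀ y, g y ≠ 0 → ‖y‖ ≤ |k| := fun y hy =>
    (hk y (subset_tsupport g hy)).trans (le_abs_self k)
  obtain ⟨C, hC, hCN⟩ := exists_pow_mul_gauss_le (c := ρ / h) (by positivity) N
  have hI := (hg.integrable_of_hasCompactSupport hgs (μ := volume)).norm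
  refine ⟨‖(gaussMass Φ 2 h : ℂ)⁻¹‖ * ((1 + |k|) ^ N * C * ∫ y, ‖g y‖), fun x => ?_⟩
  have hs0 : 0 < Real.sqrt (1 + ‖x‖ ^ 2) ^ N := by positivity
  rw [bergProj, norm_mul]
  have h1 : ‖∫ y, bergKernel Φ h x y * g y‖ ≤
      ∫ y, ((1 + |k|) ^ N * C * (Real.sqrt (1 + ‖x‖ ^ 2) ^ N)⁻¹ * Real.exp (Φ x / h)) * ‖g y‖ := by
    refine norm_integral_le_of_norm_le (hI.const_mul _) (ae_of_all _ fun y => ?_)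
    rw [norm_mul]
    by_cases hy : g y = 0
    · simp [hy]
    gcongr
    rw [norm_bergKernel, mul_comm]
    gcongr
    rw [← div_eq_mul_inv, le_div_iff₀ hs0]
    -- On the support of `g`, growth in `x` is controlled by growth in `x - y`, which the Gaussian
    -- absorbs.
    have h2 : Real.sqrt (1 + ‖x‖ ^ 2) ≤ (1 + |k|) * (1 + ‖x - y‖) := by
      have h3 : Real.sqrt (1 + ‖x‖ ^ 2) ≤ 1 + ‖x‖ := by
        rw [Real.sqrt_le_left (by positivity)]; nlinarith [norm_nonneg x]
      have h4 : ‖x‖ ≤ ‖x - y‖ + ‖y‖ := by simpa using norm_add_le (x - y) y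
      have h5 := hk' y hy
      nlinarith [norm_nonneg (x - y), abs_nonneg k]
    have h6 : Real.exp (-leviR Φ (x - y) (x - y) / h) ≤ Real.exp (-(ρ / h) * ‖x - y‖ ^ 2) := by
      rw [Real.exp_le_exp, show -(ρ / h) * ‖x - y‖ ^ 2 = -(ρ * ‖x - y‖ ^ 2) / h by ring]
      gcongr
      exact hR _
    calc _ ≤ Real.exp (-(ρ / h) * ‖x - y‖ ^ 2) * ((1 + |k|) * (1 + ‖x - y‖)) ^ N := by gcongr
      _ = (1 + |k|) ^ N * ((1 + ‖x - y‖) ^ N * Real.exp (-(ρ / h) * ‖x - y‖ ^ 2)) := by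
        rw [mul_pow]; ring
      _ ≤ _ := by gcongr; exact hCN _ (norm_nonneg _)
  rw [integral_const_mul] at h1
  calc _ ≤ ‖(gaussMass Φ 2 h : ℂ)⁻¹‖ * (((1 + |k|) ^ N * C * (Real.sqrt (1 + ‖x‖ ^ 2) ^ N)⁻¹ *
        Real.exp (Φ x / h)) * ∫ y, ‖g y‖) := by gcongr
    _ = _ := by ring

lemma weighted_sub (Φ : Cn n → ℝ) (h : ℝ) (u v : Cn n → ℂ) :
    weighted Φ h (u - v) = weighted Φ h u - weighted Φ h v := by
  ext x; simp only [weighted, Pi.sub_apply]; ring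

/-- Functions of rapid decay are dense in `H_Φ`. -/
lemma exists_rapidDecay_seq (hρ : 0 < ρ) (hR : ∀ v, ρ * ‖v‖ ^ 2 ≤ leviR Φ v v) (hh : 0 < h)
    {u : Cn n → ℂ} (hu : MemH Φ h u) : ∃ U : ℕ → Cn n → ℂ, (∀ k, RapidDecay Φ h (U k)) ∧
      Tendsto (fun k => eLpNorm (weighted Φ h (U k - u)) 2 volume) atTop (𝓝 0) := by
  obtain ⟨C, hC, hb⟩ := eLpNorm_bergProj_le hρ hR hh
  -- The weighted function is approximated in `L²` by compactly supported continuous functions,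
  -- which are then projected: the projection is bounded, fixes `u`, and sends them to functions of
  -- rapid decay.
  have hex : ∀ k : ℕ, ∃ g : Cn n → ℂ, HasCompactSupport g ∧
      eLpNorm (weighted Φ h u - g) 2 volume ≤ ((k : ℝ≥0∞) + 1)⁻¹ ∧ Continuous g ∧
        MemLp g 2 volume := fun k =>
    hu.2.exists_hasCompactSupport_eLpNorm_sub_le (by norm_num) (by simp)
  choose g hgs hgn hgc hgm using hex
  refine ⟨fun k => bergProj Φ h (g k), fun k => rapidDecay_bergProj hρ hR hh (hgc k) (hgs k), ?_⟩
  have hle : ∀ k, eLpNorm (weighted Φ h (bergProj Φ h (g k) - u)) 2 volume ≤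
      C * ((k : ℝ≥0∞) + 1)⁻¹ := by
    intro k
    conv_lhs => rw [← bergProj_weighted hρ hR hh hu, ← bergProj_sub hρ hR hh (hgm k) hu.2]
    refine (hb _ ((hgm k).1.sub hu.2.1)).trans ?_
    gcongr
    rw [eLpNorm_sub_comm]
    exact hgn k
  have hlim : Tendsto (fun k : ℕ => C * ((k : ℝ≥0∞) + 1)⁻¹) atTop (𝓝 0) := by
    have h1 : Tendsto (fun k : ℕ => ((k : ℝ≥0∞) + 1)⁻¹) atTop (𝓝 0) := by
      have := (tendsto_add_atTop_iff_nat 1).2 ENNReal.tendsto_inv_nat_nhds_zero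
      simpa using this
    simpa using ENNReal.Tendsto.const_mul h1 (Or.inr hC)
  exact tendsto_of_tendsto_of_tendsto_of_le_of_le tendsto_const_nhds hlim (fun _ => zero_le) hle

/-- `H_Φ` is complete. -/
lemma exists_limit (hρ : 0 < ρ) (hR : ∀ v, ρ * ‖v‖ ^ 2 ≤ leviR Φ v v) (hh : 0 < h)
    {V : ℕ → Cn n → ℂ} (hV : ∀ k, MemH Φ h (V k))
    (hc : ∀ ε : ℝ≥0∞, 0 < ε → ∃ N : ℕ, ∀ k, N ≤ k → ∀ l, N ≤ l →
      eLpNorm (weighted Φ h (V k - V l)) 2 volume < ε) :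
    ∃ v, MemH Φ h v ∧
      Tendsto (fun k => eLpNorm (weighted Φ h (V k - v)) 2 volume) atTop (𝓝 0) := by
  obtain ⟨C, hC, hb⟩ := eLpNorm_bergProj_le hρ hR hh
  have hcau : CauchySeq fun k => (hV k).2.toLp (weighted Φ h (V k)) := by
    rw [EMetric.cauchySeq_iff]
    intro ε hε
    obtain ⟨N, hN⟩ := hc ε hε
    refine ⟨N, fun k hk l hl => ?_⟩
    rw [Lp.edist_toLp_toLp, ← weighted_sub]
    exact hN k hk l hl
  obtain ⟨w', hwl⟩ := cauchySeq_tendsto_of_complete hcau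
  obtain ⟨w, hw, rfl⟩ : ∃ (w : Cn n → ℂ) (hw : MemLp w 2 volume), w' = hw.toLp w :=
    ⟨w', Lp.memLp w', (Lp.toLp_coeFn w' _).symm⟩
  rw [tendsto_iff_edist_tendsto_0] at hwl
  simp only [Lp.edist_toLp_toLp] at hwl
  -- The `L²` limit `w` is not known to come from a holomorphic function, but its projection does;
  -- since the projection is bounded and fixes every `V k`, it is the limit in `H_Φ`.
  refine ⟨bergProj Φ h w, memH_bergProj hρ hR hh hw, ?_⟩
  have hle : ∀ k, eLpNorm (weighted Φ h (V k - bergProj Φ h w)) 2 volume ≤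
      C * eLpNorm (weighted Φ h (V k) - w) 2 volume := by
    intro k
    conv_lhs => rw [← bergProj_weighted hρ hR hh (hV k), ← bergProj_sub hρ hR hh (hV k).2 hw]
    exact hb _ ((hV k).2.1.sub hw.1)
  have hlim : Tendsto (fun k => C * eLpNorm (weighted Φ h (V k) - w) 2 volume) atTop (𝓝 0) := by
    simpa using ENNReal.Tendsto.const_mul hwl (Or.inr hC)
  exact tendsto_of_tendsto_of_tendsto_of_le_of_le tendsto_const_nhds hlim (fun _ => zero_le) hle

end Projection

/-- A triangle inequality in `L²` in which only one of the majorants is measurable. -/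
lemma eLpNorm_two_le_of_enorm_le_add {α : Type*} [MeasurableSpace α] {μ : Measure α}
    {f g k : α → ℂ} (hk : AEStronglyMeasurable k μ) (h : ∀ᵐ x ∂μ, ‖f x‖ₑ ≤ ‖g x‖ₑ + ‖k x‖ₑ) :
    eLpNorm f 2 μ ≤ 2 * (eLpNorm g 2 μ + eLpNorm k 2 μ) := by
  simp only [eLpNorm_eq_lintegral_rpow_enorm_toReal (p := 2) (by norm_num) (by norm_num),
    ENNReal.toReal_ofNat]
  have h1 : ∫⁻ x, ‖f x‖ₑ ^ (2 : ℝ) ∂μ ≤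
      2 * (∫⁻ x, ‖g x‖ₑ ^ (2 : ℝ) ∂μ + ∫⁻ x, ‖k x‖ₑ ^ (2 : ℝ) ∂μ) := by
    rw [← lintegral_add_right' _ (hk.enorm.pow_const _), ← lintegral_const_mul' _ _ (by norm_num)]
    refine lintegral_mono_ae (h.mono fun x hx => ?_)
    calc _ ≤ (‖g x‖ₑ + ‖k x‖ₑ) ^ (2 : ℝ) := ENNReal.rpow_le_rpow hx (by norm_num)
      _ ≤ 2 ^ ((2 : ℝ) - 1) * (‖g x‖ₑ ^ (2 : ℝ) + ‖k x‖ₑ ^ (2 : ℝ)) :=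
        ENNReal.rpow_add_le_mul_rpow_add_rpow _ _ (by norm_num)
      _ = _ := by norm_num
  calc _ ≤ (2 * (∫⁻ x, ‖g x‖ₑ ^ (2 : ℝ) ∂μ + ∫⁻ x, ‖k x‖ₑ ^ (2 : ℝ) ∂μ)) ^ (1 / 2 : ℝ) :=
        ENNReal.rpow_le_rpow h1 (by norm_num)
    _ = 2 ^ (1 / 2 : ℝ) *
        (∫⁻ x, ‖g x‖ₑ ^ (2 : ℝ) ∂μ + ∫⁻ x, ‖k x‖ₑ ^ (2 : ℝ) ∂μ) ^ (1 / 2 : ℝ) :=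
        ENNReal.mul_rpow_of_nonneg _ _ (by norm_num)
    _ ≤ 2 ^ (1 : ℝ) * ((∫⁻ x, ‖g x‖ₑ ^ (2 : ℝ) ∂μ) ^ (1 / 2 : ℝ) +
        (∫⁻ x, ‖k x‖ₑ ^ (2 : ℝ) ∂μ) ^ (1 / 2 : ℝ)) := by
        refine mul_le_mul' (ENNReal.rpow_le_rpow_of_exponent_le (by norm_num) (by norm_num))
          (ENNReal.rpow_add_le_add_rpow _ _ (by norm_num) (by norm_num))
    _ = _ := by rw [ENNReal.rpow_one]

/-! ### Extension of the Weyl quantization by continuity. -/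

section RapidDecay

variable {n : ℕ} {Φ : QuadraticForm ℝ (Cn n)} {h : ℝ}

lemma RapidDecay.sub {u v : Cn n → ℂ} (hu : RapidDecay Φ h u) (hv : RapidDecay Φ h v) :
    RapidDecay Φ h (u - v) := by
  refine ⟨hu.1.sub hv.1, fun N => ?_⟩
  obtain ⟨C, hC⟩ := hu.2 N
  obtain ⟨D, hD⟩ := hv.2 N
  refine ⟨C + D, fun x => ?_⟩
  calc _ ≤ ‖u x‖ + ‖v x‖ := norm_sub_le _ _
    _ ≤ C * (Real.sqrt (1 + ‖x‖ ^ 2) ^ N)⁻¹ * Real.exp (Φ x / h) +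
        D * (Real.sqrt (1 + ‖x‖ ^ 2) ^ N)⁻¹ * Real.exp (Φ x / h) := add_le_add (hC x) (hD x)
    _ = _ := by ring

lemma continuous_weighted {Ψ : Cn n → ℝ} (hΨ : Continuous Ψ) {u : Cn n → ℂ} (hu : Continuous u) :
    Continuous (weighted Ψ h u) := by
  unfold weighted
  fun_prop

lemma norm_weighted (Ψ : Cn n → ℝ) (h : ℝ) (u : Cn n → ℂ) (x : Cn n) :
    ‖weighted Ψ h u x‖ = ‖u x‖ * Real.exp (-Ψ x / h) := by
  rw [weighted, norm_mul, Complex.norm_real, Real.norm_of_nonneg (Real.exp_pos _).le]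

lemma RapidDecay.memH {u : Cn n → ℂ} (hu : RapidDecay Φ h u) : MemH Φ h u := by
  have hc := continuous_weighted (h := h) (continuous_quadForm Φ) hu.1.continuous
  refine ⟨hu.1, (memLp_two_iff_integrable_sq_norm hc.aestronglyMeasurable).2 ?_⟩
  obtain ⟨C, hC⟩ := hu.exists_bound 0
  refine (hu.integrable.const_mul C).mono' (by fun_prop) (ae_of_all _ fun x => ?_)
  rw [Real.norm_of_nonneg (by positivity), norm_weighted, sq]
  gcongr
  simpa using hC x

variable {a : Lambda Φ → ℂ} {s M r : ℝ}

lemma weylGamma_sub (hσ : GevreyNorm s M r fun x => a (lift Φ x)) {u v : Cn n → ℂ}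
    (hu : RapidDecay Φ h u) (hv : RapidDecay Φ h v) :
    weylGamma Φ a h (u - v) = weylGamma Φ a h u - weylGamma Φ a h v := by
  ext x
  have h1 := integrable_weyl_integrand hσ.1.continuous hσ.norm_le hu x
  have h2 := integrable_weyl_integrand hσ.1.continuous hσ.norm_le hv x
  simp only [weylGamma_eq, Pi.sub_apply]
  rw [← mul_sub, ← integral_sub h1 h2]
  congr 2; ext y; ring

/-- The symbol is not analytic and depends on `x` through the midpoint. Taking the midpoint `w` as
integration variable removes `x` from the symbol; what remains is holomorphic in `x`, since `lam Φ
w` is complex linear and `u` is holomorphic. -/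
lemma differentiable_weylGamma (hσ : GevreyNorm s M r fun x => a (lift Φ x)) {u : Cn n → ℂ}
    (hu : RapidDecay Φ h u) (hh : 0 < h) : Differentiable ℂ (weylGamma Φ a h u) := by
  set d := Module.finrank ℝ (Cn n) with hd
  have hsub : ∀ x, weylGamma Φ a h u x =
      ((1 / (2 * Real.pi * h) ^ n : ℝ) * contourConst Φ) * ((|((2 : ℝ) ^ d)⁻¹| : ℝ)⁻¹ : ℝ) *
      ∫ w, Complex.exp (2 * lam Φ w ((2 : ℂ) • x - (2 : ℂ) • w) / h) * a (lift Φ w) *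
        u ((2 : ℂ) • w - x) := by
    intro x
    rw [weylGamma_eq, mul_assoc (_ * contourConst Φ) _ (∫ w, _)]
    congr 1
    set F : Cn n → ℂ := fun y =>
      Complex.exp (2 * lam Φ (mid x y) (x - y) / h) * a (lift Φ (mid x y)) * u y with hF
    have h1 := Measure.integral_comp_smul (volume : Measure (Cn n)) (fun y => F (y - x)) 2
    rw [integral_sub_right_eq_self F x] at h1
    have h2 : ∀ w, F ((2 : ℝ) • w - x) =
        Complex.exp (2 * lam Φ w ((2 : ℂ) • x - (2 : ℂ) • w) / h) * a (lift Φ w) *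
          u ((2 : ℂ) • w - x) := by
      intro w
      have e1 : (2 : ℝ) • w - x = (2 : ℂ) • w - x := by
        rw [← Complex.coe_smul]; norm_num
      have e2 : mid x ((2 : ℝ) • w - x) = w := by rw [mid]; module
      have e3 : x - ((2 : ℂ) • w - x) = (2 : ℂ) • x - (2 : ℂ) • w := by module
      change Complex.exp _ * _ * _ = _
      rw [e2, e1, e3]
    rw [← integral_congr_ae (ae_of_all _ h2), h1, Complex.real_smul, ← mul_assoc, ← Complex.ofReal_mul, inv_mul_cancel₀ (by positivity),
      Complex.ofReal_one, one_mul]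
  rw [funext hsub]
  refine Differentiable.const_mul ?_ _
  refine differentiable_integral_of_locally_dominated (ν := volume)
    (F := fun x w => Complex.exp (2 * lam Φ w ((2 : ℂ) • x - (2 : ℂ) • w) / h) * a (lift Φ w) *
      u ((2 : ℂ) • w - x)) (fun x => ?_) (fun w => ?_) (fun x₀ => ?_)
  · have h1 := continuous_lam Φ (f := fun w : Cn n => w)
      (g := fun w => (2 : ℂ) • x - (2 : ℂ) • w) continuous_id (by fun_prop)
    have h2 := hσ.1.continuous
    have h3 := hu.1.continuous
    have h4 : Continuous fun w => Complex.exp (2 * lam Φ w ((2 : ℂ) • x - (2 : ℂ) • w) / h) := by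
      fun_prop
    exact ((h4.mul h2).mul (h3.comp (by fun_prop))).aestronglyMeasurable
  · have h1 := (lam Φ w).differentiable
    have h3 := hu.1
    fun_prop
  · obtain ⟨A, hA⟩ := (isCompact_closedBall x₀ 1).exists_bound_of_continuousOn
      (continuous_quadForm Φ).continuousOn
    obtain ⟨C, hC⟩ := hu.exists_bound (d + 1)
    have hI := integrable_one_add_norm (E := Cn n) (μ := volume) (r := (d + 1 : ℕ)) (by simp [hd])
    simp only [Real.rpow_neg (show (0 : ℝ) ≤ 1 + ‖(_ : Cn n)‖ by positivity),
      Real.rpow_natCast] at hI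
    have hM := hσ.nonneg
    have hC0 : 0 ≤ C := by
      have := le_trans (by positivity) (hC 0)
      simpa using this
    refine ⟨1, one_pos, _, hI.const_mul (Real.exp (A / h) * M * C * (2 + ‖x₀‖) ^ (d + 1)),
      fun x hx w => ?_⟩
    set y := (2 : ℂ) • w - x with hy
    have hw : w = mid x y := by
      rw [mid, hy, add_sub_cancel, ← Complex.coe_smul, smul_smul]; norm_num
    have e3 : (2 : ℂ) • x - (2 : ℂ) • w = x - y := by rw [hy]; module
    have h2 : Φ x ≤ A := (le_abs_self _).trans (hA x (Metric.ball_subset_closedBall hx))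
    have h4 : ‖Complex.exp (2 * lam Φ w ((2 : ℂ) • x - (2 : ℂ) • w) / h)‖ =
        Real.exp (Φ x / h) * Real.exp (-Φ y / h) := by
      rw [e3, hw, norm_exp_phase]
    have h5 : 1 + ‖w‖ ≤ (2 + ‖x₀‖) * (1 + ‖y‖) := by
      have h6 : ‖w‖ = 1 / 2 * ‖x + y‖ := by rw [hw, mid, norm_smul]; norm_num
      have h7 := norm_add_le x y
      have h8 : ‖x‖ ≤ 1 + ‖x₀‖ := by
        have := norm_add_le (x - x₀) x₀
        rw [sub_add_cancel, ← dist_eq_norm] at this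
        linarith [Metric.mem_ball.1 hx]
      nlinarith [norm_nonneg y, norm_nonneg x₀, mul_nonneg (norm_nonneg y) (norm_nonneg x₀)]
    have h9 : ((1 + ‖y‖) ^ (d + 1))⁻¹ ≤ (2 + ‖x₀‖) ^ (d + 1) * ((1 + ‖w‖) ^ (d + 1))⁻¹ := by
      rw [← div_eq_mul_inv, inv_eq_one_div, div_le_div_iff₀ (by positivity) (by positivity),
        one_mul, ← mul_pow]
      gcongr
    rw [norm_mul, norm_mul, h4]
    calc _ ≤ Real.exp (A / h) * Real.exp (-Φ y / h) * M * ‖u y‖ := by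
          gcongr; exact hσ.norm_le w
      _ = Real.exp (A / h) * M * (‖u y‖ * Real.exp (-Φ y / h)) := by ring
      _ ≤ Real.exp (A / h) * M * (C * ((2 + ‖x₀‖) ^ (d + 1) * ((1 + ‖w‖) ^ (d + 1))⁻¹)) := by
          refine mul_le_mul_of_nonneg_left ((hC y).trans ?_) (by positivity)
          gcongr
      _ = _ := by ring

/-- The extension by continuity exists and is unique once the operator is bounded on functions of
rapid decay. -/
lemma existsUnique_isWeylImage {ρ : ℝ} (hρ : 0 < ρ) (hR : ∀ v, ρ * ‖v‖ ^ 2 ≤ leviR Φ v v)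
    (hh : 0 < h) (hσ : GevreyNorm s M r fun x => a (lift Φ x)) {K : ℝ≥0∞} (hK : K ≠ ⊤)
    (hb : ∀ u, RapidDecay Φ h u →
      eLpNorm (weighted Φ h (weylGamma Φ a h u)) 2 volume ≤ K * eLpNorm (weighted Φ h u) 2 volume)
    {u : Cn n → ℂ} (hu : MemH Φ h u) : ∃! v, IsWeylImage Φ a h u v := by
  have hΦc := continuous_quadForm Φ
  have hmem : ∀ u, RapidDecay Φ h u → MemH Φ h (weylGamma Φ a h u) := fun u hu =>
    ⟨differentiable_weylGamma hσ hu hh, (continuous_weighted hΦc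
      (differentiable_weylGamma hσ hu hh).continuous).aestronglyMeasurable,
      (hb u hu).trans_lt (ENNReal.mul_lt_top hK.lt_top hu.memH.2.2)⟩
  have htri : ∀ U V : Cn n → ℂ, RapidDecay Φ h U → RapidDecay Φ h V →
      eLpNorm (weighted Φ h (weylGamma Φ a h U - weylGamma Φ a h V)) 2 volume ≤
        K * (eLpNorm (weighted Φ h (U - u)) 2 volume +
          eLpNorm (weighted Φ h (V - u)) 2 volume) := by
    intro U V hU hV
    rw [← weylGamma_sub hσ hU hV]
    refine (hb _ (hU.sub hV)).trans ?_
    gcongr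
    have e : weighted Φ h (U - V) = weighted Φ h (U - u) - weighted Φ h (V - u) := by
      rw [← weighted_sub, sub_sub_sub_cancel_right]
    rw [e]
    refine eLpNorm_sub_le ?_ ?_ (by norm_num)
    · exact (continuous_weighted hΦc (hU.1.continuous.sub hu.1.continuous)).aestronglyMeasurable
    · exact (continuous_weighted hΦc (hV.1.continuous.sub hu.1.continuous)).aestronglyMeasurable
  obtain ⟨U, hU, hUl⟩ := exists_rapidDecay_seq hρ hR hh hu
  obtain ⟨v, hv, hvl⟩ := exists_limit hρ hR hh (fun k => hmem _ (hU k)) (fun ε hε => by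
    have hε2 : 0 < ε / 2 := ENNReal.half_pos hε.ne'
    have h2 : Tendsto (fun k => K * eLpNorm (weighted Φ h (U k - u)) 2 volume) atTop (𝓝 0) := by
      simpa using ENNReal.Tendsto.const_mul hUl (Or.inr hK)
    obtain ⟨N, hN⟩ := eventually_atTop.1 (h2.eventually (gt_mem_nhds hε2))
    refine ⟨N, fun k hk l hl => (htri _ _ (hU k) (hU l)).trans_lt ?_⟩
    rw [mul_add, ← ENNReal.add_halves ε]
    exact ENNReal.add_lt_add (hN k hk) (hN l hl))
  refine ⟨v, ⟨hv, U, hU, hUl, hvl⟩, ?_⟩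
  rintro v' ⟨hv', U', hU', hUl', hvl'⟩
  have hz : eLpNorm (weighted Φ h (v' - v)) 2 volume ≤ 0 := by
    refine ge_of_tendsto (x := atTop) (f := fun k =>
      eLpNorm (weighted Φ h (weylGamma Φ a h (U' k) - v')) 2 volume +
      (K * (eLpNorm (weighted Φ h (U' k - u)) 2 volume +
          eLpNorm (weighted Φ h (U k - u)) 2 volume) +
        eLpNorm (weighted Φ h (weylGamma Φ a h (U k) - v)) 2 volume)) ?_
      (Eventually.of_forall fun k => ?_)
    · have h1 := hvl'.add ((ENNReal.Tendsto.const_mul (a := K) (hUl'.add hUl) (Or.inr hK)).add hvl)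
      simpa using h1
    · have m1 := (hmem _ (hU' k)).1.continuous
      have m2 := (hmem _ (hU k)).1.continuous
      have c1 := continuous_weighted (h := h) hΦc (m1.sub hv'.1.continuous)
      have c2 := continuous_weighted (h := h) hΦc (m2.sub hv.1.continuous)
      have c3 := continuous_weighted (h := h) hΦc (m1.sub m2)
      have e : weighted Φ h (v' - v) = -weighted Φ h (weylGamma Φ a h (U' k) - v') +
          (weighted Φ h (weylGamma Φ a h (U' k) - weylGamma Φ a h (U k)) +
            weighted Φ h (weylGamma Φ a h (U k) - v)) := by
        ext x; simp only [weighted, Pi.sub_apply, Pi.add_apply, Pi.neg_apply]; ring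
      rw [e]
      refine (eLpNorm_add_le c1.neg.aestronglyMeasurable
        (c3.add c2).aestronglyMeasurable (by norm_num)).trans ?_
      rw [eLpNorm_neg]
      gcongr
      refine (eLpNorm_add_le c3.aestronglyMeasurable c2.aestronglyMeasurable
        (by norm_num)).trans ?_
      gcongr
      exact htri _ _ (hU' k) (hU k)
  have hc := continuous_weighted (h := h) hΦc (hv'.1.continuous.sub hv.1.continuous)
  have h0 := (eLpNorm_eq_zero_iff hc.aestronglyMeasurable (by norm_num)).1 (le_antisymm hz zero_le)
  have h1 : weighted Φ h (v' - v) = 0 := Continuous.ae_eq_iff_eq volume hc continuous_const |>.1 h0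
  ext x
  have h2 := congrFun h1 x
  simp only [weighted, Pi.sub_apply, Pi.zero_apply, mul_eq_zero, Complex.ofReal_eq_zero,
    (Real.exp_pos _).ne', or_false] at h2
  exact sub_eq_zero.1 h2

end RapidDecay

/-! ### Comparison of the spaces for the two weights. -/

section Weights

variable {n : ℕ} {h : ℝ}

lemma contDiff_quadForm (Φ : QuadraticForm ℝ (Cn n)) : ContDiff ℝ 1 fun x => Φ x := by
  simp only [← polarB_self]
  exact (polarB Φ).contDiff.clm_apply contDiff_id

/-- The constant `e^{ε/h}` is not uniform in `h`. It is used only at fixed `h`, to transfer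
membership and convergence between the weights, and does not enter the final estimate. -/
lemma eLpNorm_weighted_le {Ψ Ψ' : Cn n → ℝ} {ε : ℝ} (hh : 0 < h) (hΨ : ∀ x, Ψ' x - ε ≤ Ψ x)
    (u : Cn n → ℂ) (μ : Measure (Cn n)) : eLpNorm (weighted Ψ h u) 2 μ ≤
      ENNReal.ofReal (Real.exp (ε / h)) * eLpNorm (weighted Ψ' h u) 2 μ := by
  refine eLpNorm_le_mul_eLpNorm_of_ae_le_mul (ae_of_all _ fun x => ?_) 2
  rw [norm_weighted, norm_weighted, mul_left_comm, ← Real.exp_add, ← add_div]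
  gcongr
  linarith [hΨ x]

lemma MemH.of_le {Ψ Ψ' : Cn n → ℝ} {ε : ℝ} (hh : 0 < h) (hΨ : ∀ x, Ψ' x - ε ≤ Ψ x)
    (hc : Continuous Ψ) {u : Cn n → ℂ} (hu : MemH Ψ' h u) : MemH Ψ h u :=
  ⟨hu.1, (continuous_weighted hc hu.1.continuous).aestronglyMeasurable,
    (eLpNorm_weighted_le hh hΨ u volume).trans_lt
      (ENNReal.mul_lt_top ENNReal.ofReal_lt_top hu.2.2)⟩

lemma massOn_eq {Ψ : Cn n → ℝ} {u : Cn n → ℂ} (hu : MemH Ψ h u) (S : Set (Cn n)) :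
    massOn Ψ h S u = (eLpNorm (weighted Ψ h u) 2 (volume.restrict S)).toReal ^ 2 := by
  have h1 := (hu.2.restrict S).eLpNorm_eq_integral_rpow_norm (by norm_num) (by norm_num)
  have h2 : ∀ x, ‖weighted Ψ h u x‖ ^ (2 : ℝ) = ‖u x‖ ^ 2 * Real.exp (-2 * Ψ x / h) := fun x => by
    rw [norm_weighted, Real.rpow_ofNat, mul_pow, ← Real.exp_nat_mul]
    congr 2; push_cast; ring
  simp only [ENNReal.toReal_ofNat, h2] at h1
  have h3 : 0 ≤ ∫ x in S, ‖u x‖ ^ 2 * Real.exp (-2 * Ψ x / h) :=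
    integral_nonneg fun x => by positivity
  rw [h1, ENNReal.toReal_ofReal (by positivity), massOn, ← Real.rpow_mul_natCast h3]
  norm_num

end Weights

/-! ### Boundedness, and the elliptic estimate. -/

section Estimate

variable {n : ℕ} {Φ : QuadraticForm ℝ (Cn n)} {h : ℝ} {a : Lambda Φ → ℂ}

/-- Boundedness of the Weyl quantization from the comparison with a multiplication operator. -/
lemma weylGamma_bounded {κ : ℂ} {b : Cn n → ℂ} {B : ℝ} (hb : ∀ x, ‖b x‖ ≤ B) {L : ℝ≥0∞} (hL : L ≠ ⊤)
    (hop : ∀ u, RapidDecay Φ h u → eLpNorm (fun x => (weylGamma Φ a h u x - κ * b x * u x) *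
      (Real.exp (-Φ x / h) : ℂ)) 2 volume ≤ L * eLpNorm (weighted Φ h u) 2 volume) :
    ∃ K : ℝ≥0∞, K ≠ ⊤ ∧ ∀ u, RapidDecay Φ h u →
      eLpNorm (weighted Φ h (weylGamma Φ a h u)) 2 volume ≤
        K * eLpNorm (weighted Φ h u) 2 volume := by
  refine ⟨2 * (L + ‖κ * B‖ₑ), ENNReal.mul_ne_top (by norm_num)
    (ENNReal.add_ne_top.2 ⟨hL, enorm_ne_top⟩), fun u hu => ?_⟩
  have hk : AEStronglyMeasurable ((κ * B) • weighted Φ h u) volume :=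
    hu.memH.2.1.const_smul _
  refine (eLpNorm_two_le_of_enorm_le_add (g := fun x => (weylGamma Φ a h u x - κ * b x * u x) *
    (Real.exp (-Φ x / h) : ℂ)) hk (ae_of_all _ fun x => ?_)).trans ?_
  · have e : weighted Φ h (weylGamma Φ a h u) x = (weylGamma Φ a h u x - κ * b x * u x) *
        (Real.exp (-Φ x / h) : ℂ) + κ * b x * weighted Φ h u x := by
      simp only [weighted]; ring
    rw [e]
    refine (enorm_add_le _ _).trans (add_le_add le_rfl ?_)
    rw [Pi.smul_apply, smul_eq_mul, enorm_mul, enorm_mul, enorm_mul, enorm_mul]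
    gcongr
    rw [← ofReal_norm, ← ofReal_norm]
    exact ENNReal.ofReal_le_ofReal ((hb x).trans (by
      rw [Complex.norm_real]; exact le_abs_self _))
  · rw [mul_assoc, add_mul, eLpNorm_const_smul]
    gcongr
    exact hop u hu

/-- The elliptic estimate for functions of rapid decay. -/
lemma elliptic_estimate_rapidDecay {Φ₁ : Cn n → ℝ} {κ : ℂ} {b : Cn n → ℂ} {L : ℝ≥0∞}
    {S : Set (Cn n)} (hS : MeasurableSet S) {c : ℝ} (hc : 0 ≤ c)
    (hb : ∀ x ∈ S, c ≤ ‖κ * b x‖) {u : Cn n → ℂ}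
    (hm : AEStronglyMeasurable (weighted Φ₁ h (weylGamma Φ a h u)) volume)
    (hop : eLpNorm (fun x => (weylGamma Φ a h u x - κ * b x * u x) *
      (Real.exp (-Φ₁ x / h) : ℂ)) 2 (volume.restrict S) ≤
        L * eLpNorm (weighted Φ₁ h u) 2 volume) :
    ENNReal.ofReal c * eLpNorm (weighted Φ₁ h u) 2 (volume.restrict S) ≤
      2 * (L * eLpNorm (weighted Φ₁ h u) 2 volume +
        eLpNorm (weighted Φ₁ h (weylGamma Φ a h u)) 2 volume) := by
  have e : ENNReal.ofReal c * eLpNorm (weighted Φ₁ h u) 2 (volume.restrict S) =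
      eLpNorm ((c : ℂ) • weighted Φ₁ h u) 2 (volume.restrict S) := by
    rw [eLpNorm_const_smul, ← ofReal_norm, Complex.norm_real, Real.norm_of_nonneg hc]
  rw [e]
  refine (eLpNorm_two_le_of_enorm_le_add (g := fun x => (weylGamma Φ a h u x - κ * b x * u x) *
    (Real.exp (-Φ₁ x / h) : ℂ)) hm.restrict (ae_restrict_of_forall_mem hS fun x hx => ?_)).trans ?_
  · have e1 : κ * b x * weighted Φ₁ h u x = -((weylGamma Φ a h u x - κ * b x * u x) *
        (Real.exp (-Φ₁ x / h) : ℂ)) + weighted Φ₁ h (weylGamma Φ a h u) x := by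
      simp only [weighted]; ring
    have e2 : ‖κ * b x * weighted Φ₁ h u x‖ₑ ≤ ‖(weylGamma Φ a h u x - κ * b x * u x) *
        (Real.exp (-Φ₁ x / h) : ℂ)‖ₑ + ‖weighted Φ₁ h (weylGamma Φ a h u) x‖ₑ := by
      rw [e1]
      refine (enorm_add_le _ _).trans_eq ?_
      rw [enorm_neg]
    refine le_trans ?_ e2
    rw [Pi.smul_apply, smul_eq_mul, enorm_mul, enorm_mul]
    gcongr
    rw [← ofReal_norm, ← ofReal_norm, Complex.norm_real, Real.norm_of_nonneg hc]
    exact ENNReal.ofReal_le_ofReal (hb x hx)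
  · exact mul_le_mul' le_rfl
      (add_le_add hop (eLpNorm_mono_measure _ Measure.restrict_le_self))

/-- The elliptic estimate passes to the extension by continuity. -/
lemma elliptic_estimate_of_isWeylImage (hh : 0 < h) {Φ₁ : Cn n → ℝ} (hΦ₁ : Continuous Φ₁) {ε : ℝ}
    (hle : ∀ x, Φ x - ε ≤ Φ₁ x) {L : ℝ≥0∞} (hL : L ≠ ⊤) {S : Set (Cn n)} {c : ℝ}
    (hdiff : ∀ u, RapidDecay Φ h u → Continuous (weylGamma Φ a h u))
    (hest : ∀ u, RapidDecay Φ h u →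
      ENNReal.ofReal c * eLpNorm (weighted Φ₁ h u) 2 (volume.restrict S) ≤
        2 * (L * eLpNorm (weighted Φ₁ h u) 2 volume +
          eLpNorm (weighted Φ₁ h (weylGamma Φ a h u)) 2 volume))
    {u v : Cn n → ℂ} (hu : Continuous u) (huv : IsWeylImage Φ a h u v) :
    ENNReal.ofReal c * eLpNorm (weighted Φ₁ h u) 2 (volume.restrict S) ≤
        2 * (L * eLpNorm (weighted Φ₁ h u) 2 volume + eLpNorm (weighted Φ₁ h v) 2 volume) := by
  obtain ⟨hv, U, hU, hUl, hvl⟩ := huv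
  have hlim : ∀ w : ℕ → Cn n → ℂ,
      Tendsto (fun k => eLpNorm (weighted Φ h (w k)) 2 volume) atTop (𝓝 0) →
      Tendsto (fun k => eLpNorm (weighted Φ₁ h (w k)) 2 volume) atTop (𝓝 0) := by
    intro w hw
    have h1 : Tendsto (fun k => ENNReal.ofReal (Real.exp (ε / h)) *
        eLpNorm (weighted Φ h (w k)) 2 volume) atTop (𝓝 0) := by
      simpa using ENNReal.Tendsto.const_mul hw (Or.inr ENNReal.ofReal_ne_top)
    exact tendsto_of_tendsto_of_tendsto_of_le_of_le tendsto_const_nhds h1 (fun _ => zero_le)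
      fun k => eLpNorm_weighted_le hh hle _ _
  have hδ := hlim _ hUl
  have hδ' := hlim _ hvl
  have tri : ∀ (f g : Cn n → ℂ) (μ : Measure (Cn n)), Continuous f → Continuous g →
      eLpNorm (weighted Φ₁ h f) 2 μ ≤
        eLpNorm (weighted Φ₁ h g) 2 μ + eLpNorm (weighted Φ₁ h (f - g)) 2 μ := by
    intro f g μ hf hg
    have e : weighted Φ₁ h f = weighted Φ₁ h g + weighted Φ₁ h (f - g) := by
      rw [weighted_sub, add_sub_cancel]
    conv_lhs => rw [e]
    exact eLpNorm_add_le (continuous_weighted hΦ₁ hg).aestronglyMeasurable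
      (continuous_weighted hΦ₁ (hf.sub hg)).aestronglyMeasurable (by norm_num)
  have hcomm : ∀ (f g : Cn n → ℂ) (μ : Measure (Cn n)), eLpNorm (weighted Φ₁ h (f - g)) 2 μ =
      eLpNorm (weighted Φ₁ h (g - f)) 2 μ := fun f g μ => by
    rw [weighted_sub, weighted_sub, eLpNorm_sub_comm]
  refine ge_of_tendsto (x := atTop) (f := fun k =>
    2 * (L * (eLpNorm (weighted Φ₁ h u) 2 volume + eLpNorm (weighted Φ₁ h (U k - u)) 2 volume) +
      (eLpNorm (weighted Φ₁ h v) 2 volume +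
        eLpNorm (weighted Φ₁ h (weylGamma Φ a h (U k) - v)) 2 volume)) +
      ENNReal.ofReal c * eLpNorm (weighted Φ₁ h (U k - u)) 2 volume) ?_
    (Eventually.of_forall fun k => ?_)
  · have h1 := ENNReal.Tendsto.const_mul (a := L)
      ((tendsto_const_nhds (x := eLpNorm (weighted Φ₁ h u) 2 volume)).add hδ) (Or.inr hL)
    have h2 := (tendsto_const_nhds (x := eLpNorm (weighted Φ₁ h v) 2 volume)).add hδ'
    have h3 := ENNReal.Tendsto.const_mul (a := 2) (h1.add h2) (Or.inr (by norm_num))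
    have h4 := h3.add (ENNReal.Tendsto.const_mul (a := ENNReal.ofReal c) hδ
      (Or.inr ENNReal.ofReal_ne_top))
    simpa using h4
  · have hUc := (hU k).1.continuous
    calc _ ≤ ENNReal.ofReal c * (eLpNorm (weighted Φ₁ h (U k)) 2 (volume.restrict S) +
          eLpNorm (weighted Φ₁ h (U k - u)) 2 volume) := by
          refine mul_le_mul' le_rfl ((tri u (U k) _ hu hUc).trans ?_)
          rw [hcomm u]
          exact add_le_add le_rfl (eLpNorm_mono_measure _ Measure.restrict_le_self)
      _ ≤ _ := by
          rw [mul_add]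
          refine add_le_add ((hest _ (hU k)).trans ?_) le_rfl
          exact mul_le_mul' le_rfl (add_le_add (mul_le_mul' le_rfl (tri _ _ _ hUc hu))
            (tri _ _ _ (hdiff _ (hU k)) hv.1.continuous))

/-- The constant `8` is from `(2(p+q))² ≤ 8(p²+q²)`. -/
lemma sq_le_of_ennreal_le {c L : ℝ} (hc : 0 < c) (hL : 0 ≤ L) {x y z : ℝ≥0∞} (hy : y ≠ ⊤)
    (hz : z ≠ ⊤) (hle : ENNReal.ofReal c * x ≤ 2 * (ENNReal.ofReal L * y + z)) :
    x.toReal ^ 2 ≤ 8 / c ^ 2 * (z.toReal ^ 2 + L ^ 2 * y.toReal ^ 2) := by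
  have h1 : c * x.toReal ≤ 2 * (L * y.toReal + z.toReal) := by
    have h2 := ENNReal.toReal_mono (by finiteness) hle
    rw [ENNReal.toReal_mul, ENNReal.toReal_mul, ENNReal.toReal_add (by finiteness) hz,
      ENNReal.toReal_mul, ENNReal.toReal_ofReal hc.le, ENNReal.toReal_ofReal hL] at h2
    simpa using h2
  have h3 : 0 ≤ c * x.toReal := by positivity
  rw [div_mul_eq_mul_div, le_div_iff₀ (by positivity)]
  have h4 := pow_le_pow_left₀ h3 h1 2
  nlinarith [sq_nonneg (L * y.toReal - z.toReal)]

end Estimate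

end BargmannWeyl

end

/-! ### Assembly of the theorem. -/

theorem proposition2p2 (n : ℕ) (Φ₀ : QuadraticForm ℝ (BargmannWeyl.Cn n))
    (hΦ₀ : BargmannWeyl.StrictlyPSH Φ₀) (s : ℝ) (hs : 1 < s)
    (a : BargmannWeyl.Lambda Φ₀ → ℂ) (ha : BargmannWeyl.GevreyLambda Φ₀ s a)
    (A : BargmannWeyl.Cn n × BargmannWeyl.Cn n → ℂ)
    (hA : BargmannWeyl.IsAlmostHolomorphicExtension Φ₀ s a A) :
    ∃ C₁ : ℝ, 0 < C₁ ∧ ∀ C : ℝ, 0 < C → ∃ h₀ : ℝ, 0 < h₀ ∧ ∃ K : ℝ, 0 < K ∧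
      ∀ h : ℝ, 0 < h → h < h₀ →
      ∀ U : Set (BargmannWeyl.Cn n), IsOpen U → Bornology.IsBounded U →
      (∀ ρ : BargmannWeyl.Lambda Φ₀, ρ.1.1 ∉ U → 2 / C ≤ ‖a ρ‖) →
      ∀ Φ₁ : BargmannWeyl.Cn n → ℝ, BargmannWeyl.IsC11 Φ₁ →
      BargmannWeyl.C11Small (fun x => Φ₁ x - Φ₀ x) (C₁⁻¹ * h ^ (1 - 1 / s)) →
      ∀ u : BargmannWeyl.Cn n → ℂ, BargmannWeyl.MemH Φ₁ h u →
        (∃! v, BargmannWeyl.IsWeylImage Φ₀ a h u v) ∧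
        ∀ v, BargmannWeyl.IsWeylImage Φ₀ a h u v →
          BargmannWeyl.MemH Φ₁ h v ∧
          BargmannWeyl.massOn Φ₁ h Uᶜ u ≤
            K * BargmannWeyl.normSqH Φ₁ h v + K * h * BargmannWeyl.normSqH Φ₁ h u := by
  open BargmannWeyl in
  obtain ⟨ρ, hρ, hR⟩ := exists_leviR_coercive hΦ₀
  obtain ⟨M, r, hr, hσ⟩ := GevreyBdd.gevreyNorm (by linarith) ha
  obtain ⟨C₁, hC₁, K, hK, h₁, hh₁, -, hop⟩ := exists_operator_bound hΦ₀ hs hr hσ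
  have hκ : 0 < ‖unitConst Φ₀‖ := norm_pos_iff.2 (unitConst_ne_zero hΦ₀)
  have hθ : 0 < 1 - 1 / s := by
    rw [sub_pos, div_lt_one (by linarith)]; exact hs
  -- The second bound on `h` is `K h^(1-1/s) ≤ 1/C`. Then `|b - a| ≤ 1/C`, so off `U` the lower
  -- bound `2/C` for `a` leaves `1/C` for `b`.
  refine ⟨C₁, hC₁, fun C hC => ⟨min h₁ ((1 / (C * K)) ^ (1 - 1 / s)⁻¹), by positivity,
    8 / (‖unitConst Φ₀‖ / C) ^ 2 * (1 + K ^ 2), by positivity, ?_⟩⟩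
  intro h hh hh0 U hU _ hell Φ₁ hΦ₁ hsmall u hu
  have hhh₁ := hh0.trans_le (min_le_left _ _)
  have hKh : K * h ^ (1 - 1 / s) ≤ 1 / C := by
    have h1 := (hh0.trans_le (min_le_right _ _)).le
    have h2 : h ^ (1 - 1 / s) ≤ 1 / (C * K) := by
      rw [Real.le_rpow_inv_iff_of_pos hh.le (by positivity) hθ] at h1
      exact h1
    calc _ ≤ K * (1 / (C * K)) := by gcongr
      _ = 1 / C := by field_simp
  have hΦ₁c : Continuous Φ₁ := hΦ₁.1.continuous
  have hΦ₀c := continuous_quadForm Φ₀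
  have hle : ∀ x, Φ₀ x - C₁⁻¹ * h ^ (1 - 1 / s) ≤ Φ₁ x := fun x => by
    linarith [(abs_le.1 (hsmall.1 x)).1]
  have hle' : ∀ x, Φ₁ x - C₁⁻¹ * h ^ (1 - 1 / s) ≤ Φ₀ x := fun x => by
    linarith [(abs_le.1 (hsmall.1 x)).2]
  have hu0 : MemH Φ₀ h u := hu.of_le hh hle' hΦ₀c
  constructor
  -- The comparison theorem with zero perturbation gives boundedness for the unperturbed weight,
  -- hence existence and uniqueness of the extension.
  · obtain ⟨b, hb, hbop⟩ := hop h hh hhh₁ Φ₀ (by simpa using contDiff_const) (by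
      have : 0 ≤ C₁⁻¹ * h ^ (1 - 1 / s) := by positivity
      simp only [sub_self]
      refine ⟨fun x => by simpa, fun x => by simpa, fun x y => ?_⟩
      simp only [fderiv_fun_const, Pi.zero_apply, sub_self, norm_zero]
      positivity)
    obtain ⟨K', hK', hbd⟩ := weylGamma_bounded (κ := unitConst Φ₀) (b := b)
      (B := M + K * h ^ (1 - 1 / s)) (fun x => by
        have h1 := norm_sub_norm_le (b x) (a (lift Φ₀ x))
        have h2 := hσ.norm_le x
        have h3 := hb x
        linarith) (L := ENNReal.ofReal (K * Real.sqrt h)) ENNReal.ofReal_ne_top (fun u hu => by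
        simpa using hbop u hu Set.univ)
    exact existsUnique_isWeylImage hρ hR hh hσ hK' hbd hu0
  · intro v hv
    have hv1 : MemH Φ₁ h v := hv.1.of_le hh hle hΦ₁c
    refine ⟨hv1, ?_⟩
    obtain ⟨b, hb, hbop⟩ := hop h hh hhh₁ Φ₁ (hΦ₁.1.sub (contDiff_quadForm Φ₀)) hsmall
    have hdiff : ∀ u, RapidDecay Φ₀ h u → Continuous (weylGamma Φ₀ a h u) := fun u hu =>
      (differentiable_weylGamma hσ hu hh).continuous
    have hbS : ∀ x ∈ Uᶜ, ‖unitConst Φ₀‖ / C ≤ ‖unitConst Φ₀ * b x‖ := by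
      intro x hx
      have h1 := hell (lift Φ₀ x) hx
      have h2 := norm_sub_norm_le (a (lift Φ₀ x)) (b x)
      have h3 := hb x
      rw [norm_sub_rev] at h3
      have h4 : 2 / C = 1 / C + 1 / C := by ring
      rw [norm_mul, div_eq_mul_one_div]
      gcongr
      linarith
    have hest := elliptic_estimate_of_isWeylImage hh hΦ₁c hle (S := Uᶜ)
      (c := ‖unitConst Φ₀‖ / C) (L := ENNReal.ofReal (K * Real.sqrt h)) ENNReal.ofReal_ne_top hdiff
      (fun w hw => elliptic_estimate_rapidDecay hU.isClosed_compl.measurableSet (by positivity) hbS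
        (continuous_weighted hΦ₁c (hdiff w hw)).aestronglyMeasurable (hbop w hw Uᶜ))
      hu.1.continuous hv
    have hfin := sq_le_of_ennreal_le (by positivity) (by positivity) hu.2.2.ne hv1.2.2.ne hest
    rw [normSqH, normSqH, massOn_eq hu, massOn_eq hu, massOn_eq hv1, Measure.restrict_univ]
    refine hfin.trans ?_
    rw [mul_pow, Real.sq_sqrt hh.le]
    set D := 8 / (‖unitConst Φ₀‖ / C) ^ 2
    have hD : 0 ≤ D := by positivity
    set X := (eLpNorm (weighted Φ₁ h v) 2 volume).toReal ^ 2
    set Y := (eLpNorm (weighted Φ₁ h u) 2 volume).toReal ^ 2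
    have hX : 0 ≤ D * K ^ 2 * X := by positivity
    have hY : 0 ≤ D * h * Y := by positivity
    nlinarith
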